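/- Let $W$ be a real space-time white noise on $\mathbb R^2$ (a centered Gaussian family $\{W(f)\}_{f\in L^2(\mathbb R^2;\mathbb R)}$ with $\mathbb E[W(f)W(g)]=\langle f,g\rangle_{L^2}$), defined on a probability space $(\Omega,\mathfrak F,\mathbb P)$, and let $\widehat W$ be its Fourier transform, i.e. $\int f\,d\widehat W:=W(\mathcal F f)$ for $f\in L^2(\mathbb R^2;\mathbb C)$, where $\mathcal F$ is the unitary Fourier transform on $L^2$ and $W$ is extended complex-linearly. Fix $H_0,H_1\in(0,1)$ with $2H_0+H_1<1$ and set $\alpha_0:=1-(2H_0+H_1)>0$. For $\kappa>0$ and an integer $n\ge 0$ let $$B^{\kappa,n}_t(x)=c_{H_0}c_{H_1}\int_{|\xi|\le 2^{2\kappa n}}\int_{|\eta|\le 2^{\kappa n}}\frac{e^{\imath\xi t}-1}{|\xi|^{H_0+\frac12}}\,\frac{e^{\imath\eta x}-1}{|\eta|^{H_1+\frac12}}\,\widehat W(d\xi,d\eta),\qquad c_H=\frac12\Big(\int_0^\infty\frac{1-\cos\xi}{|\xi|^{2H+1}}\,d\xi\Big)^{-1/2},$$ for $(t,x)\in\mathbb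 R^2$. This real Gaussian field has a version with almost surely $C^\infty$ paths on $\mathbb R^2$; fix such versions. With the heat kernel $G_t(x)=(4\pi t)^{-1/2}e^{-x^2/(4t)}\mathbf 1_{\{t>0\}}$, set $$\Psi^{\kappa,n}_t(x):=\int_0^t ds\int_{\mathbb R}dy\,G_{t-s}(x-y)\,(\partial_t\partial_xB^{\kappa,n})_s(y),\qquad t\in[0,1],\ x\in\mathbb R;$$ almost surely, for all $(t,x)\in[0,1]\times\mathbb R$ the integral converges absolutely, and $x\mapsto\Psi^{\kappa,n}_t(x)$ is continuous for every $t\in[0,1]$. For $s\in\mathbb R$ and $1\le q<\infty$ let $\mathcal W^{s,q}$ be the space of tempered distributions $f$ on $\mathbb R$ with $\|f\|_{\mathcal W^{s,q}}:=\|\mathcal F^{-1}((1+|\cdot|^2)^{s/2}\mathcal Ff)\|_{L^q(\mathbb R)}<\infty$, and $\mathcal H^s:=\mathcal W^{s,2}$. Then for every $\rho\in\mathcal C_c^\infty(\mathbb R)$ there is a random family $\rho\cdot\Psi=(\rho\cdot\Psi_t)_{t\in[0,1]}$ of tempered distributions on $\mathbb R$, depending neither on $\kappa$ nor on $\alpha$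 and $p$, such that: (1) for all $\kappa>0$, $\alpha>\alpha_0$ and $1\le p<\infty$, the sequence $(\rho\cdot\Psi^{\kappa,n})_{n\ge 0}$ converges to $\rho\cdot\Psi$ in $L^{2p}(\Omega;\mathcal C([0,1];\mathcal W^{-\alpha,2p}))$; (2) for all $\kappa>0$, $\alpha>\alpha_0$ and $0<\varsigma<\min(2H_0,H_1,\alpha-\alpha_0)$, almost surely there is a (random) constant $C$, not depending on $n$, such that for all $n\ge 1$ $$\sup_{t\in[0,1]}\big\|\rho\cdot\Psi^{\kappa,n}_t-\rho\cdot\Psi_t\big\|_{\mathcal H^{-\alpha}}\le C\,2^{-\varsigma\kappa n}.$$ -/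

import Mathlib

open MeasureTheory ProbabilityTheory Filter Topology Set
open scoped ENNReal SchwartzMap FourierTransform unitInterval

noncomputable section

namespace RoughHeat

/-! ### The Bessel-potential spaces `W^{s,p}(ℝ)` as normed spaces of tempered distributions -/

/-- The tempered distributions `f` on `ℝ` with `𝓕⁻¹((1 + |·|²)^{s/2} 𝓕 f) ∈ L^p(ℝ)`. -/
def besselSubmodule (s : ℝ) (p : ℝ≥0∞) [Fact (1 ≤ p)] : Submodule ℂ 𝓢'(ℝ, ℂ) where
  carrier := {f | TemperedDistribution.MemSobolev s p f}
  add_mem' := fun hf hg => hf.add hg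
  zero_mem' := TemperedDistribution.memSobolev_fun_zero ℝ ℂ s p
  smul_mem' := fun c _ hf => hf.smul c

/-- The space `W^{s,p}(ℝ)`. It is a type of its own, so that it carries the topology of its norm
(see below) and not the one induced by the tempered distributions. -/
def BesselSpace (s : ℝ) (p : ℝ≥0∞) [Fact (1 ≤ p)] : Type :=
  ↥(besselSubmodule s p)

namespace BesselSpace

variable {s : ℝ} {p : ℝ≥0∞} [Fact (1 ≤ p)]

instance : AddCommGroup (BesselSpace s p) :=
  inferInstanceAs (AddCommGroup ↥(besselSubmodule s p))

instance : Module ℂ (BesselSpace s p) :=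
  inferInstanceAs (Module ℂ ↥(besselSubmodule s p))

/-- The inclusion of `W^{s,p}(ℝ)` into the tempered distributions. -/
def toDist : BesselSpace s p →ₗ[ℂ] 𝓢'(ℝ, ℂ) := (besselSubmodule s p).subtype

/-- An element of `W^{s,p}(ℝ)` from a tempered distribution that belongs to it. -/
def mk (f : 𝓢'(ℝ, ℂ)) (h : TemperedDistribution.MemSobolev s p f) : BesselSpace s p := ⟨f, h⟩

theorem toDist_injective : Function.Injective (toDist : BesselSpace s p → 𝓢'(ℝ, ℂ)) :=
  Subtype.val_injective

theorem memSobolev (f : BesselSpace s p) : TemperedDistribution.MemSobolev s p f.toDist := f.2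

theorem coeLp_injective :
    Function.Injective (Lp.toTemperedDistributionCLM ℂ (volume : Measure ℝ) p) :=
  LinearMap.ker_eq_bot.mp (Lp.ker_toTemperedDistributionCLM_eq_bot (F := ℂ) (p := p))

/-- The `L^p` function `𝓕⁻¹((1 + |·|²)^{s/2} 𝓕 f)`. -/
def lpRep (f : BesselSpace s p) : Lp ℂ p (volume : Measure ℝ) :=
  Classical.choose (show ∃ g : Lp ℂ p (volume : Measure ℝ),
    TemperedDistribution.besselPotential ℝ ℂ s f.toDist = g from f.memSobolev)

theorem coe_lpRep (f : BesselSpace s p) :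
    (f.lpRep : 𝓢'(ℝ, ℂ)) = TemperedDistribution.besselPotential ℝ ℂ s f.toDist :=
  (Classical.choose_spec (show ∃ g : Lp ℂ p (volume : Measure ℝ),
    TemperedDistribution.besselPotential ℝ ℂ s f.toDist = g from f.memSobolev)).symm

theorem clm_lpRep (f : BesselSpace s p) :
    Lp.toTemperedDistributionCLM ℂ (volume : Measure ℝ) p f.lpRep =
      TemperedDistribution.besselPotential ℝ ℂ s f.toDist := by
  rw [Lp.toTemperedDistributionCLM_apply, coe_lpRep]

/-- The map `f ↦ 𝓕⁻¹((1 + |·|²)^{s/2} 𝓕 f)` from `W^{s,p}(ℝ)` to `L^p(ℝ)`, as a linear map. -/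
def toLp : BesselSpace s p →ₗ[ℂ] Lp ℂ p (volume : Measure ℝ) where
  toFun f := f.lpRep
  map_add' f g := by
    apply coeLp_injective
    rw [map_add, clm_lpRep, clm_lpRep, clm_lpRep, map_add, map_add]
  map_smul' c f := by
    apply coeLp_injective
    rw [RingHom.id_apply, map_smul, clm_lpRep, clm_lpRep, map_smul, map_smul]

theorem coe_toLp (f : BesselSpace s p) :
    (f.toLp : 𝓢'(ℝ, ℂ)) = TemperedDistribution.besselPotential ℝ ℂ s f.toDist :=
  f.coe_lpRep

theorem toLp_injective : Function.Injective (toLp : BesselSpace s p → Lp ℂ p volume) := by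
  intro f g h
  apply toDist_injective
  have h' : TemperedDistribution.besselPotential ℝ ℂ s f.toDist =
      TemperedDistribution.besselPotential ℝ ℂ s g.toDist := by
    rw [← coe_toLp, ← coe_toLp, h]
  have := congrArg (TemperedDistribution.besselPotential ℝ ℂ (-s)) h'
  simpa using this

/-- The norm of `W^{s,p}(ℝ)`: `‖f‖ = ‖𝓕⁻¹((1 + |·|²)^{s/2} 𝓕 f)‖_{L^p}`. -/
instance : NormedAddCommGroup (BesselSpace s p) :=
  NormedAddCommGroup.induced (BesselSpace s p) (Lp ℂ p (volume : Measure ℝ)) toLp toLp_injective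

instance : NormedSpace ℂ (BesselSpace s p) :=
  NormedSpace.induced ℂ (BesselSpace s p) (Lp ℂ p (volume : Measure ℝ)) toLp

end BesselSpace

open Classical in
/-- The `W^{s,p}`-norm of a tempered distribution, `∞` outside `W^{s,p}(ℝ)`. -/
def besselENorm (s : ℝ) (p : ℝ≥0∞) [Fact (1 ≤ p)] (f : 𝓢'(ℝ, ℂ)) : ℝ≥0∞ :=
  if h : TemperedDistribution.MemSobolev s p f then ‖BesselSpace.mk f h‖ₑ else ∞

/-- Makes `L^{2p}` and `W^{s,2p}` available as normed spaces for `p ≥ 1`. -/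
instance factOneLeTwoMul (p : ℝ≥0∞) [hp : Fact (1 ≤ p)] : Fact (1 ≤ 2 * p) :=
  ⟨hp.out.trans (le_mul_of_one_le_left zero_le one_le_two)⟩

open Classical in
/-- The tempered distribution `φ ↦ ∫ φ(x) f(x) dx` given by an integrable function `f`. -/
def funDist (f : ℝ → ℂ) : 𝓢'(ℝ, ℂ) :=
  if h : MemLp f 1 (volume : Measure ℝ) then
    Lp.toTemperedDistribution (h.toLp f : Lp ℂ 1 (volume : Measure ℝ))
  else 0

/-! ### White noise and its Fourier transform -/

/-- The space-time plane `ℝ²`; coordinate `0` is time and coordinate `1` is space. -/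
abbrev Plane : Type := EuclideanSpace ℝ (Fin 2)

/-- `W` is a (real) space-time white noise: a centered Gaussian family indexed by `L²(ℝ²; ℝ)`
with `E[W(f) W(g)] = ⟨f, g⟩`. -/
structure IsWhiteNoise {Ω : Type*} [MeasurableSpace Ω]
    (W : Lp ℝ 2 (volume : Measure Plane) → Ω → ℝ) (P : Measure Ω) : Prop where
  gaussian : IsGaussianProcess W P
  centered : ∀ f, ∫ ω, W f ω ∂P = 0
  covariance : ∀ f g, ∫ ω, W f ω * W g ω ∂P = inner ℝ f g

open Classical in
/-- The Wiener integral `∫ f(ξ,η) Ŵ(dξ,dη)` of a square-integrable `f : ℝ² → ℂ` against the Fourier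
transform `Ŵ` of the noise `W`, that is `W(𝓕 f)` with `𝓕` the unitary Fourier transform on `L²` and
`W` extended complex-linearly. -/
def integralHat {Ω : Type*} (W : Lp ℝ 2 (volume : Measure Plane) → Ω → ℝ)
    (f : Plane → ℂ) (ω : Ω) : ℂ :=
  if h : MemLp f 2 (volume : Measure Plane) then
    (W (Complex.reCLM.compLp (𝓕 (h.toLp f : Lp ℂ 2 (volume : Measure Plane)))) ω : ℂ) +
      Complex.I * (W (Complex.imCLM.compLp (𝓕 (h.toLp f : Lp ℂ 2 (volume : Measure Plane)))) ω : ℂ)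
  else 0

/-! ### The truncated fractional sheet -/

/-- The constant `c_H` of the harmonizable representation. -/
def sheetConst (H : ℝ) : ℝ :=
  1 / 2 * (∫ ξ in Ioi (0 : ℝ), (1 - Real.cos ξ) / |ξ| ^ (2 * H + 1)) ^ (-(1 / 2) : ℝ)

/-- The one-parameter harmonizable kernel `(e^{iξt} - 1) / |ξ|^{H + 1/2}`. -/
def harmKernel (H t ξ : ℝ) : ℂ :=
  (Complex.exp (Complex.I * ξ * t) - 1) / ((|ξ| ^ (H + 1 / 2) : ℝ) : ℂ)

/-- The frequency domain `D^{κ,n} = {|ξ| ≤ 2^{2κn}, |η| ≤ 2^{κn}}`. -/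
def freqDomain (κ : ℝ) (n : ℕ) : Set Plane :=
  {z | |z 0| ≤ (2 : ℝ) ^ (2 * κ * n) ∧ |z 1| ≤ (2 : ℝ) ^ (κ * n)}

/-- The (square-integrable) kernel whose integral against `Ŵ` is `B^{κ,n}_t(x)`. -/
def sheetKernel (H₀ H₁ κ : ℝ) (n : ℕ) (t x : ℝ) : Plane → ℂ :=
  (freqDomain κ n).indicator fun z =>
    (sheetConst H₀ * sheetConst H₁ : ℂ) * (harmKernel H₀ t (z 0) * harmKernel H₁ x (z 1))

/-- `B` is (a smooth version of) the frequency-truncated fractional sheet `B^{κ,n}`: each `B_t(x)` is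
almost surely the Wiener integral defining `B^{κ,n}_t(x)`, and almost every path is `C^∞` on `ℝ²`. -/
structure IsTruncatedSheet {Ω : Type*} [MeasurableSpace Ω]
    (W : Lp ℝ 2 (volume : Measure Plane) → Ω → ℝ) (P : Measure Ω)
    (H₀ H₁ κ : ℝ) (n : ℕ) (B : ℝ → ℝ → Ω → ℝ) : Prop where
  version : ∀ t x, ∀ᵐ ω ∂P, (B t x ω : ℂ) = integralHat W (sheetKernel H₀ H₁ κ n t x) ω
  smooth : ∀ᵐ ω ∂P, ContDiff ℝ ((⊤ : ℕ∞) : WithTop ℕ∞) (fun z : ℝ × ℝ => B z.1 z.2 ω)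

/-! ### The heat convolution -/

/-- The heat kernel `G_t(x)`, zero for `t ≤ 0`. -/
def heatKernel (t x : ℝ) : ℝ :=
  if 0 < t then 1 / √(4 * Real.pi * t) * Real.exp (-(x ^ 2) / (4 * t)) else 0

/-- The mixed derivative `(∂_t ∂_x b)_s(y)`. -/
def mixedDeriv (b : ℝ → ℝ → ℝ) (s y : ℝ) : ℝ :=
  deriv (fun t => deriv (fun x => b t x) y) s

/-- The space-time convolution `(G ∗ ∂_t∂_x b)_t(x) = ∫_0^t ds ∫ dy G_{t-s}(x-y) (∂_t∂_x b)_s(y)`. -/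
def heatSol (b : ℝ → ℝ → ℝ) (t x : ℝ) : ℝ :=
  ∫ s in (0 : ℝ)..t, ∫ y, heatKernel (t - s) (x - y) * mixedDeriv b s y

/-- The distribution `ρ · (G ∗ ∂_t∂_x b)_t`. -/
def localSol (ρ : ℝ → ℝ) (b : ℝ → ℝ → ℝ) (t : ℝ) : 𝓢'(ℝ, ℂ) :=
  funDist fun x => ((ρ x * heatSol b t x : ℝ) : ℂ)

/-- The space `L^{2p}(Ω; C([0,1]; W^{-α,2p}(ℝ)))`. -/
abbrev PathSpace {Ω : Type*} [MeasurableSpace Ω] (P : Measure Ω) (α : ℝ) (p : ℝ≥0∞)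
    [Fact (1 ≤ p)] : Type _ :=
  Lp C(I, BesselSpace (-α) (2 * p)) (2 * p) P

end RoughHeat

end

open MeasureTheory ProbabilityTheory Filter Topology Set
open scoped ENNReal SchwartzMap FourierTransform unitInterval

noncomputable section

namespace RoughHeat

/-! ### Wiener integrals against the Fourier transform of white noise -/

/-! A truncated sheet has bounded frequencies, so almost every path is an entire double power
series. Its mixed derivative is `∑ A_{jk} s^j/j! y^k/k!`, where `A_{jk}` (`coef`) is the Wiener
integral of `θ w (iξ)^j (iη)^k`, with `θ` the cutoff and `w` the weight `noiseWeight`. Almost surely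
`|A_{jk}| ≤ C (2Λ)^(j+k)` (`ae_norm_coef_le`). Such a series may be differentiated, convolved with
the heat kernel and localized by `ρ` term by term: `ρ Ψ_t = ∑ A_{j,l+2i} g_{ji}(t) ρ x^l/l!`,
absolutely convergent in `C([0,1]; W^{-α,r})` (`GeomBound.hasSum_heatSol`, `toDist_pathSeries`). The
only stochastic exchange needed is that Wiener integrals commute almost surely with dominated sums
(`ae_hasSum_integralHat`); it takes the place of a stochastic Fubini theorem.

Resummation (`ae_incrField_eq`) shows that at each point `y` the Bessel potential of `ρ(Ψ_t - Ψ_t')`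
is one Wiener integral, with kernel `θ w (σ_t - σ_t')(ξ,η) J(ρ e^{iη·})(y)`. Here `σ_t` is the
symbol of the heat operator and `J` the Bessel potential of order `-α`. Two deterministic bounds
control the kernel: `σ_t - σ_t'` is at most a constant times `(t-t')^ε (1+|ξ|+η²)^(-(1-ε))`
(`norm_heatSymbol_sub_le`), and `J(ρ e^{iη·})(y)` at most a constant times `(1+y²)^(-1)
(1+η²)^(-α/2)` (`Cut.norm_schwartzBessel_exp_le`). Against the weight `w` the product is square
integrable because `α > α₀`. If moreover `θ` lives on `1+|ξ|+η² ≥ N²`, a factor `N^(-ς)` can be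
extracted (`rpow_weight_le`).

The `L^q` norms of Gaussian variables are multiples of their `L²` norms, so these bounds hold for
moments of every order. Integration in `y` against `dy/(1+y²)` and dyadic chaining in `t` turn them
into a moment bound of size `N^(-ς)` for the supremum in time of the `W^{-α,r}` norm
(`exists_eLpNorm_cutPath_le`).

The difference of two cutoffs vanishes on the low frequencies common to both, so the approximations
are Cauchy, with a rate that does not distinguish the values of `κ` (`exists_limit_cutPath`).
Geometric rates in `L^r(Ω)` become almost sure rates by a Borel–Cantelli argument. Taking the limit
in the space of tempered distributions gives a process independent of `κ`, `α` and `p`. -/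

theorem integralHat_of_memLp {Ω : Type*} {W : Lp ℝ 2 (volume : Measure Plane) → Ω → ℝ}
    {f : Plane → ℂ} (hf : MemLp f 2 volume) (ω : Ω) :
    integralHat W f ω =
      (W (Complex.reCLM.compLp (𝓕 (hf.toLp f : Lp ℂ 2 (volume : Measure Plane)))) ω : ℂ) +
      Complex.I *
        (W (Complex.imCLM.compLp (𝓕 (hf.toLp f : Lp ℂ 2 (volume : Measure Plane)))) ω : ℂ) := by
  rw [integralHat, dif_pos hf]

section WhiteNoise

variable {Ω : Type*} [MeasurableSpace Ω] {P : Measure Ω}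
  {W : Lp ℝ 2 (volume : Measure Plane) → Ω → ℝ}

/-- The `L^q` norm of a standard Gaussian variable. -/
def gaussMoment (q : ℝ≥0∞) : ℝ≥0∞ := eLpNorm id q (gaussianReal 0 1)

theorem gaussMoment_ne_top {q : ℝ≥0∞} (hq : q ≠ ∞) : gaussMoment q ≠ ∞ :=
  (memLp_id_gaussianReal' q hq).2.ne

theorem IsWhiteNoise.memLp (hW : IsWhiteNoise W P) (f : Lp ℝ 2 (volume : Measure Plane))
    {q : ℝ≥0∞} (hq : q ≠ ∞) : MemLp (W f) q P :=
  (hW.gaussian.hasGaussianLaw_eval f).memLp hq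

theorem IsWhiteNoise.map_eq (hW : IsWhiteNoise W P) (f : Lp ℝ 2 (volume : Measure Plane)) :
    P.map (W f) = gaussianReal 0 (‖f‖₊ ^ 2) := by
  have h := hW.gaussian.hasGaussianLaw_eval f
  have := h.isProbabilityMeasure
  rw [h.map_eq_gaussianReal, hW.centered f, variance_of_integral_eq_zero h.aemeasurable (hW.centered f)]
  congr 1
  have : ∫ ω, W f ω ^ 2 ∂P = ‖f‖ ^ 2 := by
    simp_rw [sq]
    rw [hW.covariance f f, real_inner_self_eq_norm_mul_norm]
  rw [this]
  ext
  simp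

/-- A centered Gaussian variable is its standard deviation times a standard one. This is what turns
`L²` bounds in frequency into moment bounds of any order. -/
theorem IsWhiteNoise.eLpNorm_eq (hW : IsWhiteNoise W P) (f : Lp ℝ 2 (volume : Measure Plane))
    (q : ℝ≥0∞) : eLpNorm (W f) q P = ‖f‖ₑ * gaussMoment q := by
  have h := hW.gaussian.hasGaussianLaw_eval f
  have h1 : eLpNorm id q (P.map (W f)) = eLpNorm (W f) q P :=
    eLpNorm_map_measure aestronglyMeasurable_id h.aemeasurable
  have h2 : (gaussianReal 0 1).map (fun x => ‖f‖ * x) = gaussianReal 0 (‖f‖₊ ^ 2) := by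
    rw [gaussianReal_map_const_mul]
    congr 1
    · simp
    · ext; simp
  rw [← h1, hW.map_eq, ← h2, eLpNorm_map_measure aestronglyMeasurable_id (by fun_prop)]
  have h3 : (id ∘ fun x : ℝ => ‖f‖ * x) = ‖f‖ • (id : ℝ → ℝ) := by ext; simp
  rw [h3, eLpNorm_const_smul, gaussMoment]
  simp

/-- Linearity of `W` is not part of the definition of white noise. It follows from the covariance:
the second moment of the linearity defect expands to zero. -/
theorem IsWhiteNoise.ae_linear (hW : IsWhiteNoise W P) (a b : ℝ)
    (f g h : Lp ℝ 2 (volume : Measure Plane)) (hh : h = a • f + b • g) :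
    W h =ᵐ[P] fun ω => a * W f ω + b * W g ω := by
  have m := fun f => hW.memLp f (q := 2) (by simp)
  have i := fun f g => (m f).integrable_mul (m g)
  have key : ∫ ω, (W h ω - (a * W f ω + b * W g ω)) ^ 2 ∂P = 0 := by
    have e : (fun ω => (W h ω - (a * W f ω + b * W g ω)) ^ 2) = fun ω =>
        (W h * W h) ω + a ^ 2 * (W f * W f) ω + b ^ 2 * (W g * W g) ω
          - 2 * a * (W h * W f) ω - 2 * b * (W h * W g) ω + 2 * a * b * (W f * W g) ω := by
      ext ω; simp only [Pi.mul_apply]; ring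
    rw [e, integral_add, integral_sub, integral_sub, integral_add, integral_add]
    · simp only [integral_const_mul, Pi.mul_apply]
      simp only [hW.covariance, hh, inner_add_left, inner_add_right, inner_smul_left,
        inner_smul_right, real_inner_comm f g]
      simp only [conj_trivial]
      ring
    all_goals fun_prop (disch := exact i _ _)
  rw [integral_eq_zero_iff_of_nonneg (fun ω => sq_nonneg _)] at key
  · filter_upwards [key] with ω hω
    have := pow_eq_zero_iff (two_ne_zero) |>.1 hω
    linarith
  · exact ((m h).sub (((m f).const_mul a).add ((m g).const_mul b))).integrable_sq

theorem aemeasurable_integralHat (hW : IsWhiteNoise W P) (f : Plane → ℂ) :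
    AEMeasurable (integralHat W f) P := by
  by_cases hf : MemLp f 2 (volume : Measure Plane)
  · simp_rw [funext (integralHat_of_memLp (W := W) hf)]
    have := fun g => hW.gaussian.aemeasurable g
    exact ((Complex.measurable_ofReal.comp_aemeasurable (this _))).add
      ((Complex.measurable_ofReal.comp_aemeasurable (this _)).const_mul _)
  · have : integralHat W f = fun _ => 0 := by ext ω; rw [integralHat, dif_neg hf]
    rw [this]; exact aemeasurable_const

/-- By Plancherel the real and the imaginary part of the transform each have norm at most `‖f‖`;
estimating them separately costs the factor 2. -/
theorem eLpNorm_integralHat_le (hW : IsWhiteNoise W P) {f : Plane → ℂ} (hf : MemLp f 2 volume)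
    {q : ℝ≥0∞} (hq : 1 ≤ q) :
    eLpNorm (integralHat W f) q P ≤ 2 * gaussMoment q * eLpNorm f 2 volume := by
  have bnd : ∀ L : ℂ →L[ℝ] ℝ, ‖L‖ ≤ 1 →
      eLpNorm (fun ω => (W (L.compLp (𝓕 (hf.toLp f : Lp ℂ 2 (volume : Measure Plane)))) ω : ℂ)) q P
        ≤ gaussMoment q * eLpNorm f 2 volume := by
    intro L hL
    have h1 : eLpNorm (fun ω => (W (L.compLp (𝓕 (hf.toLp f))) ω : ℂ)) q P =
        eLpNorm (W (L.compLp (𝓕 (hf.toLp f)))) q P :=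
      eLpNorm_congr_norm_ae (Eventually.of_forall fun ω => by simp)
    rw [h1, hW.eLpNorm_eq, mul_comm]
    gcongr
    have h2 : ‖L.compLp (𝓕 (hf.toLp f))‖ ≤ ‖hf.toLp f‖ := by
      refine (L.norm_compLp_le _).trans ?_
      rw [Lp.norm_fourier_eq]
      exact mul_le_of_le_one_left (norm_nonneg _) hL
    rw [← Lp.enorm_toLp hf, ← ofReal_norm, ← ofReal_norm]
    exact ENNReal.ofReal_le_ofReal h2
  simp_rw [funext (integralHat_of_memLp (W := W) hf)]
  have am := fun g => (Complex.measurable_ofReal.comp_aemeasurable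
    (hW.gaussian.aemeasurable g)).aestronglyMeasurable
  refine (eLpNorm_add_le (am _) ((am _).const_mul _) hq).trans ?_
  have h3 : eLpNorm (fun ω => Complex.I *
      (W (Complex.imCLM.compLp (𝓕 (hf.toLp f))) ω : ℂ)) q P =
      eLpNorm (fun ω => (W (Complex.imCLM.compLp (𝓕 (hf.toLp f))) ω : ℂ)) q P :=
    eLpNorm_congr_norm_ae (Eventually.of_forall fun ω => by simp)
  calc _ ≤ gaussMoment q * eLpNorm f 2 volume + gaussMoment q * eLpNorm f 2 volume := by
        refine add_le_add (bnd _ (by simp)) ?_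
        exact h3.trans_le (bnd _ (by simp))
    _ = _ := by ring

theorem integralHat_add (hW : IsWhiteNoise W P) {f g : Plane → ℂ} (hf : MemLp f 2 volume)
    (hg : MemLp g 2 volume) :
    integralHat W (f + g) =ᵐ[P] integralHat W f + integralHat W g := by
  have e : ∀ L : ℂ →L[ℝ] ℝ, L.compLp (𝓕 ((hf.add hg).toLp (f + g))) =
      (1 : ℝ) • L.compLp (𝓕 (hf.toLp f)) + (1 : ℝ) • L.compLp (𝓕 (hg.toLp g)) := by
    intro L
    rw [MemLp.toLp_add, FourierTransform.fourier_add, one_smul, one_smul]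
    exact map_add (L.compLpₗ 2 (volume : Measure Plane)) _ _
  filter_upwards [hW.ae_linear 1 1 _ _ _ (e Complex.reCLM), hW.ae_linear 1 1 _ _ _ (e Complex.imCLM)]
    with ω h1 h2
  rw [Pi.add_apply, integralHat_of_memLp (hf.add hg), integralHat_of_memLp hf,
    integralHat_of_memLp hg, h1, h2]
  push_cast
  ring

theorem integralHat_const_mul (hW : IsWhiteNoise W P) {f : Plane → ℂ} (hf : MemLp f 2 volume)
    (c : ℂ) : integralHat W (fun z => c * f z) =ᵐ[P] fun ω => c * integralHat W f ω := by
  have e : 𝓕 ((hf.const_mul c).toLp (fun z => c * f z)) = c • 𝓕 (hf.toLp f) := by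
    rw [← FourierTransform.fourier_smul]; rfl
  -- A complex scalar mixes the real and imaginary parts of the transform while `W` is only
  -- real-linear, so each component is expanded on its own.
  have ere : Complex.reCLM.compLp (𝓕 ((hf.const_mul c).toLp (fun z => c * f z))) =
      c.re • Complex.reCLM.compLp (𝓕 (hf.toLp f)) +
        (-c.im) • Complex.imCLM.compLp (𝓕 (hf.toLp f)) := by
    rw [e]
    ext1
    filter_upwards [Complex.reCLM.coeFn_compLp (c • 𝓕 (hf.toLp f)), Lp.coeFn_smul c (𝓕 (hf.toLp f)),
      Lp.coeFn_add (c.re • Complex.reCLM.compLp (𝓕 (hf.toLp f)))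
        ((-c.im) • Complex.imCLM.compLp (𝓕 (hf.toLp f))),
      Lp.coeFn_smul c.re (Complex.reCLM.compLp (𝓕 (hf.toLp f))),
      Lp.coeFn_smul (-c.im) (Complex.imCLM.compLp (𝓕 (hf.toLp f))),
      Complex.reCLM.coeFn_compLp (𝓕 (hf.toLp f)), Complex.imCLM.coeFn_compLp (𝓕 (hf.toLp f))]
      with z h1 h2 h3 h4 h5 h6 h7
    rw [h1, h2, h3, Pi.add_apply, h4, h5, Pi.smul_apply, Pi.smul_apply, Pi.smul_apply, h6, h7]
    simp
    ring
  have eim : Complex.imCLM.compLp (𝓕 ((hf.const_mul c).toLp (fun z => c * f z))) =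
      c.im • Complex.reCLM.compLp (𝓕 (hf.toLp f)) +
        c.re • Complex.imCLM.compLp (𝓕 (hf.toLp f)) := by
    rw [e]
    ext1
    filter_upwards [Complex.imCLM.coeFn_compLp (c • 𝓕 (hf.toLp f)), Lp.coeFn_smul c (𝓕 (hf.toLp f)),
      Lp.coeFn_add (c.im • Complex.reCLM.compLp (𝓕 (hf.toLp f)))
        (c.re • Complex.imCLM.compLp (𝓕 (hf.toLp f))),
      Lp.coeFn_smul c.im (Complex.reCLM.compLp (𝓕 (hf.toLp f))),
      Lp.coeFn_smul c.re (Complex.imCLM.compLp (𝓕 (hf.toLp f))),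
      Complex.reCLM.coeFn_compLp (𝓕 (hf.toLp f)), Complex.imCLM.coeFn_compLp (𝓕 (hf.toLp f))]
      with z h1 h2 h3 h4 h5 h6 h7
    rw [h1, h2, h3, Pi.add_apply, h4, h5, Pi.smul_apply, Pi.smul_apply, Pi.smul_apply, h6, h7]
    simp
    ring
  filter_upwards [hW.ae_linear _ _ _ _ _ ere, hW.ae_linear _ _ _ _ _ eim] with ω h1 h2
  rw [integralHat_of_memLp (hf.const_mul c), integralHat_of_memLp hf, h1, h2]
  apply Complex.ext
  · simp
    ring
  · simp
    ring

theorem integralHat_sub (hW : IsWhiteNoise W P) {f g : Plane → ℂ} (hf : MemLp f 2 volume)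
    (hg : MemLp g 2 volume) :
    integralHat W (f - g) =ᵐ[P] integralHat W f - integralHat W g := by
  have e : f - g = f + fun z => (-1 : ℂ) * g z := by ext z; simp [sub_eq_add_neg]
  rw [e]
  filter_upwards [integralHat_add hW hf (hg.const_mul (-1)), integralHat_const_mul hW hg (-1)]
    with ω h1 h2
  rw [h1, Pi.add_apply, h2]
  simp [sub_eq_add_neg]

theorem integralHat_zero (hW : IsWhiteNoise W P) :
    integralHat W (fun _ => 0) =ᵐ[P] fun _ => 0 := by
  simpa using integralHat_const_mul hW (f := fun _ => 0) MemLp.zero 0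

theorem integralHat_sum (hW : IsWhiteNoise W P) {ι : Type*} (S : Finset ι) {Φ : ι → Plane → ℂ}
    (hΦ : ∀ i, MemLp (Φ i) 2 volume) :
    integralHat W (fun z => ∑ i ∈ S, Φ i z) =ᵐ[P] fun ω => ∑ i ∈ S, integralHat W (Φ i) ω := by
  classical
  induction S using Finset.induction_on with
  | empty => simpa using integralHat_zero hW
  | insert a s ha ih =>
    have := integralHat_add hW (hΦ a) (memLp_finsetSum s (fun i _ => hΦ i))
    filter_upwards [this, ih] with ω h1 h2
    simp_rw [Finset.sum_insert ha]
    rw [← h2]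
    exact h1

theorem memLp_of_bound {Φ : Plane → ℂ} {G : Plane → ℝ} {c : ℝ} (hΦ : AEStronglyMeasurable Φ volume)
    (hG : MemLp G 2 volume) (hb : ∀ z, ‖Φ z‖ ≤ c * G z) : MemLp Φ 2 volume :=
  (hG.const_mul c).mono' hΦ (Eventually.of_forall hb)

theorem eLpNorm_le_of_bound {Φ : Plane → ℂ} {G : Plane → ℝ} {c : ℝ} (hc : 0 ≤ c)
    (hb : ∀ᵐ z ∂(volume : Measure Plane), ‖Φ z‖ ≤ c * G z) :
    eLpNorm Φ 2 volume ≤ ENNReal.ofReal c * eLpNorm G 2 volume := by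
  refine (eLpNorm_le_mul_eLpNorm_of_ae_le_mul (c := c) (g := G) ?_ 2)
  filter_upwards [hb] with z hz
  exact hz.trans (mul_le_mul_of_nonneg_left (le_abs_self _) hc)

/-- Wiener integrals of a dominated family are almost surely absolutely summable. -/
theorem ae_summable_integralHat (hW : IsWhiteNoise W P) {ι : Type*} [Countable ι]
    {Φ : ι → Plane → ℂ} {G : Plane → ℝ} {c : ι → ℝ}
    (hΦ : ∀ i, AEStronglyMeasurable (Φ i) volume) (hG : MemLp G 2 volume) (hc : ∀ i, 0 ≤ c i)
    (hcs : Summable c) (hb : ∀ i z, ‖Φ i z‖ ≤ c i * G z) :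
    ∀ᵐ ω ∂P, Summable fun i => ‖integralHat W (Φ i) ω‖ := by
  have hm : ∀ i, MemLp (Φ i) 2 volume := fun i => memLp_of_bound (hΦ i) hG (hb i)
  have h1 : ∫⁻ ω, ∑' i, ‖integralHat W (Φ i) ω‖ₑ ∂P ≠ ∞ := by
    rw [lintegral_tsum (fun i => (aemeasurable_integralHat hW _).enorm)]
    have h2 : ∀ i, ∫⁻ ω, ‖integralHat W (Φ i) ω‖ₑ ∂P ≤
        ENNReal.ofReal (c i) * (2 * gaussMoment 1 * eLpNorm G 2 volume) := by
      intro i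
      rw [← eLpNorm_one_eq_lintegral_enorm]
      refine (eLpNorm_integralHat_le hW (hm i) le_rfl).trans ?_
      refine (mul_le_mul_right (eLpNorm_le_of_bound (hc i)
        (Eventually.of_forall (hb i))) _).trans (le_of_eq ?_)
      ring
    refine ne_top_of_le_ne_top ?_ (ENNReal.tsum_le_tsum h2)
    rw [ENNReal.tsum_mul_right]
    refine ENNReal.mul_ne_top ?_ (ENNReal.mul_ne_top (ENNReal.mul_ne_top (by simp)
      (gaussMoment_ne_top (by simp))) hG.2.ne)
    rw [← ENNReal.ofReal_tsum_of_nonneg hc hcs]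
    exact ENNReal.ofReal_ne_top
  filter_upwards [ae_lt_top' (AEMeasurable.tsum fun i =>
    (aemeasurable_integralHat hW _).enorm) h1] with ω hω
  exact tsum_enorm_ne_top_iff_summable_norm.1 hω.ne

/-- The Wiener integral commutes almost surely with dominated sums. -/
theorem ae_hasSum_integralHat (hW : IsWhiteNoise W P) {ι : Type*} [Countable ι]
    {Φ : ι → Plane → ℂ} {f : Plane → ℂ} {G : Plane → ℝ} {c : ι → ℝ}
    (hΦ : ∀ i, AEStronglyMeasurable (Φ i) volume) (hG : MemLp G 2 volume) (hc : ∀ i, 0 ≤ c i)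
    (hcs : Summable c) (hb : ∀ i z, ‖Φ i z‖ ≤ c i * G z)
    (hf : ∀ᵐ z, HasSum (fun i => Φ i z) (f z)) :
    MemLp f 2 volume ∧
      ∀ᵐ ω ∂P, HasSum (fun i => integralHat W (Φ i) ω) (integralHat W f ω) := by
  have hm : ∀ i, MemLp (Φ i) 2 volume := fun i => memLp_of_bound (hΦ i) hG (hb i)
  -- Almost everywhere statements tolerate only countably many null sets, so the net of finite
  -- partial sums is replaced by a sequence.
  obtain ⟨S, hS⟩ := exists_seq_tendsto (atTop : Filter (Finset ι))
  have hSm : ∀ n, MemLp (fun z => ∑ i ∈ S n, Φ i z) 2 volume := fun n =>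
    memLp_finsetSum _ fun i _ => hm i
  have hfm : AEStronglyMeasurable f volume :=
    aestronglyMeasurable_of_tendsto_ae atTop (fun n => (hSm n).1)
      (hf.mono fun z hz => hz.comp hS)
  have tail : ∀ n, ∀ᵐ z, ‖f z - ∑ i ∈ S n, Φ i z‖ ≤ (∑' i : {i // i ∉ S n}, c i) * G z := by
    intro n
    filter_upwards [hf] with z hz
    have e : f z - ∑ i ∈ S n, Φ i z = ∑' i : {i // i ∉ S n}, Φ i z := by
      rw [← hz.tsum_eq, ← hz.summable.sum_add_tsum_compl (s := S n), add_sub_cancel_left]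
      rfl
    rw [e, ← tsum_mul_right]
    have hs : Summable fun i : {i // i ∉ S n} => c i * G z := (hcs.subtype _).mul_right _
    exact tsum_of_norm_bounded hs.hasSum fun i => hb i z
  have hf2 : MemLp f 2 volume := by
    have h0 : MemLp (f - fun z => ∑ i ∈ S 0, Φ i z) 2 volume :=
      (hG.const_mul _).mono' (hfm.sub (hSm 0).1) (tail 0)
    simpa using h0.add (hSm 0)
  refine ⟨hf2, ?_⟩
  have hlim : Tendsto (fun n => eLpNorm (fun ω => integralHat W f ω -
      ∑ i ∈ S n, integralHat W (Φ i) ω) 1 P) atTop (𝓝 0) := by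
    have hT : Tendsto (fun n => ENNReal.ofReal (∑' i : {i // i ∉ S n}, c i) *
        (2 * gaussMoment 1 * eLpNorm G 2 volume)) atTop (𝓝 0) := by
      have h0 : Tendsto (fun n => ∑' i : {i // i ∉ S n}, c i) atTop (𝓝 0) :=
        (tendsto_tsum_compl_atTop_zero c).comp hS
      have h1 := (ENNReal.tendsto_ofReal h0)
      rw [ENNReal.ofReal_zero] at h1
      have := ENNReal.Tendsto.mul_const h1 (b := 2 * gaussMoment 1 * eLpNorm G 2 volume)
        (Or.inr (ENNReal.mul_ne_top (ENNReal.mul_ne_top (by simp)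
          (gaussMoment_ne_top (by simp))) hG.2.ne))
      simpa using this
    refine tendsto_of_tendsto_of_tendsto_of_le_of_le tendsto_const_nhds hT
      (fun _ => zero_le) fun n => ?_
    have e : (fun ω => integralHat W f ω - ∑ i ∈ S n, integralHat W (Φ i) ω) =ᵐ[P]
        integralHat W (f - fun z => ∑ i ∈ S n, Φ i z) := by
      filter_upwards [integralHat_sub hW hf2 (hSm n), integralHat_sum hW (S n) hm] with ω h1 h2
      rw [h1, Pi.sub_apply, h2]
    rw [eLpNorm_congr_ae e]
    refine (eLpNorm_integralHat_le hW (hf2.sub (hSm n)) le_rfl).trans ?_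
    refine (mul_le_mul_right (eLpNorm_le_of_bound (tsum_nonneg fun i : {i // i ∉ S n} => hc i)
      (tail n)) _).trans (le_of_eq ?_)
    ring
  have hsum := ae_summable_integralHat hW hΦ hG hc hcs hb
  have am : ∀ n, AEStronglyMeasurable (fun ω => integralHat W f ω -
      ∑ i ∈ S n, integralHat W (Φ i) ω) P := fun n =>
    (aemeasurable_integralHat hW _).aestronglyMeasurable.sub
      (Finset.aestronglyMeasurable_fun_sum _ fun i _ =>
        (aemeasurable_integralHat hW _).aestronglyMeasurable)
  -- The partial sums tend to the Wiener integral of `f` in `L¹` and to the sum of the series almost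
  -- surely; Fatou's lemma identifies the two limits.
  have h0 : eLpNorm (fun ω => integralHat W f ω - ∑' i, integralHat W (Φ i) ω) 1 P = 0 := by
    have := Lp.eLpNorm_lim_le_liminf_eLpNorm (p := 1) am
      (fun ω => integralHat W f ω - ∑' i, integralHat W (Φ i) ω)
      (hsum.mono fun ω hω => tendsto_const_nhds.sub (hω.of_norm.hasSum.comp hS))
    rw [hlim.liminf_eq] at this
    exact le_antisymm this zero_le
  have hm0 : AEStronglyMeasurable
      (fun ω => integralHat W f ω - ∑' i, integralHat W (Φ i) ω) P :=
    aestronglyMeasurable_of_tendsto_ae atTop am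
      (hsum.mono fun ω hω => tendsto_const_nhds.sub (hω.of_norm.hasSum.comp hS))
  rw [eLpNorm_eq_zero_iff hm0 one_ne_zero] at h0
  filter_upwards [h0, hsum] with ω h1 h2
  have : integralHat W f ω = ∑' i, integralHat W (Φ i) ω := sub_eq_zero.1 h1
  rw [this]
  exact h2.of_norm.hasSum

end WhiteNoise

/-! ### Dyadic chaining -/

section Chaining

variable {E : Type*} [NormedAddCommGroup E]

/-- The dyadic point `k / 2^m`, as a point of the unit interval. -/
def dyadic (m k : ℕ) : I := projIcc (0 : ℝ) 1 zero_le_one ((k : ℝ) / 2 ^ m)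

theorem coe_dyadic {m k : ℕ} (h : k ≤ 2 ^ m) : (dyadic m k : ℝ) = (k : ℝ) / 2 ^ m := by
  have h1 : (k : ℝ) / 2 ^ m ≤ 1 := by
    rw [div_le_one (by positivity)]
    exact_mod_cast h
  rw [dyadic, projIcc_of_mem zero_le_one ⟨by positivity, h1⟩]

theorem dyadic_zero (m : ℕ) : dyadic m 0 = 0 := by
  ext
  rw [coe_dyadic (Nat.zero_le _)]
  simp

theorem dyadic_succ_two_mul {m k : ℕ} (h : k ≤ 2 ^ m) : dyadic (m + 1) (2 * k) = dyadic m k := by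
  ext
  rw [coe_dyadic h, coe_dyadic (by rw [pow_succ]; omega)]
  push_cast
  rw [pow_succ]
  field_simp

/-- A point of level `m+1` either has level `m` or lies one increment to the right of such a point.
Every dyadic point is thus reached from `0` using at most one increment per level; density and
continuity give all other times. -/
theorem norm_le_of_dyadic_increments (f : C(I, E)) (h0 : f 0 = 0) {r M : ℝ} (hr0 : 0 ≤ r)
    (hr1 : r < 1) (hM : 0 ≤ M)
    (h : ∀ m k, k < 2 ^ m → ‖f (dyadic m (k + 1)) - f (dyadic m k)‖ ≤ M * r ^ m) :
    ‖f‖ ≤ M * (1 - r)⁻¹ := by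
  have hs : ∀ m, ∑ i ∈ Finset.range (m + 1), r ^ i ≤ (1 - r)⁻¹ := fun m => by
    rw [← tsum_geometric_of_lt_one hr0 hr1]
    exact (summable_geometric_of_lt_one hr0 hr1).sum_le_tsum _ fun i _ => by positivity
  have key : ∀ m k, k ≤ 2 ^ m → ‖f (dyadic m k)‖ ≤ M * ∑ i ∈ Finset.range (m + 1), r ^ i := by
    intro m
    induction m with
    | zero =>
      intro k hk
      obtain rfl | rfl : k = 0 ∨ k = 1 := by
        simp at hk; omega
      · rw [dyadic_zero, h0]; simpa using hM
      · simpa [dyadic_zero, h0] using h 0 0 (by simp)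
    | succ m ih =>
      intro k hk
      rw [Finset.sum_range_succ, mul_add]
      obtain ⟨j, rfl | rfl⟩ := Nat.even_or_odd' k
      · have hj : j ≤ 2 ^ m := by rw [pow_succ] at hk; omega
        rw [dyadic_succ_two_mul hj]
        have : 0 ≤ M * r ^ (m + 1) := by positivity
        linarith [ih j hj]
      · have hj : j ≤ 2 ^ m := by rw [pow_succ] at hk; omega
        have h1 := h (m + 1) (2 * j) (by omega)
        rw [dyadic_succ_two_mul hj] at h1
        have h2 := norm_add_le (f (dyadic m j)) (f (dyadic (m + 1) (2 * j + 1)) - f (dyadic m j))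
        rw [add_sub_cancel] at h2
        linarith [ih j hj]
  have hC : 0 ≤ M * (1 - r)⁻¹ := mul_nonneg hM (inv_nonneg.2 (by linarith))
  rw [ContinuousMap.norm_le f hC]
  intro t
  have hk : ∀ m : ℕ, ⌊(t : ℝ) * 2 ^ m⌋₊ ≤ 2 ^ m := fun m => by
    have : (t : ℝ) * 2 ^ m ≤ 2 ^ m := mul_le_of_le_one_left (by positivity) t.2.2
    exact Nat.floor_le_of_le (by exact_mod_cast this)
  have hd : Tendsto (fun m : ℕ => dyadic m ⌊(t : ℝ) * 2 ^ m⌋₊) atTop (𝓝 t) := by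
    rw [tendsto_subtype_rng]
    simp_rw [fun m => coe_dyadic (hk m)]
    have := (tendsto_nat_floor_mul_div_atTop (R := ℝ) t.2.1).comp
      (tendsto_pow_atTop_atTop_of_one_lt (one_lt_two (α := ℝ)))
    exact this
  refine le_of_tendsto ((f.continuous.tendsto t).comp hd).norm (Eventually.of_forall fun m => ?_)
  exact (key m _ (hk m)).trans (mul_le_mul_of_nonneg_left (hs m) hM)

/-- Kolmogorov's criterion in quantitative form. The constant is fixed before the process, which
makes the later bounds uniform in the cutoff. -/
theorem lintegral_norm_pow_le_of_increments {Ω : Type*} [MeasurableSpace Ω] {P : Measure Ω}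
    {q : ℕ} (hq : q ≠ 0) {b : ℝ} (hb : 1 < b) :
    ∃ C : ℝ≥0∞, C ≠ ∞ ∧ ∀ (f : Ω → C(I, E)), AEStronglyMeasurable f P →
      (∀ᵐ ω ∂P, f ω 0 = 0) → ∀ K : ℝ≥0∞,
      (∀ s t : I, s ≤ t → ∫⁻ ω, ‖f ω t - f ω s‖ₑ ^ q ∂P ≤
        K * ENNReal.ofReal (((t : ℝ) - s) ^ b)) →
      ∫⁻ ω, ‖f ω‖ₑ ^ q ∂P ≤ C * K := by
  -- The `2^m` increments of level `m` contribute `(2 · 2^(-b))^m = a^(2m)` to the expectation. One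
  -- factor `a^m` pays for the weight `a^(-m)` in `Q`, the other makes the series converge.
  set a : ℝ := 2 ^ (-((b - 1) / 2)) with ha
  have ha0 : 0 < a := by positivity
  have ha1 : a < 1 := Real.rpow_lt_one_of_one_lt_of_neg one_lt_two (by linarith)
  have ha2 : 2 * (2 : ℝ) ^ (-b) = a * a := by
    rw [ha, ← Real.rpow_add two_pos]
    nth_rewrite 1 [← Real.rpow_one 2]
    rw [← Real.rpow_add two_pos]
    congr 1; ring
  set r : ℝ := a ^ ((q : ℝ)⁻¹) with hr
  have hr0 : 0 ≤ r := by positivity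
  have hr1 : r < 1 := Real.rpow_lt_one ha0.le ha1 (by positivity)
  have hrq : r ^ q = a := Real.rpow_inv_natCast_pow ha0.le hq
  refine ⟨ENNReal.ofReal ((1 - r)⁻¹ ^ q) * ENNReal.ofReal ((1 - a)⁻¹),
    ENNReal.mul_ne_top ENNReal.ofReal_ne_top ENNReal.ofReal_ne_top, fun f hf h0 K hK => ?_⟩
  set D : ℕ → ℕ → Ω → ℝ≥0∞ := fun m k ω => ‖f ω (dyadic m (k + 1)) - f ω (dyadic m k)‖ₑ ^ q
  have hD : ∀ m k, AEMeasurable (D m k) P := fun m k => by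
    have h1 : Continuous fun g : C(I, E) => g (dyadic m (k + 1)) - g (dyadic m k) := by fun_prop
    exact (h1.comp_aestronglyMeasurable hf).enorm.pow_const q
  set Q : Ω → ℝ≥0∞ := fun ω => ∑' m : ℕ, ENNReal.ofReal (a⁻¹ ^ m) * ∑ k ∈ Finset.range (2 ^ m), D m k ω
  have bound : ∀ᵐ ω ∂P, ‖f ω‖ₑ ^ q ≤ ENNReal.ofReal ((1 - r)⁻¹ ^ q) * Q ω := by
    filter_upwards [h0] with ω hω
    by_cases hQ : Q ω = ∞
    · rw [hQ, ENNReal.mul_top]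
      · exact le_top
      · have : 0 < (1 - r)⁻¹ ^ q := pow_pos (inv_pos.2 (by linarith)) _
        simpa using this
    set M : ℝ := (Q ω).toReal ^ ((q : ℝ)⁻¹)
    have hM : M ^ q = (Q ω).toReal := Real.rpow_inv_natCast_pow ENNReal.toReal_nonneg hq
    have hM0 : 0 ≤ M := by positivity
    have inc : ∀ m k, k < 2 ^ m → ‖f ω (dyadic m (k + 1)) - f ω (dyadic m k)‖ ≤ M * r ^ m := by
      intro m k hk
      have h1 : ENNReal.ofReal (a⁻¹ ^ m) * D m k ω ≤ Q ω := by
        refine le_trans ?_ (ENNReal.le_tsum m)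
        gcongr
        exact Finset.single_le_sum (f := fun k => D m k ω) (fun _ _ => zero_le) (Finset.mem_range.2 hk)
      have h2 := ENNReal.toReal_mono hQ h1
      rw [ENNReal.toReal_mul, ENNReal.toReal_ofReal (by positivity), ENNReal.toReal_pow,
        toReal_enorm, ← hM] at h2
      refine le_of_pow_le_pow_left₀ hq (by positivity) ?_
      rw [mul_pow, ← pow_mul, mul_comm m q, pow_mul, hrq]
      rw [inv_pow, inv_mul_le_iff₀ (by positivity)] at h2
      linarith
    have := norm_le_of_dyadic_increments (f ω) hω hr0 hr1 hM0 inc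
    rw [← ofReal_norm, ← ENNReal.ofReal_pow (norm_nonneg _), ← ENNReal.ofReal_toReal hQ,
      ← ENNReal.ofReal_mul (by positivity [sub_pos.2 hr1]), ← hM, ← mul_pow]
    refine ENNReal.ofReal_le_ofReal (pow_le_pow_left₀ (norm_nonneg _) ?_ _)
    rw [mul_comm]; exact this
  refine (lintegral_mono_ae bound).trans ?_
  rw [lintegral_const_mul' _ _ ENNReal.ofReal_ne_top, mul_assoc]
  gcongr
  rw [lintegral_tsum (fun m => (Finset.aemeasurable_fun_sum _ fun k _ => hD m k).const_mul _)]
  have hterm : ∀ m : ℕ, ∫⁻ ω, ENNReal.ofReal (a⁻¹ ^ m) * ∑ k ∈ Finset.range (2 ^ m), D m k ω ∂P ≤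
      ENNReal.ofReal (a ^ m) * K := by
    intro m
    rw [lintegral_const_mul' _ _ ENNReal.ofReal_ne_top,
      lintegral_finsetSum' _ fun k _ => hD m k]
    have h1 : ∀ k ∈ Finset.range (2 ^ m), ∫⁻ ω, D m k ω ∂P ≤ K * ENNReal.ofReal ((2 ^ (-b)) ^ m) := by
      intro k hk
      have hk' := Finset.mem_range.1 hk
      have hle : dyadic m k ≤ dyadic m (k + 1) := by
        rw [← Subtype.coe_le_coe, coe_dyadic hk', coe_dyadic hk'.le]
        push_cast
        gcongr
        linarith
      refine (hK _ _ hle).trans (le_of_eq ?_)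
      rw [coe_dyadic hk', coe_dyadic hk'.le]
      congr 2
      have : ((k + 1 : ℕ) : ℝ) / 2 ^ m - k / 2 ^ m = ((2 : ℝ) ^ m)⁻¹ := by
        push_cast; field_simp; ring
      rw [this, Real.inv_rpow (by positivity), ← Real.rpow_natCast, ← Real.rpow_mul two_pos.le,
        ← Real.rpow_neg two_pos.le, ← Real.rpow_natCast, ← Real.rpow_mul two_pos.le]
      congr 1; ring
    refine (mul_le_mul_right (Finset.sum_le_sum h1) _).trans (le_of_eq ?_)
    rw [Finset.sum_const, Finset.card_range, nsmul_eq_mul]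
    have : (((2 ^ m : ℕ) : ℝ≥0∞)) = ENNReal.ofReal (2 ^ m) := by
      rw [← ENNReal.ofReal_natCast]; push_cast; rfl
    rw [this]
    have e : a ^ m = a⁻¹ ^ m * (2 ^ m * (2 ^ (-b)) ^ m) := by
      rw [← mul_pow, ha2, ← mul_pow]
      congr 1; field_simp
    rw [e, ENNReal.ofReal_mul (by positivity), ENNReal.ofReal_mul (by positivity)]
    ring
  refine (ENNReal.tsum_le_tsum hterm).trans (le_of_eq ?_)
  rw [ENNReal.tsum_mul_right, ← ENNReal.ofReal_tsum_of_nonneg (fun m => by positivity)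
    (summable_geometric_of_lt_one ha0.le ha1), tsum_geometric_of_lt_one ha0.le ha1]

end Chaining

/-! ### Weighted estimates on the line -/

/-- The finite measure `dy / (1 + y²)`. -/
def cauchyWeight : Measure ℝ := volume.withDensity fun y => ENNReal.ofReal ((1 + y ^ 2)⁻¹)

instance : IsFiniteMeasure cauchyWeight :=
  isFiniteMeasure_withDensity_ofReal integrable_inv_one_add_sq.2

theorem cauchyWeight_absolutelyContinuous : cauchyWeight ≪ volume :=
  withDensity_absolutelyContinuous _ _

theorem lintegral_eq_lintegral_cauchyWeight {g : ℝ → ℝ≥0∞} (hg : AEMeasurable g volume) :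
    ∫⁻ y, g y = ∫⁻ y, ENNReal.ofReal (1 + y ^ 2) * g y ∂cauchyWeight := by
  rw [cauchyWeight, lintegral_withDensity_eq_lintegral_mul₀ (by fun_prop) (by fun_prop)]
  refine lintegral_congr fun y => ?_
  rw [Pi.mul_apply, ← mul_assoc, ← ENNReal.ofReal_mul (by positivity),
    inv_mul_cancel₀ (by positivity), ENNReal.ofReal_one, one_mul]

/-- The density `1 + y²` is at least 1 and `r ≥ 1`, so it is dominated by its `r`-th power and can
be absorbed into `F`. Hölder's inequality on a finite measure then raises `r` to the integer `q`.
Functions decaying like `(1+y²)^(-1)` are thereby controlled by uniform pointwise bounds. -/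
theorem eLpNorm_pow_le_cauchyWeight {r : ℝ≥0∞} (hr1 : 1 ≤ r) (hr : r ≠ ∞) {q : ℕ} (hq : r ≤ q) :
    ∃ C : ℝ≥0∞, C ≠ ∞ ∧ ∀ F : ℝ → ℂ, AEStronglyMeasurable F volume →
      eLpNorm F r volume ^ q ≤
        C * ∫⁻ y, ‖((1 + y ^ 2 : ℝ) : ℂ) * F y‖ₑ ^ q ∂cauchyWeight := by
  have hr0 : r ≠ 0 := (zero_lt_one.trans_le hr1).ne'
  have hq0 : (q : ℝ≥0∞) ≠ 0 := (zero_lt_one.trans_le (hr1.trans hq)).ne'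
  have hq0' : q ≠ 0 := by exact_mod_cast hq0
  have hrr : 1 ≤ r.toReal := by simpa using ENNReal.toReal_mono hr hr1
  refine ⟨(cauchyWeight univ ^ (1 / r.toReal - 1 / (q : ℝ≥0∞).toReal)) ^ q,
    ENNReal.pow_ne_top (ENNReal.rpow_ne_top_of_nonneg ?_ (measure_ne_top _ _)), fun F hF => ?_⟩
  · rw [sub_nonneg]
    exact one_div_le_one_div_of_le (by linarith) (ENNReal.toReal_mono (by simp) hq)
  set G : ℝ → ℂ := fun y => ((1 + y ^ 2 : ℝ) : ℂ) * F y
  have hGm : AEStronglyMeasurable G volume := by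
    refine AEStronglyMeasurable.mul ?_ hF
    exact (Continuous.aestronglyMeasurable (by fun_prop))
  have h1 : eLpNorm F r volume ≤ eLpNorm G r cauchyWeight := by
    rw [eLpNorm_eq_lintegral_rpow_enorm_toReal hr0 hr, eLpNorm_eq_lintegral_rpow_enorm_toReal hr0 hr]
    refine ENNReal.rpow_le_rpow ?_ (by positivity)
    rw [lintegral_eq_lintegral_cauchyWeight (hF.enorm.pow_const _)]
    refine lintegral_mono fun y => ?_
    simp only [G]
    have hy : (1 : ℝ≥0∞) ≤ ENNReal.ofReal (1 + y ^ 2) := by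
      rw [ENNReal.one_le_ofReal]; nlinarith
    have e : ‖((1 + y ^ 2 : ℝ) : ℂ)‖ₑ = ENNReal.ofReal (1 + y ^ 2) := by
      rw [← ofReal_norm, Complex.norm_real, Real.norm_of_nonneg (by positivity)]
    rw [enorm_mul, ENNReal.mul_rpow_of_nonneg _ _ (by linarith), e]
    gcongr
    nth_rewrite 1 [← ENNReal.rpow_one (ENNReal.ofReal (1 + y ^ 2))]
    exact ENNReal.rpow_le_rpow_of_exponent_le hy hrr
  have h2 := h1.trans (eLpNorm_le_eLpNorm_mul_rpow_measure_univ hq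
    (hGm.mono_ac cauchyWeight_absolutelyContinuous))
  refine (pow_le_pow_left₀ zero_le h2 q).trans (le_of_eq ?_)
  rw [mul_pow, mul_comm]
  congr 1
  rw [eLpNorm_eq_lintegral_rpow_enorm_toReal hq0 (by simp)]
  simp only [ENNReal.toReal_natCast, ENNReal.rpow_natCast]
  rw [← ENNReal.rpow_natCast, ← ENNReal.rpow_mul, one_div, inv_mul_cancel₀ (by exact_mod_cast hq0'),
    ENNReal.rpow_one]

/-! ### Bessel potential spaces -/

namespace BesselSpace

variable {s : ℝ} {p : ℝ≥0∞} [Fact (1 ≤ p)]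

theorem norm_def (f : BesselSpace s p) : ‖f‖ = ‖f.toLp‖ := rfl

theorem isometry_toLp : Isometry (toLp : BesselSpace s p → Lp ℂ p (volume : Measure ℝ)) :=
  AddMonoidHomClass.isometry_of_norm _ fun _ => rfl

theorem toDist_mk (f : 𝓢'(ℝ, ℂ)) (h : TemperedDistribution.MemSobolev s p f) :
    (mk f h).toDist = f := rfl

theorem toDist_eq (f : BesselSpace s p) :
    f.toDist = TemperedDistribution.besselPotential ℝ ℂ (-s)
      (Lp.toTemperedDistributionCLM ℂ (volume : Measure ℝ) p f.toLp) := by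
  rw [Lp.toTemperedDistributionCLM_apply, coe_toLp]
  simp

theorem continuous_toDist : Continuous (toDist : BesselSpace s p → 𝓢'(ℝ, ℂ)) := by
  simp_rw [funext (toDist_eq (s := s) (p := p))]
  exact (ContinuousLinearMap.continuous _).comp
    ((ContinuousLinearMap.continuous _).comp isometry_toLp.continuous)

theorem surjective_toLp :
    Function.Surjective (toLp : BesselSpace s p → Lp ℂ p (volume : Measure ℝ)) := by
  intro g
  have h : TemperedDistribution.MemSobolev s p
      (TemperedDistribution.besselPotential ℝ ℂ (-s) (g : 𝓢'(ℝ, ℂ))) := ⟨g, by simp⟩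
  refine ⟨mk _ h, coeLp_injective ?_⟩
  rw [Lp.toTemperedDistributionCLM_apply, Lp.toTemperedDistributionCLM_apply, coe_toLp, toDist_mk]
  simp

/-- `toLp` is a surjective isometry onto a complete space. Completeness is needed to sum series of
paths and to take limits of Cauchy sequences. -/
instance : CompleteSpace (BesselSpace s p) := by
  have h := isometry_toLp (s := s) (p := p)
  rw [completeSpace_congr (e := Equiv.ofBijective toLp ⟨toLp_injective, surjective_toLp⟩)
    h.isUniformEmbedding]
  infer_instance

variable (s p) in
/-- The inclusion of the Schwartz functions. -/
def ofSchwartz (f : 𝓢(ℝ, ℂ)) : BesselSpace s p := mk (f : 𝓢'(ℝ, ℂ)) f.memSobolev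

theorem toDist_ofSchwartz (f : 𝓢(ℝ, ℂ)) : (ofSchwartz s p f).toDist = (f : 𝓢'(ℝ, ℂ)) := rfl

end BesselSpace

/-- The Bessel potential on Schwartz functions. -/
def schwartzBessel (s : ℝ) : 𝓢(ℝ, ℂ) →L[ℂ] 𝓢(ℝ, ℂ) :=
  SchwartzMap.fourierMultiplierCLM ℂ fun x : ℝ => (((1 + ‖x‖ ^ 2) ^ (s / 2) : ℝ) : ℂ)

namespace BesselSpace

variable {s : ℝ} {p : ℝ≥0∞} [Fact (1 ≤ p)]

theorem toLp_ofSchwartz (f : 𝓢(ℝ, ℂ)) :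
    (ofSchwartz s p f).toLp = (schwartzBessel s f).toLp p := by
  apply coeLp_injective
  rw [Lp.toTemperedDistributionCLM_apply, Lp.toTemperedDistributionCLM_apply, coe_toLp,
    toDist_ofSchwartz, Lp.toTemperedDistribution_toLp_eq, TemperedDistribution.besselPotential,
    TemperedDistribution.fourierMultiplierCLM_toTemperedDistributionCLM_eq (by fun_prop)]
  rfl

end BesselSpace

/-! ### Localized monomials and exponentials -/

section Cut

/-- A smooth compactly supported function. -/
structure Cut where
  toFun : ℝ → ℝ
  smooth : ContDiff ℝ ((⊤ : ℕ∞) : WithTop ℕ∞) toFun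
  compact : HasCompactSupport toFun

/-- The product of a cutoff with a smooth function, as a Schwartz function. -/
def Cut.mul (ρ : Cut) (g : ℝ → ℂ) (hg : ContDiff ℝ ((⊤ : ℕ∞) : WithTop ℕ∞) g) : 𝓢(ℝ, ℂ) :=
  HasCompactSupport.toSchwartzMap (f := fun x => (ρ.toFun x : ℂ) * g x)
    ((ρ.compact.comp_left (g := Complex.ofReal) Complex.ofReal_zero).mul_right)
    ((Complex.ofRealCLM.contDiff.comp ρ.smooth).mul hg)

theorem Cut.mul_apply (ρ : Cut) (g : ℝ → ℂ) (hg) (x : ℝ) :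
    ρ.mul g hg x = (ρ.toFun x : ℂ) * g x := rfl

/-- The localized monomial `ρ(x) x^l / l!`. -/
def Cut.mono (ρ : Cut) (l : ℕ) : 𝓢(ℝ, ℂ) :=
  ρ.mul (fun x => (x : ℂ) ^ l / (l.factorial : ℂ))
    ((Complex.ofRealCLM.contDiff.pow l).div_const _)

/-- The localized exponential `ρ(x) e^{cx}`. -/
def Cut.exp (ρ : Cut) (c : ℂ) : 𝓢(ℝ, ℂ) :=
  ρ.mul (fun x => Complex.exp (c * x)) ((contDiff_const.mul Complex.ofRealCLM.contDiff).cexp)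

theorem Cut.mono_apply (ρ : Cut) (l : ℕ) (x : ℝ) :
    ρ.mono l x = (ρ.toFun x : ℂ) * ((x : ℂ) ^ l / (l.factorial : ℂ)) := rfl

theorem Cut.exp_apply (ρ : Cut) (c : ℂ) (x : ℝ) :
    ρ.exp c x = (ρ.toFun x : ℂ) * Complex.exp (c * x) := rfl

/-- Differentiating `i` times costs a factor `l.descFactorial i ≤ l^i ≤ i! e^l`, which is only
exponential in `l` and is absorbed by enlarging the base from `M` to `M e`. -/
theorem norm_iteratedFDeriv_monomial_le {M : ℝ} (hM : 1 ≤ M) {x : ℝ} (hx : |x| ≤ M) (i l : ℕ) :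
    ‖iteratedFDeriv ℝ i (fun x : ℝ => (x : ℂ) ^ l / (l.factorial : ℂ)) x‖ ≤
      i.factorial * ((M * Real.exp 1) ^ l / l.factorial) := by
  have e : (fun x : ℝ => (x : ℂ) ^ l / (l.factorial : ℂ)) =
      fun x : ℝ => Complex.ofRealCLM (x ^ l / (l.factorial : ℝ)) := by
    ext x; simp
  have h1 := ContinuousLinearMap.norm_iteratedFDeriv_comp_left (𝕜 := ℝ) Complex.ofRealCLM
    (f := fun x : ℝ => x ^ l / (l.factorial : ℝ)) (x := x) (N := ((⊤ : ℕ∞) : WithTop ℕ∞))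
    (by fun_prop) (n := i) (by exact_mod_cast le_top)
  rw [e]
  refine h1.trans ?_
  rw [Complex.ofRealCLM_norm, one_mul, norm_iteratedFDeriv_eq_norm_iteratedDeriv]
  have h2 : iteratedDeriv i (fun x : ℝ => x ^ l / (l.factorial : ℝ)) x =
      l.descFactorial i * x ^ (l - i) / l.factorial := by
    simp_rw [div_eq_mul_inv]
    rw [iteratedDeriv_mul_const_field, iteratedDeriv_pow]
  rw [h2, norm_div, norm_mul, norm_pow]
  simp only [Real.norm_eq_abs, Nat.abs_cast]
  have h3 : (l.descFactorial i : ℝ) ≤ i.factorial * Real.exp 1 ^ l := by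
    have : (l : ℝ) ^ i / i.factorial ≤ Real.exp l := Real.pow_div_factorial_le_exp _ (by positivity) _
    rw [div_le_iff₀ (by positivity)] at this
    calc (l.descFactorial i : ℝ) ≤ (l : ℝ) ^ i := by exact_mod_cast Nat.descFactorial_le_pow l i
      _ ≤ _ := by rw [← Real.exp_nat_mul, mul_one]; linarith
  have h4 : |x| ^ (l - i) ≤ M ^ l :=
    (pow_le_pow_left₀ (abs_nonneg _) hx _).trans (pow_le_pow_right₀ hM (Nat.sub_le _ _))
  calc _ ≤ (i.factorial * Real.exp 1 ^ l) * M ^ l / l.factorial := by gcongr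
    _ = _ := by rw [mul_pow]; ring

/-- The Schwartz seminorms of the localized monomials decay factorially. -/
theorem Cut.seminorm_mono_le (ρ : Cut) : ∃ b : ℝ, 0 ≤ b ∧ ∀ k n : ℕ, ∃ C : ℝ, 0 ≤ C ∧ ∀ l : ℕ,
    SchwartzMap.seminorm ℂ k n (ρ.mono l) ≤ C * (b ^ l / l.factorial) := by
  obtain ⟨M, hM1, hM⟩ : ∃ M : ℝ, 1 ≤ M ∧ ∀ x ∈ tsupport ρ.toFun, |x| ≤ M := by
    obtain ⟨R, hR⟩ := ρ.compact.isCompact.isBounded.exists_norm_le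
    exact ⟨max 1 R, le_max_left _ _, fun x hx => (hR x hx).trans (le_max_right _ _)⟩
  refine ⟨M * Real.exp 1, by positivity, fun k n => ?_⟩
  set R : 𝓢(ℝ, ℂ) := ρ.mul (fun _ => 1) contDiff_const
  have hR : ∀ x, R x = (ρ.toFun x : ℂ) := fun x => by simp [R, Cut.mul_apply]
  refine ⟨M ^ k * ∑ i ∈ Finset.range (n + 1), (n.choose i : ℝ) * SchwartzMap.seminorm ℂ 0 i R *
    (n - i).factorial, by positivity, fun l => ?_⟩
  refine SchwartzMap.seminorm_le_bound ℂ k n _ (by positivity) fun x => ?_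
  have hcoe : ((ρ.mono l : 𝓢(ℝ, ℂ)) : ℝ → ℂ) =
      fun x => R x * ((x : ℂ) ^ l / (l.factorial : ℂ)) := by
    ext x; rw [hR]; rfl
  by_cases hx : x ∈ tsupport ρ.toFun
  · have h1 := norm_iteratedFDeriv_mul_le (𝕜 := ℝ) (f := R)
      (g := fun x : ℝ => (x : ℂ) ^ l / (l.factorial : ℂ)) (N := ((⊤ : ℕ∞) : WithTop ℕ∞)) (x := x)
      (R.smooth _) ((Complex.ofRealCLM.contDiff.pow l).div_const _) (n := n)
      (by exact_mod_cast le_top)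
    rw [hcoe]
    calc _ ≤ M ^ k * ∑ i ∈ Finset.range (n + 1), (n.choose i : ℝ) * SchwartzMap.seminorm ℂ 0 i R *
          ((n - i).factorial * ((M * Real.exp 1) ^ l / l.factorial)) := by
          gcongr
          · exact hM x hx
          · refine h1.trans (Finset.sum_le_sum fun i _ => ?_)
            gcongr
            · exact SchwartzMap.norm_iteratedFDeriv_le_seminorm ℂ R i x
            · exact norm_iteratedFDeriv_monomial_le hM1 (hM x hx) _ _
      _ = _ := by
          rw [mul_assoc, Finset.sum_mul]
          congr 1
          refine Finset.sum_congr rfl fun i _ => by ring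
  · have h0 : iteratedFDeriv ℝ n (ρ.mono l) x = 0 := by
      by_contra hne
      have h2 := support_iteratedFDeriv_subset (𝕜 := ℝ) (f := ρ.mono l) n hne
      refine hx (closure_mono (fun y hy => ?_) h2)
      intro h3
      apply hy
      rw [hcoe]
      simp [hR, h3]
    rw [h0, norm_zero, mul_zero]
    positivity

/-- A continuous linear map into a normed space is bounded by finitely many Schwartz seminorms. The
base `b` is the same for all seminorms, hence for all maps. -/
theorem Cut.norm_clm_mono_le (ρ : Cut) : ∃ b : ℝ, 0 ≤ b ∧ ∀ {G : Type} [NormedAddCommGroup G]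
    [NormedSpace ℂ G] (T : 𝓢(ℝ, ℂ) →L[ℂ] G), ∃ C : ℝ, 0 ≤ C ∧ ∀ l : ℕ,
    ‖T (ρ.mono l)‖ ≤ C * (b ^ l / l.factorial) := by
  obtain ⟨b, hb, h⟩ := ρ.seminorm_mono_le
  refine ⟨b, hb, fun T => ?_⟩
  choose C hC0 hC using h
  obtain ⟨s, D, -, hD⟩ := Seminorm.bound_of_continuous
    (schwartz_withSeminorms ℂ ℝ ℂ) ((normSeminorm ℂ _).comp T.toLinearMap)
    (continuous_norm.comp T.continuous)
  refine ⟨D * ∑ i ∈ s, C i.1 i.2, mul_nonneg D.2 (Finset.sum_nonneg fun i _ => hC0 _ _), fun l => ?_⟩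
  have h1 := hD (ρ.mono l)
  refine h1.trans ?_
  rw [smul_apply, NNReal.smul_def, smul_eq_mul, mul_assoc]
  gcongr
  refine Seminorm.finset_sup_apply_le (mul_nonneg (Finset.sum_nonneg fun i _ => hC0 _ _)
    (by positivity)) fun i hi => (hC i.1 i.2 l).trans ?_
  gcongr
  exact Finset.single_le_sum (f := fun i : ℕ × ℕ => C i.1 i.2) (fun i _ => hC0 _ _) hi

/-- A series of Schwartz functions with summable seminorms converges in the Schwartz space to its
pointwise sum. -/
theorem hasSum_schwartz {f : ℕ → 𝓢(ℝ, ℂ)} {g : 𝓢(ℝ, ℂ)}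
    (hs : ∀ k n, Summable fun l => SchwartzMap.seminorm ℂ k n (f l))
    (hg : ∀ x, HasSum (fun l => f l x) (g x)) : HasSum f g := by
  have hder : ∀ n x, HasSum (fun l => iteratedFDeriv ℝ n (f l) x) (iteratedFDeriv ℝ n g x) := by
    intro n x
    have e : (g : ℝ → ℂ) = fun x => ∑' l, f l x := by ext x; exact (hg x).tsum_eq.symm
    have hb : ∀ (k : ℕ) (i : ℕ) (x : ℝ), ‖iteratedFDeriv ℝ k (f i) x‖ ≤
        SchwartzMap.seminorm ℂ 0 k (f i) := fun k i x =>
      SchwartzMap.norm_iteratedFDeriv_le_seminorm ℂ (f i) k x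
    rw [e, iteratedFDeriv_tsum_apply (N := ⊤) (v := fun k i => SchwartzMap.seminorm ℂ 0 k (f i))
      (fun i => (f i).smooth _) (fun k _ => hs 0 k) (fun k i x _ => hb k i x) le_top x]
    exact (Summable.of_norm_bounded (hs 0 n) fun i => hb n i x).hasSum
  rw [HasSum, (schwartz_withSeminorms ℂ ℝ ℂ).tendsto_nhds]
  rintro ⟨k, n⟩ ε hε
  have ht := (tendsto_tsum_compl_atTop_zero
    fun l => SchwartzMap.seminorm ℂ k n (f l)).eventually (gt_mem_nhds hε)
  filter_upwards [ht] with S hS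
  refine lt_of_le_of_lt ?_ hS
  rw [map_sub_rev]
  refine SchwartzMap.seminorm_le_bound ℂ k n _ (tsum_nonneg fun _ => by positivity) fun x => ?_
  have e1 : iteratedFDeriv ℝ n (⇑(g - ∑ i ∈ S, f i)) x =
      ∑' i : {i // i ∉ S}, iteratedFDeriv ℝ n (f i) x := by
    have hS' : ⇑(∑ i ∈ S, f i) = fun x => ∑ i ∈ S, f i x := by
      ext x; simp
    have : ⇑(g - ∑ i ∈ S, f i) = ⇑g - fun x => ∑ i ∈ S, f i x := by
      ext x; simp
    rw [this, iteratedFDeriv_sub_apply (g.contDiffAt n)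
      ((ContDiff.sum fun i _ => (f i).smooth n).contDiffAt), iteratedFDeriv_fun_sum_apply
      (fun i _ => (f i).contDiffAt n), ← (hder n x).tsum_eq,
      ← (hder n x).summable.sum_add_tsum_compl (s := S), add_sub_cancel_left]
    rfl
  rw [e1, ← norm_norm, ← norm_pow, ← norm_smul, ← tsum_const_smul'']
  refine tsum_of_norm_bounded ((hs k n).subtype _).hasSum fun i => ?_
  rw [norm_smul, norm_pow, norm_norm]
  exact SchwartzMap.le_seminorm ℂ k n (f i) x

/-- The Taylor series of the exponential, localized, converges in the Schwartz topology and so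
passes through Bessel potentials. It links the monomials in which the paths are expanded with the
exponentials for which sharp bounds hold. -/
theorem Cut.hasSum_exp (ρ : Cut) (c : ℂ) : HasSum (fun l => c ^ l • ρ.mono l) (ρ.exp c) := by
  obtain ⟨b, hb, h⟩ := ρ.seminorm_mono_le
  refine hasSum_schwartz (fun k n => ?_) fun x => ?_
  · obtain ⟨C, hC, h⟩ := h k n
    refine Summable.of_nonneg_of_le (fun l => by positivity) (fun l => ?_)
      ((Real.summable_pow_div_factorial (‖c‖ * b)).mul_left C)
    rw [map_smul_eq_mul, norm_pow]
    refine (mul_le_mul_of_nonneg_left (h l) (by positivity)).trans (le_of_eq ?_)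
    rw [mul_pow]
    ring
  · have h1 := (NormedSpace.expSeries_div_hasSum_exp (c * x)).mul_left (ρ.toFun x : ℂ)
    rw [← Complex.exp_eq_exp_ℂ] at h1
    refine h1.congr_fun fun l => ?_
    rw [smul_apply, Cut.mono_apply, mul_pow, smul_eq_mul]
    ring

end Cut

/-! ### Bessel potentials of localized exponentials -/

section BesselExp

/-- Two integrations by parts produce `4π² y²`; the constant `4π² ≥ 1` is dropped. -/
theorem one_add_sq_mul_norm_fourier_le {g g₁ g₂ : ℝ → ℂ} (h1 : ∀ x, HasDerivAt g (g₁ x) x)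
    (h2 : ∀ x, HasDerivAt g₁ (g₂ x) x) (i0 : Integrable g) (i1 : Integrable g₁)
    (i2 : Integrable g₂) (y : ℝ) :
    (1 + y ^ 2) * ‖𝓕 g y‖ ≤ (∫ x, ‖g x‖) + ∫ x, ‖g₂ x‖ := by
  have e1 : deriv g = g₁ := funext fun x => (h1 x).deriv
  have e2 : deriv g₁ = g₂ := funext fun x => (h2 x).deriv
  have f1 := Real.fourier_deriv i0 (fun x => (h1 x).differentiableAt) (by rwa [e1])
  have f2 := Real.fourier_deriv i1 (fun x => (h2 x).differentiableAt) (by rwa [e2])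
  rw [e1] at f1
  rw [e2, f1] at f2
  have b0 : ‖𝓕 g y‖ ≤ ∫ x, ‖g x‖ := VectorFourier.norm_fourierIntegral_le_integral_norm _ _ _ _ _
  have b2 : ‖𝓕 g₂ y‖ ≤ ∫ x, ‖g₂ x‖ := VectorFourier.norm_fourierIntegral_le_integral_norm _ _ _ _ _
  rw [f2] at b2
  simp only [smul_eq_mul, norm_mul, Complex.norm_I, Complex.norm_real, Real.norm_eq_abs,
    Complex.norm_ofNat, mul_one, abs_of_pos Real.pi_pos] at b2
  have b3 : y ^ 2 * ‖𝓕 g y‖ ≤ 2 * Real.pi * |y| * (2 * Real.pi * |y| * ‖𝓕 g y‖) := by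
    have : 2 * Real.pi * |y| * (2 * Real.pi * |y| * ‖𝓕 g y‖) =
        (4 * Real.pi ^ 2) * (y ^ 2 * ‖𝓕 g y‖) := by
      rw [← sq_abs y]; ring
    rw [this]
    refine le_mul_of_one_le_left (by positivity) ?_
    nlinarith [Real.pi_gt_three]
  linarith

/-- The symbol `(1 + λ²)^s`. -/
def bracket (s x : ℝ) : ℝ := (1 + x ^ 2) ^ s

theorem bracket_nonneg (s x : ℝ) : 0 ≤ bracket s x := by unfold bracket; positivity

theorem hasDerivAt_bracket (s x : ℝ) :
    HasDerivAt (bracket s) (2 * s * x * bracket (s - 1) x) x := by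
  have h : HasDerivAt (fun x : ℝ => 1 + x ^ 2) (2 * x) x := by
    simpa using (hasDerivAt_pow 2 x).const_add 1
  refine (h.rpow_const (p := s) (Or.inl (by positivity))).congr_deriv ?_
  rw [bracket]; ring

theorem bracket_sub_one (s x : ℝ) : bracket (s - 1) x = bracket s x / (1 + x ^ 2) := by
  rw [bracket, Real.rpow_sub_one (by positivity), bracket]

theorem abs_mul_bracket_sub_one_le (s x : ℝ) : |x * bracket (s - 1) x| ≤ bracket s x := by
  rw [bracket_sub_one, abs_mul, abs_div, abs_of_nonneg (bracket_nonneg s x),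
    abs_of_pos (show 0 < 1 + x ^ 2 by positivity), mul_div_assoc', div_le_iff₀ (by positivity),
    mul_comm]
  refine mul_le_mul_of_nonneg_left ?_ (bracket_nonneg s x)
  nlinarith [sq_abs x, sq_nonneg (|x| - 1)]

theorem bracket_sub_one_le (s x : ℝ) : bracket (s - 1) x ≤ bracket s x := by
  rw [bracket_sub_one]
  exact div_le_self (bracket_nonneg s x) (by nlinarith)

theorem hasDerivAt_bracket_deriv (s x : ℝ) :
    HasDerivAt (fun x => 2 * s * x * bracket (s - 1) x)
      (2 * s * bracket (s - 1) x + 4 * s * (s - 1) * x * (x * bracket (s - 1 - 1) x)) x := by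
  have h := (((hasDerivAt_id x).const_mul (2 * s)).mul (hasDerivAt_bracket (s - 1) x))
  refine h.congr_deriv ?_
  simp only [id]
  ring

/-- Derivatives of the bracket are bounded by the bracket itself, so it behaves like a constant when
integrating by parts; the next lemma is the second order case. -/
theorem abs_bracket_deriv_le (s x : ℝ) :
    |2 * s * x * bracket (s - 1) x| ≤ 2 * |s| * bracket s x := by
  have := abs_mul_bracket_sub_one_le s x
  calc |2 * s * x * bracket (s - 1) x| = 2 * |s| * |x * bracket (s - 1) x| := by
        rw [show 2 * s * x * bracket (s - 1) x = 2 * s * (x * bracket (s - 1) x) by ring, abs_mul,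
          abs_mul, abs_two]
    _ ≤ _ := by gcongr

theorem abs_bracket_deriv_deriv_le (s x : ℝ) :
    |2 * s * bracket (s - 1) x + 4 * s * (s - 1) * x * (x * bracket (s - 1 - 1) x)| ≤
      (2 * |s| + 4 * |s| * |s - 1|) * bracket s x := by
  have h1 := bracket_sub_one_le s x
  have h2 : |x * (x * bracket (s - 1 - 1) x)| ≤ bracket s x := by
    rw [bracket_sub_one (s - 1), bracket_sub_one s, abs_of_nonneg]
    · rw [div_div, mul_div_assoc', mul_div_assoc', div_le_iff₀ (by positivity)]
      have := bracket_nonneg s x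
      have h3 : x * x ≤ (1 + x ^ 2) * (1 + x ^ 2) := by nlinarith [sq_nonneg x]
      nlinarith
    · rw [← mul_assoc]
      have := bracket_nonneg s x
      have : 0 ≤ x * x := mul_self_nonneg x
      positivity
  calc _ ≤ |2 * s * bracket (s - 1) x| + |4 * s * (s - 1) * x * (x * bracket (s - 1 - 1) x)| :=
        abs_add_le _ _
    _ = 2 * |s| * bracket (s - 1) x + 4 * |s| * |s - 1| * |x * (x * bracket (s - 1 - 1) x)| := by
        rw [show 4 * s * (s - 1) * x * (x * bracket (s - 1 - 1) x) =
          4 * s * (s - 1) * (x * (x * bracket (s - 1 - 1) x)) by ring]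
        rw [abs_mul (2 * s), abs_mul (4 * s * (s - 1)), abs_mul (4 * s), abs_mul 4, abs_mul 2,
          abs_two, abs_of_nonneg (bracket_nonneg (s - 1) x), abs_of_pos (four_pos (α := ℝ))]
    _ ≤ 2 * |s| * bracket s x + 4 * |s| * |s - 1| * bracket s x := by gcongr
    _ = _ := by ring

/-- Peetre's inequality. -/
theorem bracket_neg_le {s : ℝ} (hs : 0 ≤ s) (x a : ℝ) :
    bracket (-s) x ≤ 2 ^ s * bracket (-s) a * bracket s (x - a) := by
  have h : 1 + a ^ 2 ≤ 2 * (1 + x ^ 2) * (1 + (x - a) ^ 2) := by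
    nlinarith [sq_nonneg (x * (x - a)), sq_nonneg (2 * x - a)]
  have h2 := Real.rpow_le_rpow (by positivity) h hs
  rw [Real.mul_rpow (by positivity) (by positivity), Real.mul_rpow (by positivity) (by positivity)] at h2
  simp only [bracket, Real.rpow_neg (show 0 ≤ 1 + x ^ 2 by positivity),
    Real.rpow_neg (show 0 ≤ 1 + a ^ 2 by positivity)]
  have p1 : 0 < (1 + x ^ 2) ^ s := by positivity
  have p2 : 0 < (1 + a ^ 2) ^ s := by positivity
  rw [← mul_inv_le_iff₀ (by positivity), ← div_eq_mul_inv] at *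
  field_simp
  field_simp at h2
  linarith

/-- Modulation is translation in frequency; the `2π` is that of the convention for `𝓕`, whereas the
exponential carries the angular frequency `η`. -/
theorem fourier_cut_exp (ρ : Cut) (η x : ℝ) :
    𝓕 (ρ.exp (Complex.I * η)) x = 𝓕 (ρ.exp 0) (x - η / (2 * Real.pi)) := by
  rw [SchwartzMap.fourier_coe, SchwartzMap.fourier_coe, Real.fourier_real_eq, Real.fourier_real_eq]
  refine integral_congr_ae (Eventually.of_forall fun v => ?_)
  simp only [Cut.exp_apply, Circle.smul_def, Real.fourierChar_apply, smul_eq_mul]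
  rw [zero_mul, Complex.exp_zero, mul_one, mul_left_comm, mul_comm _ (ρ.toFun v : ℂ), ← Complex.exp_add]
  congr 2
  push_cast
  field_simp
  ring

theorem schwartzBessel_apply (s : ℝ) (f : 𝓢(ℝ, ℂ)) (y : ℝ) :
    schwartzBessel s f y = 𝓕 (fun x => (bracket (s / 2) x : ℂ) * 𝓕 f x) (-y) := by
  rw [schwartzBessel, SchwartzMap.fourierMultiplierCLM_apply, SchwartzMap.fourierInv_coe,
    Real.fourierInv_eq_fourier_neg]
  refine congrArg (fun g : ℝ → ℂ => 𝓕 g (-y)) (funext fun x => ?_)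
  rw [SchwartzMap.smulLeftCLM_apply_apply (by fun_prop)]
  simp [bracket]

/-- The transform of `ρ e^{iη·}` is a Schwartz bump centred at `η/(2π)`, so by Peetre's inequality
the weight may be evaluated at the centre. Smoothness of the weighted bump in frequency gives the
decay `(1+y²)^(-1)` in space, uniformly in `η`. -/
theorem Cut.norm_schwartzBessel_exp_le (ρ : Cut) {α : ℝ} (hα : 0 ≤ α) :
    ∃ C : ℝ, 0 ≤ C ∧ ∀ η y : ℝ,
      (1 + y ^ 2) * ‖schwartzBessel (-α) (ρ.exp (Complex.I * η)) y‖ ≤ C * bracket (-α / 2) η := by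
  set τ := 𝓕 (ρ.exp 0)
  set τ₁ := SchwartzMap.derivCLM ℂ ℂ τ
  set τ₂ := SchwartzMap.derivCLM ℂ ℂ τ₁
  have hτ : ∀ x, HasDerivAt τ (τ₁ x) x := fun x => τ.differentiableAt.hasDerivAt
  have hτ₁ : ∀ x, HasDerivAt τ₁ (τ₂ x) x := fun x => τ₁.differentiableAt.hasDerivAt
  set s := α / 2 with hs
  have hs0 : 0 ≤ s := by positivity
  have int : ∀ φ : 𝓢(ℝ, ℂ), Integrable fun x => bracket s x * ‖φ x‖ := by
    intro φ
    have h1 := (SchwartzMap.smulLeftCLM ℂ (fun x : ℝ => (((1 + ‖x‖ ^ 2) ^ s : ℝ) : ℂ)) φ).integrable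
      (μ := volume)
    refine h1.norm.congr (Eventually.of_forall fun x => ?_)
    simp only []
    rw [SchwartzMap.smulLeftCLM_apply_apply (by fun_prop), norm_smul, Complex.norm_real,
      Real.norm_of_nonneg (by positivity), bracket, Real.norm_eq_abs, sq_abs]
  set m := bracket (-s)
  set m₁ : ℝ → ℝ := fun x => 2 * (-s) * x * bracket (-s - 1) x
  set m₂ : ℝ → ℝ := fun x =>
    2 * (-s) * bracket (-s - 1) x + 4 * (-s) * (-s - 1) * x * (x * bracket (-s - 1 - 1) x)
  set c₁ : ℝ := 2 * |(-s)|
  set c₂ : ℝ := 2 * |(-s)| + 4 * |(-s)| * |(-s) - 1|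
  have hm : ∀ x, HasDerivAt (fun x => (m x : ℂ)) (m₁ x) x := fun x => (hasDerivAt_bracket _ x).ofReal_comp
  have hm₁ : ∀ x, HasDerivAt (fun x => (m₁ x : ℂ)) (m₂ x) x :=
    fun x => (hasDerivAt_bracket_deriv _ x).ofReal_comp
  have bm : ∀ x, ‖(m x : ℂ)‖ ≤ m x := fun x => by
    rw [Complex.norm_real, Real.norm_of_nonneg (bracket_nonneg _ _)]
  have bm₁ : ∀ x, ‖(m₁ x : ℂ)‖ ≤ c₁ * m x := fun x => by
    rw [Complex.norm_real]; exact abs_bracket_deriv_le _ _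
  have bm₂ : ∀ x, ‖(m₂ x : ℂ)‖ ≤ c₂ * m x := fun x => by
    rw [Complex.norm_real]; exact abs_bracket_deriv_deriv_le _ _
  set H : ℝ → ℝ := fun u => bracket s u * ‖τ u‖ + bracket s u * ‖τ₁ u‖ + bracket s u * ‖τ₂ u‖
  have iH : Integrable H := ((int τ).add (int τ₁)).add (int τ₂)
  set c : ℝ := 1 + 2 * c₁ + c₂
  have hc1 : 0 ≤ c₁ := by positivity
  have hc2 : 0 ≤ c₂ := by positivity
  -- Here `a` is the centre of the bump. The weighted bump and its first two derivatives are all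
  -- dominated by the same multiple of the translate `H (x - a)`.
  have key : ∀ a y : ℝ, (1 + y ^ 2) * ‖𝓕 (fun x => (m x : ℂ) * τ (x - a)) y‖ ≤
      2 * (c * 2 ^ s * (∫ u, H u)) * m a := by
    intro a y
    have dτ : ∀ x, HasDerivAt (fun x => τ (x - a)) (τ₁ (x - a)) x := fun x =>
      (hτ (x - a)).comp_sub_const x a
    have dτ₁ : ∀ x, HasDerivAt (fun x => τ₁ (x - a)) (τ₂ (x - a)) x := fun x =>
      (hτ₁ (x - a)).comp_sub_const x a
    set g : ℝ → ℂ := fun x => (m x : ℂ) * τ (x - a)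
    set g₁ : ℝ → ℂ := fun x => (m₁ x : ℂ) * τ (x - a) + (m x : ℂ) * τ₁ (x - a)
    set g₂ : ℝ → ℂ := fun x => ((m₂ x : ℂ) * τ (x - a) + (m₁ x : ℂ) * τ₁ (x - a)) +
      ((m₁ x : ℂ) * τ₁ (x - a) + (m x : ℂ) * τ₂ (x - a))
    have h1 : ∀ x, HasDerivAt g (g₁ x) x := fun x => (hm x).mul (dτ x)
    have h2 : ∀ x, HasDerivAt g₁ (g₂ x) x := fun x =>
      ((hm₁ x).mul (dτ x)).add ((hm x).mul (dτ₁ x))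
    have pe : ∀ x, m x ≤ 2 ^ s * m a * bracket s (x - a) := fun x => bracket_neg_le hs0 x a
    have iHa : Integrable fun x => c * 2 ^ s * m a * H (x - a) := (iH.comp_sub_right a).const_mul _
    have hm0 : ∀ x, 0 ≤ m x := fun x => bracket_nonneg _ _
    have base : ∀ x, c * (m x * (‖τ (x - a)‖ + ‖τ₁ (x - a)‖ + ‖τ₂ (x - a)‖)) ≤
        c * 2 ^ s * m a * H (x - a) := by
      intro x
      have : m x * (‖τ (x - a)‖ + ‖τ₁ (x - a)‖ + ‖τ₂ (x - a)‖) ≤ 2 ^ s * m a * bracket s (x - a) *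
          (‖τ (x - a)‖ + ‖τ₁ (x - a)‖ + ‖τ₂ (x - a)‖) := by
        gcongr; exact pe x
      refine (mul_le_mul_of_nonneg_left this (by positivity)).trans (le_of_eq ?_)
      simp only [H]; ring
    have n0 : ∀ x, ‖g x‖ ≤ c * 2 ^ s * m a * H (x - a) := by
      intro x
      refine le_trans ?_ (base x)
      have t0 : ‖g x‖ ≤ m x * ‖τ (x - a)‖ := by
        simp only [g, norm_mul]; gcongr; exact bm x
      have := hm0 x
      have p0 : 0 ≤ m x * ‖τ (x - a)‖ := by positivity
      have p1 : 0 ≤ m x * ‖τ₁ (x - a)‖ := by positivity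
      have p2 : 0 ≤ m x * ‖τ₂ (x - a)‖ := by positivity
      simp only [c]
      nlinarith [mul_nonneg hc1 p0, mul_nonneg hc1 p1, mul_nonneg hc1 p2, mul_nonneg hc2 p0,
        mul_nonneg hc2 p1, mul_nonneg hc2 p2]
    have n1 : ∀ x, ‖g₁ x‖ ≤ c * 2 ^ s * m a * H (x - a) := by
      intro x
      refine le_trans ?_ (base x)
      have t0 : ‖g₁ x‖ ≤ c₁ * m x * ‖τ (x - a)‖ + m x * ‖τ₁ (x - a)‖ := by
        refine (norm_add_le _ _).trans ?_
        simp only [norm_mul]; gcongr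
        · exact bm₁ x
        · exact bm x
      have := hm0 x
      have p0 : 0 ≤ m x * ‖τ (x - a)‖ := by positivity
      have p1 : 0 ≤ m x * ‖τ₁ (x - a)‖ := by positivity
      have p2 : 0 ≤ m x * ‖τ₂ (x - a)‖ := by positivity
      simp only [c]
      nlinarith [mul_nonneg hc1 p0, mul_nonneg hc1 p1, mul_nonneg hc1 p2, mul_nonneg hc2 p0,
        mul_nonneg hc2 p1, mul_nonneg hc2 p2]
    have n2 : ∀ x, ‖g₂ x‖ ≤ c * 2 ^ s * m a * H (x - a) := by
      intro x
      refine le_trans ?_ (base x)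
      have t0 : ‖g₂ x‖ ≤ (c₂ * m x * ‖τ (x - a)‖ + c₁ * m x * ‖τ₁ (x - a)‖) +
          (c₁ * m x * ‖τ₁ (x - a)‖ + m x * ‖τ₂ (x - a)‖) := by
        refine (norm_add_le _ _).trans (add_le_add ((norm_add_le _ _).trans ?_)
          ((norm_add_le _ _).trans ?_))
        · simp only [norm_mul]; gcongr
          · exact bm₂ x
          · exact bm₁ x
        · simp only [norm_mul]; gcongr
          · exact bm₁ x
          · exact bm x
      have := hm0 x
      have p0 : 0 ≤ m x * ‖τ (x - a)‖ := by positivity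
      have p1 : 0 ≤ m x * ‖τ₁ (x - a)‖ := by positivity
      have p2 : 0 ≤ m x * ‖τ₂ (x - a)‖ := by positivity
      simp only [c]
      nlinarith [mul_nonneg hc1 p0, mul_nonneg hc1 p1, mul_nonneg hc1 p2, mul_nonneg hc2 p0,
        mul_nonneg hc2 p1, mul_nonneg hc2 p2]
    have c0 : Continuous g := continuous_iff_continuousAt.2 fun x => (h1 x).continuousAt
    have c1 : Continuous g₁ := continuous_iff_continuousAt.2 fun x => (h2 x).continuousAt
    have mb : ∀ r, Continuous (bracket r) := fun r =>
      continuous_iff_continuousAt.2 fun x => (hasDerivAt_bracket r x).continuousAt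
    have c2 : Continuous g₂ := by
      have := mb (-s - 1)
      have := mb (-s - 1 - 1)
      have := mb (-s)
      have s0 := τ.continuous
      have s1 := τ₁.continuous
      have s2 := τ₂.continuous
      fun_prop
    have i0 := iHa.mono' c0.aestronglyMeasurable (Eventually.of_forall n0)
    have i1 := iHa.mono' c1.aestronglyMeasurable (Eventually.of_forall n1)
    have i2 := iHa.mono' c2.aestronglyMeasurable (Eventually.of_forall n2)
    refine (one_add_sq_mul_norm_fourier_le h1 h2 i0 i1 i2 y).trans ?_
    have I0 := integral_mono i0.norm iHa n0
    have I2 := integral_mono i2.norm iHa n2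
    rw [integral_const_mul, integral_sub_right_eq_self H a] at I0 I2
    linarith
  -- Passes from the weight at `η/(2π)` to the weight at `η`, at the price of the constant
  -- `(4π²)^s`.
  have scale : ∀ η : ℝ, m (η / (2 * Real.pi)) ≤ (4 * Real.pi ^ 2) ^ s * bracket (-α / 2) η := by
    intro η
    have h1 : (1 + η ^ 2) / (4 * Real.pi ^ 2) ≤ 1 + (η / (2 * Real.pi)) ^ 2 := by
      rw [div_pow, div_le_iff₀ (by positivity)]
      field_simp
      nlinarith [Real.pi_gt_three]
    have h2 := Real.rpow_le_rpow_of_nonpos (by positivity) h1 (show -s ≤ 0 by linarith)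
    refine h2.trans (le_of_eq ?_)
    rw [Real.div_rpow (by positivity) (by positivity), Real.rpow_neg (x := 4 * Real.pi ^ 2) (by positivity),
      div_inv_eq_mul, mul_comm, bracket, hs]
    congr 2
    ring
  have hH : 0 ≤ ∫ u, H u := integral_nonneg fun u => by
    have := bracket_nonneg s u
    positivity
  refine ⟨2 * (c * 2 ^ s * (∫ u, H u)) * (4 * Real.pi ^ 2) ^ s, by positivity, fun η y => ?_⟩
  have := key (η / (2 * Real.pi)) (-y)
  rw [schwartzBessel_apply]
  simp_rw [fourier_cut_exp]
  rw [show -α / 2 = -s by rw [hs]; ring] at *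
  rw [neg_sq] at this
  refine this.trans ?_
  rw [mul_assoc _ _ (bracket (-s) η)]
  exact mul_le_mul_of_nonneg_left (scale η) (by positivity)

end BesselExp

/-! ### The heat symbol -/

section HeatSymbol

/-- The coefficient `∫_0^t s^j/j! (t-s)^i/i! ds`. -/
def simplexCoef (j i : ℕ) (t : ℝ) : ℝ :=
  ∫ s in (0 : ℝ)..t, s ^ j / j.factorial * ((t - s) ^ i / i.factorial)

theorem simplexCoef_zero (j i : ℕ) : simplexCoef j i 0 = 0 := by simp [simplexCoef]

theorem continuous_simplexCoef (j i : ℕ) : Continuous (simplexCoef j i) := by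
  refine intervalIntegral.continuous_parametric_intervalIntegral_of_continuous
    (f := fun t s => s ^ j / j.factorial * ((t - s) ^ i / i.factorial)) ?_ continuous_id
  simp only [Function.uncurry_def]
  fun_prop

theorem abs_simplexCoef_le (j i : ℕ) {t : ℝ} (ht : t ∈ Icc (0 : ℝ) 1) :
    |simplexCoef j i t| ≤ 1 / (j.factorial * i.factorial) := by
  have h := intervalIntegral.norm_integral_le_of_norm_le_const (a := 0) (b := t)
    (C := 1 / (j.factorial * i.factorial))
    (f := fun s : ℝ => s ^ j / j.factorial * ((t - s) ^ i / i.factorial)) ?_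
  · refine h.trans ?_
    rw [sub_zero, abs_of_nonneg ht.1]
    exact mul_le_of_le_one_right (by positivity) ht.2
  · intro s hs
    rw [uIoc_of_le ht.1] at hs
    have h1 : 0 ≤ t - s := by linarith [hs.2]
    have h2 : s ^ j ≤ 1 := pow_le_one₀ hs.1.le (hs.2.trans ht.2)
    have h3 : (t - s) ^ i ≤ 1 := pow_le_one₀ h1 (by linarith [hs.1, ht.2])
    have h4 : 0 ≤ s ^ j := pow_nonneg hs.1.le _
    rw [Real.norm_of_nonneg (by positivity), div_mul_div_comm]
    gcongr
    exact mul_le_one₀ h2 (by positivity) h3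

theorem hasSum_exp_mul_exp (a b : ℂ) : HasSum (fun k : ℕ × ℕ =>
    a ^ k.1 / (k.1.factorial : ℂ) * (b ^ k.2 / (k.2.factorial : ℂ)))
    (Complex.exp a * Complex.exp b) := by
  have h : ∀ a : ℂ, HasSum (fun n : ℕ => a ^ n / (n.factorial : ℂ)) (Complex.exp a) := fun a => by
    rw [Complex.exp_eq_exp_ℂ]
    exact NormedSpace.expSeries_div_hasSum_exp a
  have hn : ∀ a : ℂ, Summable fun n : ℕ => ‖a ^ n / (n.factorial : ℂ)‖ := fun a =>
    NormedSpace.norm_expSeries_div_summable a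
  rw [← (h a).tsum_eq, ← (h b).tsum_eq, tsum_mul_tsum_of_summable_norm (hn a) (hn b)]
  exact (summable_mul_of_summable_norm (hn a) (hn b)).hasSum

/-- The symbol `∫_0^t e^{iξs} e^{-η²(t-s)} ds` of the heat operator. -/
def heatSymbol (t ξ η : ℝ) : ℂ :=
  ∫ s in (0 : ℝ)..t, Complex.exp (Complex.I * ξ * s) * Complex.exp (-(η : ℂ) ^ 2 * (t - s))

/-- Both exponentials are expanded under the integral. The coefficients `simplexCoef` are those of
the heat convolution of monomials, so the path series can be resummed to this symbol. -/
theorem hasSum_heatSymbol {t : ℝ} (ht : t ∈ Icc (0 : ℝ) 1) (ξ η : ℝ) :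
    HasSum (fun k : ℕ × ℕ => (Complex.I * ξ) ^ k.1 * (-(η : ℂ) ^ 2) ^ k.2 *
      (simplexCoef k.1 k.2 t : ℂ)) (heatSymbol t ξ η) := by
  have h := intervalIntegral.hasSum_integral_of_dominated_convergence (μ := volume)
    (a := 0) (b := t)
    (F := fun (k : ℕ × ℕ) (s : ℝ) => (Complex.I * ξ * s) ^ k.1 / k.1.factorial *
      ((-(η : ℂ) ^ 2 * (t - s)) ^ k.2 / k.2.factorial))
    (f := fun s => Complex.exp (Complex.I * ξ * s) * Complex.exp (-(η : ℂ) ^ 2 * (t - s)))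
    (fun k _ => |ξ| ^ k.1 / k.1.factorial * ((η ^ 2) ^ k.2 / k.2.factorial)) ?_ ?_ ?_ ?_ ?_
  · rw [heatSymbol]
    refine h.congr_fun fun k => ?_
    rw [simplexCoef, ← intervalIntegral.integral_ofReal, ← intervalIntegral.integral_const_mul]
    refine intervalIntegral.integral_congr fun s _ => ?_
    simp only [mul_pow]
    push_cast
    ring
  · intro k
    exact (Continuous.aestronglyMeasurable (by fun_prop))
  · intro k
    refine Eventually.of_forall fun s hs => ?_
    rw [uIoc_of_le ht.1] at hs
    have h1 : |s| ≤ 1 := by rw [abs_of_pos hs.1]; exact hs.2.trans ht.2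
    have h2 : |t - s| ≤ 1 := by rw [abs_of_nonneg (by linarith [hs.2])]; linarith [hs.1, ht.2]
    rw [norm_mul, norm_div, norm_div, norm_pow, norm_pow, norm_mul, norm_mul, norm_mul, norm_neg,
      norm_pow, Complex.norm_I, ← Complex.ofReal_sub, Complex.norm_real, Complex.norm_real,
      Complex.norm_real, Complex.norm_real, Complex.norm_natCast, Complex.norm_natCast, one_mul]
    simp only [Real.norm_eq_abs, sq_abs]
    gcongr
    · exact mul_le_of_le_one_right (by positivity) h1
    · exact mul_le_of_le_one_right (by positivity) h2
  · refine Eventually.of_forall fun s hs => ?_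
    exact (Real.summable_pow_div_factorial |ξ|).mul_of_nonneg
      (Real.summable_pow_div_factorial (η ^ 2)) (fun _ => by positivity) (fun _ => by positivity)
  · exact intervalIntegrable_const
  · refine Eventually.of_forall fun s hs => ?_
    exact hasSum_exp_mul_exp _ _

/-- The time integral is explicit. The factor `iξ + η²` dominates both `|ξ|` and `η²` in modulus,
which is the source of the parabolic smoothing. -/
theorem mul_heatSymbol (t ξ η : ℝ) (hξ : ξ ≠ 0) :
    (Complex.I * ξ + (η : ℂ) ^ 2) * heatSymbol t ξ η =
      Complex.exp (Complex.I * ξ * t) - Complex.exp (-(η : ℂ) ^ 2 * t) := by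
  set c : ℂ := Complex.I * ξ + (η : ℂ) ^ 2 with hc
  have hc0 : c ≠ 0 := by
    intro h
    have := congrArg Complex.im h
    simp [hc, ← Complex.ofReal_pow] at this
    exact hξ this
  have e : heatSymbol t ξ η = Complex.exp (-(η : ℂ) ^ 2 * t) * ∫ s in (0 : ℝ)..t, Complex.exp (c * s) := by
    rw [heatSymbol, ← intervalIntegral.integral_const_mul]
    refine intervalIntegral.integral_congr fun s _ => ?_
    simp only [← Complex.exp_add]
    congr 1
    rw [hc]; ring
  rw [e, integral_exp_mul_complex hc0, mul_left_comm, mul_div_cancel₀ _ hc0, mul_sub,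
    ← Complex.exp_add, ← Complex.exp_add]
  congr 2
  · rw [hc]; ring
  · simp

theorem norm_exp_I_sub_le (ξ s t : ℝ) :
    ‖Complex.exp (Complex.I * ξ * t) - Complex.exp (Complex.I * ξ * s)‖ ≤ |ξ| * |t - s| := by
  have e : Complex.exp (Complex.I * ξ * t) - Complex.exp (Complex.I * ξ * s) =
      Complex.exp (Complex.I * (ξ * s : ℝ)) * (Complex.exp (Complex.I * (ξ * (t - s) : ℝ)) - 1) := by
    rw [mul_sub, mul_one, ← Complex.exp_add]
    congr 2
    · push_cast; ring
    · push_cast; ring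
  rw [e, norm_mul, mul_comm Complex.I, Complex.norm_exp_ofReal_mul_I, one_mul]
  refine (Real.norm_exp_I_mul_ofReal_sub_one_le).trans ?_
  rw [Real.norm_eq_abs, abs_mul]

theorem abs_exp_neg_sub_le {c s t : ℝ} (hc : 0 ≤ c) (hs : 0 ≤ s) (hst : s ≤ t) :
    |Real.exp (-c * t) - Real.exp (-c * s)| ≤ c * (t - s) := by
  have h1 : Real.exp (-c * t) ≤ Real.exp (-c * s) := Real.exp_le_exp.2 (by nlinarith)
  rw [abs_sub_comm, abs_of_nonneg (by linarith)]
  have h2 : Real.exp (-c * t) = Real.exp (-c * s) * Real.exp (-(c * (t - s))) := by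
    rw [← Real.exp_add]; congr 1; ring
  have h3 := Real.add_one_le_exp (-(c * (t - s)))
  have h4 : Real.exp (-c * s) ≤ 1 := Real.exp_le_one_iff.2 (by nlinarith)
  have h5 : 0 ≤ c * (t - s) := mul_nonneg hc (by linarith)
  rw [h2]
  nlinarith [Real.exp_pos (-c * s)]

/-- Interpolates between a Lipschitz bound in time and decay of order one in `1+|ξ|+η²`: giving up a
power `ε` of the decay buys the Hölder exponent `ε` that chaining needs. -/
theorem norm_heatSymbol_sub_le {s t : ℝ} (hs : 0 ≤ s) (hst : s ≤ t) (ht : t ≤ 1) {ξ : ℝ} (hξ : ξ ≠ 0)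
    (η : ℝ) {ε : ℝ} (hε0 : 0 ≤ ε) (hε1 : ε ≤ 1) :
    ‖heatSymbol t ξ η - heatSymbol s ξ η‖ ≤
      10 * ((t - s) ^ ε * (1 + |ξ| + η ^ 2) ^ (-(1 - ε))) := by
  set c : ℂ := Complex.I * ξ + (η : ℂ) ^ 2 with hc
  have im : c.im = ξ := by simp [hc, ← Complex.ofReal_pow]
  have re : c.re = η ^ 2 := by simp [hc, ← Complex.ofReal_pow]
  have a1 : |ξ| ≤ ‖c‖ := by rw [← im]; exact Complex.abs_im_le_norm c
  have a2 : η ^ 2 ≤ ‖c‖ := by rw [← re]; exact (le_abs_self _).trans (Complex.abs_re_le_norm c)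
  have a0 : 0 < ‖c‖ := (abs_pos.2 hξ).trans_le a1
  set X := heatSymbol t ξ η - heatSymbol s ξ η
  have e : c * X = (Complex.exp (Complex.I * ξ * t) - Complex.exp (Complex.I * ξ * s)) -
      ((Real.exp (-(η ^ 2) * t) - Real.exp (-(η ^ 2) * s) : ℝ) : ℂ) := by
    simp only [X]
    rw [mul_sub, hc, mul_heatSymbol t ξ η hξ, mul_heatSymbol s ξ η hξ]
    push_cast
    ring
  have n1 := norm_exp_I_sub_le ξ s t
  rw [abs_of_nonneg (sub_nonneg.2 hst)] at n1
  have n2 := abs_exp_neg_sub_le (sq_nonneg η) hs hst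
  have n3 := norm_sub_le (Complex.exp (Complex.I * ξ * t) - Complex.exp (Complex.I * ξ * s))
      ((Real.exp (-(η ^ 2) * t) - Real.exp (-(η ^ 2) * s) : ℝ) : ℂ)
  rw [← e, Complex.norm_real, Real.norm_eq_abs, norm_mul] at n3
  have b1 : ‖X‖ ≤ 2 * (t - s) := by
    have : ‖c‖ * ‖X‖ ≤ ‖c‖ * (2 * (t - s)) := by
      have h1 : |ξ| * (t - s) ≤ ‖c‖ * (t - s) := mul_le_mul_of_nonneg_right a1 (by linarith)
      have h2 : η ^ 2 * (t - s) ≤ ‖c‖ * (t - s) := mul_le_mul_of_nonneg_right a2 (by linarith)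
      linarith
    exact le_of_mul_le_mul_left this a0
  have b2 : ‖c‖ * ‖X‖ ≤ 4 := by
    have m1 : ‖Complex.exp (Complex.I * ξ * t) - Complex.exp (Complex.I * ξ * s)‖ ≤ 1 + 1 := by
      refine (norm_sub_le _ _).trans (add_le_add ?_ ?_) <;>
      · rw [mul_assoc, ← Complex.ofReal_mul, mul_comm, Complex.norm_exp_ofReal_mul_I]
    have m2 : |Real.exp (-(η ^ 2) * t) - Real.exp (-(η ^ 2) * s)| ≤ 1 := by
      have h1 : Real.exp (-(η ^ 2) * t) ≤ 1 := Real.exp_le_one_iff.2 (by nlinarith [sq_nonneg η])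
      have h2 : Real.exp (-(η ^ 2) * s) ≤ 1 := Real.exp_le_one_iff.2 (by nlinarith [sq_nonneg η])
      rw [abs_le]
      constructor <;> linarith [Real.exp_pos (-(η ^ 2) * t), Real.exp_pos (-(η ^ 2) * s)]
    linarith
  have hD : 0 < 1 + |ξ| + η ^ 2 := by positivity
  -- The constant is `2 + 4 + 4`: the Lipschitz bound with `t - s ≤ 1` handles the summand 1, and
  -- `b2` handles each of `|ξ|` and `η²`.
  have b3 : ‖X‖ ≤ 10 * (1 + |ξ| + η ^ 2)⁻¹ := by
    rw [← div_eq_mul_inv, le_div_iff₀ hD]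
    have h1 : ‖X‖ * |ξ| ≤ ‖c‖ * ‖X‖ := by rw [mul_comm]; gcongr
    have h2 : ‖X‖ * η ^ 2 ≤ ‖c‖ * ‖X‖ := by rw [mul_comm]; gcongr
    nlinarith
  have hts : 0 ≤ t - s := by linarith
  rcases (norm_nonneg X).eq_or_lt with h0 | h0
  · rw [← h0]; positivity
  calc ‖X‖ = ‖X‖ ^ ε * ‖X‖ ^ (1 - ε) := by rw [← Real.rpow_add h0]; simp
    _ ≤ (10 * (t - s)) ^ ε * (10 * (1 + |ξ| + η ^ 2)⁻¹) ^ (1 - ε) := by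
        have : 0 ≤ 1 - ε := by linarith
        gcongr
        linarith
    _ = (10 ^ ε * 10 ^ (1 - ε)) * ((t - s) ^ ε * (1 + |ξ| + η ^ 2) ^ (-(1 - ε))) := by
        rw [Real.mul_rpow (by norm_num) hts, Real.mul_rpow (by norm_num) (by positivity),
          Real.inv_rpow hD.le, Real.rpow_neg hD.le]
        ring
    _ = _ := by
        rw [← Real.rpow_add (by norm_num)]
        norm_num

end HeatSymbol

/-! ### Square integrability of the frequency weights -/

section Weights

theorem integrable_comp_abs_of_integrableOn {f : ℝ → ℝ} (hf : IntegrableOn f (Ioi 0)) :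
    Integrable fun x => f |x| := by
  have hp : IntegrableOn (fun x => f |x|) (Ioi 0) :=
    hf.congr_fun (fun x hx => by simp only [abs_of_pos (mem_Ioi.1 hx)]) measurableSet_Ioi
  have hn : IntegrableOn (fun x ↦ f |x|) (Iic 0) := by
    rw [← Measure.map_neg_eq_self (volume : Measure ℝ)]
    let m : MeasurableEmbedding fun x : ℝ => -x := (Homeomorph.neg ℝ).measurableEmbedding
    rw [m.integrableOn_map_iff]
    simp_rw [Function.comp_def, abs_neg, neg_preimage, neg_Iic, neg_zero]
    exact Iff.mpr integrableOn_Ici_iff_integrableOn_Ioi hp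
  rw [← integrableOn_univ, ← Iic_union_Ioi (a := (0 : ℝ))]
  exact hn.union hp

/-- The square is `|ξ|^(1-2h)`, integrable at the origin since `h < 1`; at infinity the exponent `1
- 2h - a` is below `-1`. -/
theorem integrable_sq_mul_rpow {h a : ℝ} (h1 : h < 1) (ha : 2 - 2 * h < a) :
    Integrable fun ξ : ℝ => (|ξ| / |ξ| ^ (h + 1 / 2)) ^ 2 * (1 + |ξ|) ^ (-a) := by
  refine integrable_comp_abs_of_integrableOn
    (f := fun x => (x / x ^ (h + 1 / 2)) ^ 2 * (1 + x) ^ (-a)) ?_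
  have e : ∀ x : ℝ, 0 < x → (x / x ^ (h + 1 / 2)) ^ 2 = x ^ (1 - 2 * h) := by
    intro x hx
    nth_rewrite 1 [← Real.rpow_one x]
    rw [← Real.rpow_sub hx, ← Real.rpow_natCast, ← Real.rpow_mul hx.le]
    congr 1
    push_cast
    ring
  have m : Measurable fun x : ℝ => (x / x ^ (h + 1 / 2)) ^ 2 * (1 + x) ^ (-a) := by fun_prop
  rw [← Ioc_union_Ioi_eq_Ioi (zero_le_one (α := ℝ))]
  refine IntegrableOn.union ?_ ?_
  · have i : IntegrableOn (fun x : ℝ => x ^ (1 - 2 * h)) (Ioc 0 1) :=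
      (intervalIntegrable_iff_integrableOn_Ioc_of_le zero_le_one).1
        (intervalIntegral.intervalIntegrable_rpow' (by linarith))
    refine Integrable.mono' i m.aestronglyMeasurable ?_
    filter_upwards [ae_restrict_mem measurableSet_Ioc] with x hx
    have hx0 := hx.1
    rw [Real.norm_of_nonneg (by positivity), e x hx0]
    refine mul_le_of_le_one_right (by positivity) ?_
    exact Real.rpow_le_one_of_one_le_of_nonpos (by linarith) (by linarith)
  · have i : IntegrableOn (fun x : ℝ => x ^ (1 - 2 * h - a)) (Ioi 1) :=
      integrableOn_Ioi_rpow_of_lt (by linarith) one_pos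
    refine Integrable.mono' i m.aestronglyMeasurable ?_
    filter_upwards [ae_restrict_mem measurableSet_Ioi] with x hx
    have hx0 : 0 < x := one_pos.trans hx
    rw [Real.norm_of_nonneg (by positivity), e x hx0, sub_eq_add_neg _ a,
      Real.rpow_add hx0]
    gcongr ?_ * ?_
    exact Real.rpow_le_rpow_of_nonpos hx0 (by linarith) (by linarith)

theorem integrable_plane_mul {u v : ℝ → ℝ} (hu : Integrable u) (hv : Integrable v) :
    Integrable fun z : Plane => u (z 0) * v (z 1) := by
  have h1 : Integrable fun z : ℝ × ℝ => u z.1 * v z.2 := hu.mul_prod hv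
  have mp1 := EuclideanSpace.volume_preserving_symm_measurableEquiv_toLp (Fin 2)
  have mp2 := volume_preserving_finTwoArrow ℝ
  have h2 := (mp2.comp mp1).integrable_comp_of_integrable h1
  exact h2

/-- The weight `c_{H₀} c_{H₁} (iξ) |ξ|^{-H₀-1/2} (iη) |η|^{-H₁-1/2}`. -/
def noiseWeight (H₀ H₁ : ℝ) (z : Plane) : ℂ :=
  (sheetConst H₀ * sheetConst H₁ : ℂ) *
    ((Complex.I * z 0 / ((|z 0| ^ (H₀ + 1 / 2) : ℝ) : ℂ)) *
      (Complex.I * z 1 / ((|z 1| ^ (H₁ + 1 / 2) : ℝ) : ℂ)))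

theorem measurable_noiseWeight (H₀ H₁ : ℝ) : Measurable (noiseWeight H₀ H₁) := by
  unfold noiseWeight
  fun_prop

theorem norm_noiseWeight (H₀ H₁ : ℝ) (z : Plane) :
    ‖noiseWeight H₀ H₁ z‖ = |sheetConst H₀ * sheetConst H₁| *
      ((|z 0| / |z 0| ^ (H₀ + 1 / 2)) * (|z 1| / |z 1| ^ (H₁ + 1 / 2))) := by
  have h : ∀ x H : ℝ, ‖Complex.I * x / ((|x| ^ (H + 1 / 2) : ℝ) : ℂ)‖ = |x| / |x| ^ (H + 1 / 2) := by
    intro x H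
    rw [norm_div, norm_mul, Complex.norm_I, one_mul, Complex.norm_real, Complex.norm_real,
      Real.norm_eq_abs, Real.norm_of_nonneg (by positivity)]
  rw [noiseWeight, ← Complex.ofReal_mul, norm_mul, norm_mul, h, h, Complex.norm_real,
    Real.norm_eq_abs]

/-- The square-integrable majorant of the weights. -/
def majorant (H₀ H₁ a b : ℝ) (z : Plane) : ℝ :=
  ‖noiseWeight H₀ H₁ z‖ * ((1 + |z 0|) ^ (-a / 2) * (1 + z 1 ^ 2) ^ (-b / 2))

theorem majorant_nonneg (H₀ H₁ a b : ℝ) (z : Plane) : 0 ≤ majorant H₀ H₁ a b z := by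
  unfold majorant; positivity

/-- The variables separate. After squaring, the spatial factor `(1+η²)^(-b)` counts as
`(1+|η|)^(-2b)`, so the threshold for `b` has half the form of the one for `a`. -/
theorem memLp_majorant {H₀ H₁ a b : ℝ} (h₀ : H₀ < 1) (h₁ : H₁ < 1) (ha : 2 - 2 * H₀ < a)
    (hb : 1 - H₁ < b) : MemLp (majorant H₀ H₁ a b) 2 volume := by
  have m : Measurable (majorant H₀ H₁ a b) := by
    unfold majorant
    have := measurable_noiseWeight H₀ H₁
    fun_prop
  rw [memLp_two_iff_integrable_sq m.aestronglyMeasurable]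
  have hv : Integrable fun η : ℝ => (|η| / |η| ^ (H₁ + 1 / 2)) ^ 2 * (1 + η ^ 2) ^ (-b) := by
    have hb' : 2 - 2 * H₁ < 2 * b := by linarith
    refine ((integrable_sq_mul_rpow h₁ hb').const_mul (2 ^ b)).mono'
      (Measurable.aestronglyMeasurable (by fun_prop)) (Eventually.of_forall fun η => ?_)
    rw [Real.norm_of_nonneg (by positivity), mul_left_comm]
    refine mul_le_mul_of_nonneg_left ?_ (by positivity)
    have h1 : (1 + |η|) ^ 2 ≤ 2 * (1 + η ^ 2) := by nlinarith [sq_abs η, sq_nonneg (1 - |η|)]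
    have hb0 : 0 ≤ b := by linarith
    have h2 : ((1 + |η|) ^ 2) ^ b ≤ (2 * (1 + η ^ 2)) ^ b := by gcongr
    rw [Real.mul_rpow (by norm_num) (by positivity), ← Real.rpow_natCast, ← Real.rpow_mul (by positivity)] at h2
    push_cast at h2
    rw [Real.rpow_neg (by positivity), Real.rpow_neg (by positivity)]
    field_simp
    linarith
  refine ((integrable_plane_mul (integrable_sq_mul_rpow h₀ ha) hv).const_mul
    (|sheetConst H₀ * sheetConst H₁| ^ 2)).congr (Eventually.of_forall fun z => ?_)
  have e1 : ((1 + |z 0|) ^ (-a / 2)) ^ 2 = (1 + |z 0|) ^ (-a) := by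
    rw [← Real.rpow_natCast, ← Real.rpow_mul (by positivity)]; congr 1; push_cast; ring
  have e2 : ((1 + z 1 ^ 2) ^ (-b / 2)) ^ 2 = (1 + z 1 ^ 2) ^ (-b) := by
    rw [← Real.rpow_natCast, ← Real.rpow_mul (by positivity)]; congr 1; push_cast; ring
  simp only [majorant, norm_noiseWeight, mul_pow, e1, e2]
  ring

/-- A bounded frequency cutoff: a measurable function with values in `[-1, 1]` that vanishes outside
`[-Λ, Λ]²`. -/
structure IsFreqCutoff (θ : Plane → ℝ) (Λ : ℝ) : Prop where
  meas : Measurable θ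
  one_le : 1 ≤ Λ
  abs_le : ∀ z, |θ z| ≤ 1
  supp : ∀ z, θ z ≠ 0 → |z 0| ≤ Λ ∧ |z 1| ≤ Λ

/-- On a bounded box the decaying factors of the majorant are bounded below, so only the singularity
near the axes matters; `a` and `b` are arbitrary admissible exponents. -/
theorem IsFreqCutoff.memLp {θ : Plane → ℝ} {Λ : ℝ} (hθ : IsFreqCutoff θ Λ) {H₀ H₁ : ℝ}
    (h₀ : H₀ < 1) (h₁ : H₁ < 1) : MemLp (fun z => |θ z| * ‖noiseWeight H₀ H₁ z‖) 2 volume := by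
  set a : ℝ := 2 * (2 - 2 * H₀)
  set b : ℝ := 2 * (1 - H₁)
  have ha : 2 - 2 * H₀ < a := by simp only [a]; linarith
  have hb : 1 - H₁ < b := by simp only [b]; linarith
  have m : Measurable fun z => |θ z| * ‖noiseWeight H₀ H₁ z‖ := by
    have := hθ.meas
    have := measurable_noiseWeight H₀ H₁
    fun_prop
  have hΛ := hθ.one_le
  refine ((memLp_majorant h₀ h₁ ha hb).const_mul
    ((1 + Λ) ^ (a / 2) * (1 + Λ ^ 2) ^ (b / 2))).mono' m.aestronglyMeasurable
    (Eventually.of_forall fun z => ?_)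
  rw [Real.norm_of_nonneg (by positivity)]
  by_cases hz : θ z = 0
  · rw [hz, abs_zero, zero_mul]
    have := majorant_nonneg H₀ H₁ a b z
    positivity
  obtain ⟨z0, z1⟩ := hθ.supp z hz
  have k1 : 1 ≤ (1 + Λ) ^ (a / 2) * (1 + |z 0|) ^ (-a / 2) := by
    rw [neg_div, Real.rpow_neg (by positivity), ← div_eq_mul_inv, one_le_div (by positivity)]
    exact Real.rpow_le_rpow (by positivity) (by linarith) (by linarith)
  have k2 : 1 ≤ (1 + Λ ^ 2) ^ (b / 2) * (1 + z 1 ^ 2) ^ (-b / 2) := by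
    rw [neg_div, Real.rpow_neg (by positivity), ← div_eq_mul_inv, one_le_div (by positivity)]
    refine Real.rpow_le_rpow (by positivity) ?_ (by linarith)
    have := pow_le_pow_left₀ (abs_nonneg _) z1 2
    rw [sq_abs] at this
    linarith
  calc |θ z| * ‖noiseWeight H₀ H₁ z‖ ≤ 1 * ‖noiseWeight H₀ H₁ z‖ := by
        gcongr; exact hθ.abs_le z
    _ ≤ (((1 + Λ) ^ (a / 2) * (1 + |z 0|) ^ (-a / 2)) *
          ((1 + Λ ^ 2) ^ (b / 2) * (1 + z 1 ^ 2) ^ (-b / 2))) * ‖noiseWeight H₀ H₁ z‖ := by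
        gcongr
        exact one_le_mul_of_one_le_of_one_le k1 k2
    _ = _ := by rw [majorant]; ring

/-- The splitting of the parabolic weight, with the gain `N^{-ς}` at high frequencies. -/
theorem rpow_weight_le {a β α ς ε N : ℝ} (ha : 0 ≤ a) (hβ : β = 2 - 2 * ε - ς) (haβ : a ≤ β)
    (hς : 0 ≤ ς) (hN : 0 < N) {x y : ℝ} (hx : 0 ≤ x) (hy : 0 ≤ y) (h : N ^ 2 ≤ 1 + x + y) :
    (1 + x + y) ^ (-(1 - ε)) * (1 + y) ^ (-α / 2) ≤
      N ^ (-ς) * ((1 + x) ^ (-a / 2) * (1 + y) ^ (-(β - a + α) / 2)) := by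
  set D := 1 + x + y
  have hD : 0 < D := by positivity
  -- Since `2(1 - ε) = ς + β`, the decay splits into `ς` for the gain `N^(-ς)`, `a` for the time
  -- frequency and `β - a` for the space frequency.
  have e1 : D ^ (-(1 - ε)) = D ^ (-ς / 2) * (D ^ (-a / 2) * D ^ (-(β - a) / 2)) := by
    rw [← Real.rpow_add hD, ← Real.rpow_add hD]
    congr 1
    rw [hβ]; ring
  have k1 : D ^ (-ς / 2) ≤ N ^ (-ς) := by
    have := Real.rpow_le_rpow_of_nonpos (by positivity) h (show -ς / 2 ≤ 0 by linarith)
    refine this.trans (le_of_eq ?_)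
    rw [← Real.rpow_natCast, ← Real.rpow_mul hN.le]
    congr 1; push_cast; ring
  have k2 : D ^ (-a / 2) ≤ (1 + x) ^ (-a / 2) :=
    Real.rpow_le_rpow_of_nonpos (by positivity) (by simp only [D]; linarith) (by linarith)
  have k3 : D ^ (-(β - a) / 2) ≤ (1 + y) ^ (-(β - a) / 2) :=
    Real.rpow_le_rpow_of_nonpos (by positivity) (by simp only [D]; linarith) (by linarith)
  have e2 : (1 + y) ^ (-(β - a + α) / 2) = (1 + y) ^ (-(β - a) / 2) * (1 + y) ^ (-α / 2) := by
    rw [← Real.rpow_add (by positivity)]; congr 1; ring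
  rw [e1, e2]
  calc _ ≤ N ^ (-ς) * ((1 + x) ^ (-a / 2) * (1 + y) ^ (-(β - a) / 2)) * (1 + y) ^ (-α / 2) := by
        gcongr
    _ = _ := by ring

end Weights

/-! ### Double exponential series -/

section DoubleSeries

/-- The double exponential series `∑ a_{jk} s^j/j! y^k/k!`. -/
def dser (a : ℕ → ℕ → ℝ) (s y : ℝ) : ℝ :=
  ∑' k : ℕ × ℕ, a k.1 k.2 * (s ^ k.1 / k.1.factorial * (y ^ k.2 / k.2.factorial))

/-- Geometric growth of a double sequence. -/
def GeomBound (a : ℕ → ℕ → ℝ) (C Λ : ℝ) : Prop := ∀ j k, |a j k| ≤ C * Λ ^ (j + k)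

theorem summable_exp_mul_exp (C x y : ℝ) (hx : 0 ≤ x) (hy : 0 ≤ y) : Summable fun k : ℕ × ℕ =>
    C * (x ^ k.1 / (k.1.factorial : ℝ) * (y ^ k.2 / (k.2.factorial : ℝ))) :=
  ((Real.summable_pow_div_factorial x).mul_of_nonneg (Real.summable_pow_div_factorial y)
    (fun _ => by positivity) (fun _ => by positivity)).mul_left C

theorem tsum_exp_mul_exp (C x y : ℝ) (hx : 0 ≤ x) (hy : 0 ≤ y) : ∑' k : ℕ × ℕ,
    C * (x ^ k.1 / (k.1.factorial : ℝ) * (y ^ k.2 / (k.2.factorial : ℝ))) =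
      C * (Real.exp x * Real.exp y) := by
  have h := summable_exp_mul_exp 1 x y hx hy
  simp only [one_mul] at h
  rw [tsum_mul_left, h.tsum_prod]
  have e : ∀ x : ℝ, ∑' n : ℕ, x ^ n / (n.factorial : ℝ) = Real.exp x := fun x => by
    rw [Real.exp_eq_exp_ℝ, NormedSpace.exp_eq_tsum_div]
  simp_rw [tsum_mul_left, e, tsum_mul_right, e]

variable {a : ℕ → ℕ → ℝ} {C Λ : ℝ}

theorem GeomBound.nonneg (h : GeomBound a C Λ) : 0 ≤ C := by
  have := (abs_nonneg _).trans (h 0 0)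
  simpa using this

theorem GeomBound.norm_term_le (h : GeomBound a C Λ) (hΛ : 0 ≤ Λ) {x y s t : ℝ} (hs : |s| ≤ x)
    (ht : |t| ≤ y) (j k : ℕ) :
    ‖a j k * (s ^ j / j.factorial * (t ^ k / k.factorial))‖ ≤
      C * ((Λ * x) ^ j / j.factorial * ((Λ * y) ^ k / k.factorial)) := by
  have hx : 0 ≤ x := (abs_nonneg _).trans hs
  have hy : 0 ≤ y := (abs_nonneg _).trans ht
  have hC := h.nonneg
  rw [norm_mul, norm_mul, norm_div, norm_div, norm_pow, norm_pow]
  simp only [Real.norm_eq_abs, Nat.abs_cast]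
  calc _ ≤ (C * Λ ^ (j + k)) * (x ^ j / j.factorial * (y ^ k / k.factorial)) := by
        gcongr
        exact h j k
    _ = _ := by rw [pow_add, mul_pow, mul_pow]; ring

theorem GeomBound.summable (h : GeomBound a C Λ) (hΛ : 0 ≤ Λ) (s y : ℝ) : Summable fun k : ℕ × ℕ =>
    a k.1 k.2 * (s ^ k.1 / k.1.factorial * (y ^ k.2 / k.2.factorial)) :=
  Summable.of_norm_bounded (summable_exp_mul_exp C (Λ * |s|) (Λ * |y|) (by positivity) (by positivity))
    fun k => h.norm_term_le hΛ le_rfl le_rfl k.1 k.2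

theorem GeomBound.hasSum (h : GeomBound a C Λ) (hΛ : 0 ≤ Λ) (s y : ℝ) : HasSum (fun k : ℕ × ℕ =>
    a k.1 k.2 * (s ^ k.1 / k.1.factorial * (y ^ k.2 / k.2.factorial))) (dser a s y) :=
  (h.summable hΛ s y).hasSum

theorem GeomBound.abs_dser_le (h : GeomBound a C Λ) (hΛ : 0 ≤ Λ) (s y : ℝ) :
    |dser a s y| ≤ C * (Real.exp (Λ * |s|) * Real.exp (Λ * |y|)) := by
  rw [← tsum_exp_mul_exp C _ _ (by positivity) (by positivity)]
  exact tsum_of_norm_bounded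
    (summable_exp_mul_exp C (Λ * |s|) (Λ * |y|) (by positivity) (by positivity)).hasSum
    fun k => h.norm_term_le hΛ le_rfl le_rfl k.1 k.2

theorem GeomBound.shift_left (h : GeomBound a C Λ) : GeomBound (fun j k => a (j + 1) k) (C * Λ) Λ := by
  intro j k
  refine (h (j + 1) k).trans (le_of_eq ?_)
  rw [show j + 1 + k = (j + k) + 1 by ring, pow_succ]; ring

theorem GeomBound.shift_right (h : GeomBound a C Λ) : GeomBound (fun j k => a j (k + 1)) (C * Λ) Λ := by
  intro j k
  refine (h j (k + 1)).trans (le_of_eq ?_)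
  rw [show j + (k + 1) = (j + k) + 1 by ring, pow_succ]; ring

theorem hasDerivAt_pow_div_factorial (j : ℕ) (s : ℝ) :
    HasDerivAt (fun s : ℝ => s ^ j / j.factorial) (j * s ^ (j - 1) / j.factorial) s :=
  (hasDerivAt_pow j s).div_const _

theorem abs_deriv_pow_div_factorial_le {R s : ℝ} (hR : 1 ≤ R) (hs : |s| ≤ R) (j : ℕ) :
    |j * s ^ (j - 1) / j.factorial| ≤ (2 * R) ^ j / j.factorial := by
  rw [abs_div, abs_mul, abs_pow, Nat.abs_cast, Nat.abs_cast, mul_pow]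
  gcongr
  · exact_mod_cast Nat.lt_two_pow_self.le
  · exact (pow_le_pow_left₀ (abs_nonneg _) hs _).trans (pow_le_pow_right₀ hR (Nat.sub_le _ _))

theorem tsum_shift_left (a : ℕ → ℕ → ℝ) (s y : ℝ) :
    ∑' k : ℕ × ℕ, a k.1 k.2 * ((k.1 * s ^ (k.1 - 1) / k.1.factorial) * (y ^ k.2 / k.2.factorial)) =
      dser (fun j k => a (j + 1) k) s y := by
  have inj : Function.Injective fun k : ℕ × ℕ => (k.1 + 1, k.2) := by
    rintro ⟨a, b⟩ ⟨c, d⟩ h; simp at h; simp [h]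
  rw [dser, ← inj.tsum_eq]
  · refine tsum_congr fun k => ?_
    simp only [Nat.add_sub_cancel, Nat.factorial_succ]
    push_cast
    have : (k.1 : ℝ) + 1 ≠ 0 := by positivity
    field_simp
  · intro k hk
    rcases k with ⟨_ | j, k⟩
    · simp at hk
    · exact ⟨(j, k), rfl⟩

theorem tsum_shift_right (a : ℕ → ℕ → ℝ) (s y : ℝ) :
    ∑' k : ℕ × ℕ, a k.1 k.2 * ((s ^ k.1 / k.1.factorial) * (k.2 * y ^ (k.2 - 1) / k.2.factorial)) =
      dser (fun j k => a j (k + 1)) s y := by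
  have inj : Function.Injective fun k : ℕ × ℕ => (k.1, k.2 + 1) := by
    rintro ⟨a, b⟩ ⟨c, d⟩ h; simp at h; simp [h]
  rw [dser, ← inj.tsum_eq]
  · refine tsum_congr fun k => ?_
    simp only [Nat.add_sub_cancel, Nat.factorial_succ]
    push_cast
    have : (k.2 : ℝ) + 1 ≠ 0 := by positivity
    field_simp
  · intro k hk
    rcases k with ⟨j, _ | k⟩
    · simp at hk
    · exact ⟨(j, k), rfl⟩

/-- Termwise differentiation on a ball around the origin; each partial derivative merely shifts the
coefficients. The radius is at least 1, so lowering an exponent never worsens a bound. -/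
theorem GeomBound.hasFDerivAt_dser (h : GeomBound a C Λ) (hΛ : 0 ≤ Λ) (z : ℝ × ℝ) :
    HasFDerivAt (fun z : ℝ × ℝ => dser a z.1 z.2)
      (dser (fun j k => a (j + 1) k) z.1 z.2 • ContinuousLinearMap.fst ℝ ℝ ℝ +
        dser (fun j k => a j (k + 1)) z.1 z.2 • ContinuousLinearMap.snd ℝ ℝ ℝ) z := by
  set R : ℝ := ‖z‖ + 1
  have hR : 1 ≤ R := by simp [R]
  have hC := h.nonneg
  set f' : ℕ × ℕ → ℝ × ℝ → (ℝ × ℝ →L[ℝ] ℝ) := fun k z =>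
    (a k.1 k.2 * ((k.1 * z.1 ^ (k.1 - 1) / k.1.factorial) * (z.2 ^ k.2 / k.2.factorial))) •
        ContinuousLinearMap.fst ℝ ℝ ℝ +
      (a k.1 k.2 * ((z.1 ^ k.1 / k.1.factorial) * (k.2 * z.2 ^ (k.2 - 1) / k.2.factorial))) •
        ContinuousLinearMap.snd ℝ ℝ ℝ
  have hder : ∀ (k : ℕ × ℕ) (z : ℝ × ℝ), HasFDerivAt
      (fun z : ℝ × ℝ => a k.1 k.2 * (z.1 ^ k.1 / k.1.factorial * (z.2 ^ k.2 / k.2.factorial)))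
      (f' k z) z := by
    intro k z
    have d1 := (hasDerivAt_pow_div_factorial k.1 z.1).comp_hasFDerivAt z
      (hasFDerivAt_fst (𝕜 := ℝ) (E := ℝ) (F := ℝ) (p := z))
    have d2 := (hasDerivAt_pow_div_factorial k.2 z.2).comp_hasFDerivAt z
      (hasFDerivAt_snd (𝕜 := ℝ) (E := ℝ) (F := ℝ) (p := z))
    refine ((d1.mul d2).const_mul (a k.1 k.2)).congr_fderiv ?_
    ext
    · simp [f']
      exact Or.inl (by ring)
    · simp [f']
  set u : ℕ × ℕ → ℝ := fun k => 2 * (C * ((Λ * (2 * R)) ^ k.1 / k.1.factorial *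
    ((Λ * (2 * R)) ^ k.2 / k.2.factorial)))
  have hu : Summable u :=
    (summable_exp_mul_exp C (Λ * (2 * R)) (Λ * (2 * R)) (by positivity) (by positivity)).mul_left 2
  have parts : ∀ (k : ℕ × ℕ) (p q : ℝ), |p| ≤ (2 * R) ^ k.1 / k.1.factorial →
      |q| ≤ (2 * R) ^ k.2 / k.2.factorial → |a k.1 k.2 * (p * q)| ≤
        C * ((Λ * (2 * R)) ^ k.1 / k.1.factorial * ((Λ * (2 * R)) ^ k.2 / k.2.factorial)) := by
    intro k p q hp hq
    rw [abs_mul, abs_mul]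
    calc _ ≤ (C * Λ ^ (k.1 + k.2)) * (((2 * R) ^ k.1 / k.1.factorial) *
          ((2 * R) ^ k.2 / k.2.factorial)) := by
          gcongr
          exact h _ _
      _ = _ := by rw [pow_add, mul_pow Λ, mul_pow Λ]; ring
  have pw : ∀ (j : ℕ) (s : ℝ), |s| ≤ R → |s ^ j / j.factorial| ≤ (2 * R) ^ j / j.factorial := by
    intro j s hs
    rw [abs_div, abs_pow, Nat.abs_cast]
    gcongr
    linarith
  have hbd : ∀ (k : ℕ × ℕ) (w : ℝ × ℝ), w ∈ Metric.ball (0 : ℝ × ℝ) R → ‖f' k w‖ ≤ u k := by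
    intro k w hw
    rw [mem_ball_zero_iff] at hw
    have w1 : |w.1| ≤ R := (norm_fst_le w).trans hw.le
    have w2 : |w.2| ≤ R := (norm_snd_le w).trans hw.le
    refine (norm_add_le _ _).trans ?_
    rw [norm_smul, norm_smul]
    have n1 := ContinuousLinearMap.norm_fst_le ℝ ℝ ℝ
    have n2 := ContinuousLinearMap.norm_snd_le ℝ ℝ ℝ
    have p1 := parts k _ _ (abs_deriv_pow_div_factorial_le hR w1 k.1) (pw k.2 w.2 w2)
    have p2 := parts k _ _ (pw k.1 w.1 w1) (abs_deriv_pow_div_factorial_le hR w2 k.2)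
    have q1 := mul_le_of_le_one_right (abs_nonneg (a k.1 k.2 *
      ((k.1 * w.1 ^ (k.1 - 1) / k.1.factorial) * (w.2 ^ k.2 / k.2.factorial)))) n1
    have q2 := mul_le_of_le_one_right (abs_nonneg (a k.1 k.2 *
      ((w.1 ^ k.1 / k.1.factorial) * (k.2 * w.2 ^ (k.2 - 1) / k.2.factorial)))) n2
    simp only [u, Real.norm_eq_abs]
    linarith
  have hz : z ∈ Metric.ball (0 : ℝ × ℝ) R := by rw [mem_ball_zero_iff]; simp [R]
  have main := hasFDerivAt_tsum_of_isPreconnected hu Metric.isOpen_ball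
    (convex_ball (0 : ℝ × ℝ) R).isPreconnected (fun k z _ => hder k z) hbd hz
    (h.summable hΛ z.1 z.2) hz
  refine main.congr_fderiv ?_
  have s1 : Summable fun k : ℕ × ℕ => a k.1 k.2 *
      ((k.1 * z.1 ^ (k.1 - 1) / k.1.factorial) * (z.2 ^ k.2 / k.2.factorial)) := by
    refine Summable.of_norm_bounded hu fun k => ?_
    have := parts k _ _ (abs_deriv_pow_div_factorial_le hR ((norm_fst_le z).trans
      (mem_ball_zero_iff.1 hz).le) k.1) (pw k.2 z.2 ((norm_snd_le z).trans (mem_ball_zero_iff.1 hz).le))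
    simp only [u, Real.norm_eq_abs]
    linarith [abs_nonneg (a k.1 k.2 *
      ((k.1 * z.1 ^ (k.1 - 1) / k.1.factorial) * (z.2 ^ k.2 / k.2.factorial)))]
  have s2 : Summable fun k : ℕ × ℕ => a k.1 k.2 *
      ((z.1 ^ k.1 / k.1.factorial) * (k.2 * z.2 ^ (k.2 - 1) / k.2.factorial)) := by
    refine Summable.of_norm_bounded hu fun k => ?_
    have := parts k _ _ (pw k.1 z.1 ((norm_fst_le z).trans (mem_ball_zero_iff.1 hz).le))
      (abs_deriv_pow_div_factorial_le hR ((norm_snd_le z).trans (mem_ball_zero_iff.1 hz).le) k.2)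
    simp only [u, Real.norm_eq_abs]
    linarith [abs_nonneg (a k.1 k.2 *
      ((z.1 ^ k.1 / k.1.factorial) * (k.2 * z.2 ^ (k.2 - 1) / k.2.factorial)))]
  simp only [f']
  rw [(s1.smul_const _).tsum_add (s2.smul_const _), s1.tsum_smul_const, s2.tsum_smul_const,
    tsum_shift_left, tsum_shift_right]

theorem GeomBound.contDiff_dser_nat (hΛ : 0 ≤ Λ) (n : ℕ) : ∀ {a : ℕ → ℕ → ℝ} {C : ℝ},
    GeomBound a C Λ → ContDiff ℝ n fun z : ℝ × ℝ => dser a z.1 z.2 := by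
  induction n with
  | zero =>
    intro a C h
    rw [Nat.cast_zero, contDiff_zero]
    exact continuous_iff_continuousAt.2 fun z => (h.hasFDerivAt_dser hΛ z).continuousAt
  | succ n ih =>
    intro a C h
    rw [Nat.cast_succ, contDiff_succ_iff_hasFDerivAt]
    exact ⟨_, ((ih h.shift_left).smul contDiff_const).add ((ih h.shift_right).smul contDiff_const),
      h.hasFDerivAt_dser hΛ⟩

theorem GeomBound.contDiff_dser (h : GeomBound a C Λ) (hΛ : 0 ≤ Λ) :
    ContDiff ℝ ((⊤ : ℕ∞) : WithTop ℕ∞) fun z : ℝ × ℝ => dser a z.1 z.2 :=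
  contDiff_infty.2 fun n => GeomBound.contDiff_dser_nat hΛ n h

theorem GeomBound.hasDerivAt_right (h : GeomBound a C Λ) (hΛ : 0 ≤ Λ) (s y : ℝ) :
    HasDerivAt (fun y => dser a s y) (dser (fun j k => a j (k + 1)) s y) y := by
  have h1 := (h.hasFDerivAt_dser hΛ (s, y)).comp_hasDerivAt y
    ((hasDerivAt_const y s).prodMk (hasDerivAt_id y))
  refine h1.congr_deriv ?_
  simp

theorem GeomBound.hasDerivAt_left (h : GeomBound a C Λ) (hΛ : 0 ≤ Λ) (s y : ℝ) :
    HasDerivAt (fun s => dser a s y) (dser (fun j k => a (j + 1) k) s y) s := by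
  have h1 := (h.hasFDerivAt_dser hΛ (s, y)).comp_hasDerivAt s
    ((hasDerivAt_id s).prodMk (hasDerivAt_const s y))
  refine h1.congr_deriv ?_
  simp

theorem GeomBound.mixedDeriv_dser (h : GeomBound a C Λ) (hΛ : 0 ≤ Λ) (s y : ℝ) :
    mixedDeriv (dser a) s y = dser (fun j k => a (j + 1) (k + 1)) s y := by
  have e : (fun t => deriv (fun x => dser a t x) y) = fun t => dser (fun j k => a j (k + 1)) t y :=
    funext fun t => (h.hasDerivAt_right hΛ t y).deriv
  rw [mixedDeriv, e]
  exact (h.shift_right.hasDerivAt_left hΛ s y).deriv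

/-- Extension of a double sequence by zeros in the first row and column. -/
def padSeq (a : ℕ → ℕ → ℝ) : ℕ → ℕ → ℝ
  | j + 1, k + 1 => a j k
  | _, _ => 0

theorem GeomBound.pad (h : GeomBound a C Λ) (hΛ : 1 ≤ Λ) : GeomBound (padSeq a) C Λ := by
  have hC := h.nonneg
  intro j k
  rcases j with _ | j
  · simp [padSeq]; positivity
  · rcases k with _ | k
    · simp [padSeq]; positivity
    · refine (h j k).trans ?_
      gcongr
      · omega
      · omega

/-- The series of the sheet starts at exponents `(1,1)`. Padding writes it as a `dser` whose mixed
derivative has the unshifted coefficients. -/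
theorem hasSum_padSeq_iff (a : ℕ → ℕ → ℝ) (s y v : ℝ) :
    HasSum (fun k : ℕ × ℕ => padSeq a k.1 k.2 *
      (s ^ k.1 / k.1.factorial * (y ^ k.2 / k.2.factorial))) v ↔
    HasSum (fun k : ℕ × ℕ => a k.1 k.2 *
      (s ^ (k.1 + 1) / (k.1 + 1).factorial * (y ^ (k.2 + 1) / (k.2 + 1).factorial))) v := by
  have inj : Function.Injective fun k : ℕ × ℕ => (k.1 + 1, k.2 + 1) := by
    rintro ⟨a, b⟩ ⟨c, d⟩ h; simp at h; simp [h]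
  rw [← inj.hasSum_iff]
  · rfl
  · rintro ⟨_ | j, _ | k⟩ hk
    · simp [padSeq]
    · simp [padSeq]
    · simp [padSeq]
    · exact absurd ⟨(j, k), rfl⟩ hk

end DoubleSeries

/-! ### Gaussian moments -/

section GaussMoments

variable {x τ : ℝ}

/-- The Gaussian law with mean `x` and variance `2τ`, whose density is the heat kernel. -/
def heatLaw (τ x : ℝ) : Measure ℝ := gaussianReal x (2 * τ).toNNReal

instance (τ x : ℝ) : IsProbabilityMeasure (heatLaw τ x) := by
  unfold heatLaw; infer_instance

theorem heatKernel_eq_pdf (hτ : 0 < τ) (x y : ℝ) :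
    heatKernel τ (x - y) = gaussianPDFReal x (2 * τ).toNNReal y := by
  rw [heatKernel, if_pos hτ, gaussianPDFReal, Real.coe_toNNReal _ (by positivity), one_div]
  congr 2
  · congr 1; ring
  · congr 1
    rw [show (x - y) ^ 2 = (y - x) ^ 2 by ring]
    ring

theorem toNNReal_ne_zero (hτ : 0 < τ) : (2 * τ).toNNReal ≠ 0 := by
  rw [Ne, Real.toNNReal_eq_zero, not_le]; positivity

theorem integral_heatLaw (hτ : 0 < τ) (x : ℝ) (f : ℝ → ℝ) :
    ∫ y, f y ∂heatLaw τ x = ∫ y, heatKernel τ (x - y) * f y := by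
  rw [heatLaw, integral_gaussianReal_eq_integral_smul (toNNReal_ne_zero hτ)]
  exact integral_congr_ae (ae_of_all _ fun y => by
    simp only [heatKernel_eq_pdf hτ, smul_eq_mul])

theorem integrable_heatLaw_iff (hτ : 0 < τ) (x : ℝ) (f : ℝ → ℝ) :
    Integrable f (heatLaw τ x) ↔ Integrable fun y => heatKernel τ (x - y) * f y := by
  rw [heatLaw, gaussianReal_of_var_ne_zero _ (toNNReal_ne_zero hτ),
    integrable_withDensity_iff_integrable_smul' (measurable_gaussianPDF _ _)
      (ae_of_all _ fun _ => gaussianPDF_lt_top)]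
  refine integrable_congr (ae_of_all _ fun y => ?_)
  simp only [heatKernel_eq_pdf hτ, toReal_gaussianPDF, smul_eq_mul]

theorem integrable_pow_heatLaw (τ x : ℝ) (k : ℕ) : Integrable (fun y => y ^ k) (heatLaw τ x) := by
  have h := memLp_id_gaussianReal (μ := x) (v := (2 * τ).toNNReal) k
  have := h.integrable_norm_pow'
  refine (integrable_norm_iff (by fun_prop)).1 ?_
  simpa [heatLaw] using this

theorem integrable_exp_heatLaw (τ x c : ℝ) : Integrable (fun y => Real.exp (c * y)) (heatLaw τ x) :=
  integrable_exp_mul_gaussianReal c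

theorem integral_exp_heatLaw (hτ : 0 ≤ τ) (x c : ℝ) :
    ∫ y, Real.exp (c * y) ∂heatLaw τ x = Real.exp (x * c + τ * c ^ 2) := by
  have h := congrFun (mgf_id_gaussianReal (μ := x) (v := (2 * τ).toNNReal)) c
  simp only [mgf, id] at h
  rw [heatLaw, h, Real.coe_toNNReal _ (by positivity)]
  congr 1; ring

theorem hasDerivAt_heatKernel (hτ : 0 < τ) (x y : ℝ) :
    HasDerivAt (fun y => heatKernel τ (x - y)) (heatKernel τ (x - y) * ((x - y) / (2 * τ))) y := by
  simp only [heatKernel, if_pos hτ]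
  have h1 : HasDerivAt (fun y : ℝ => -((x - y) ^ 2) / (4 * τ)) ((x - y) / (2 * τ)) y := by
    have h := ((((hasDerivAt_id y).const_sub x).pow 2).neg).div_const (4 * τ)
    refine h.congr_deriv ?_
    simp only [id, Nat.cast_ofNat]
    field_simp
    ring
  refine (h1.exp.const_mul (1 / √(4 * Real.pi * τ))).congr_deriv ?_
  ring

/-- The `k`-th moment of the heat law, divided by `k!`. -/
def heatMoment (τ x : ℝ) (k : ℕ) : ℝ := ∫ y, y ^ k / k.factorial ∂heatLaw τ x

theorem heatMoment_zero (τ x : ℝ) : heatMoment τ x 0 = 1 := by simp [heatMoment]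

theorem heatMoment_one (τ x : ℝ) : heatMoment τ x 1 = x := by
  simp [heatMoment, heatLaw, integral_id_gaussianReal]

/-- Gaussian integration by parts: the derivative of `y^(k+1)` times the heat kernel integrates to
zero. -/
theorem heatMoment_add_two (hτ : 0 < τ) (x : ℝ) (k : ℕ) :
    (k + 2 : ℝ) * heatMoment τ x (k + 2) = x * heatMoment τ x (k + 1) + 2 * τ * heatMoment τ x k := by
  have hd : ∀ y, HasDerivAt (fun y => heatKernel τ (x - y) * y ^ (k + 1))
      ((1 / (2 * τ)) * (x * (heatKernel τ (x - y) * y ^ (k + 1)) -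
        heatKernel τ (x - y) * y ^ (k + 2)) + (k + 1) * (heatKernel τ (x - y) * y ^ k)) y := by
    intro y
    refine ((hasDerivAt_heatKernel hτ x y).mul (hasDerivAt_pow (k + 1) y)).congr_deriv ?_
    simp only [Nat.add_sub_cancel]
    push_cast
    field_simp
    ring
  have hi : ∀ k, Integrable fun y => heatKernel τ (x - y) * y ^ k := fun k =>
    (integrable_heatLaw_iff hτ x _).1 (integrable_pow_heatLaw τ x k)
  have h0 := integral_eq_zero_of_hasDerivAt_of_integrable hd
    (((((hi (k + 1)).const_mul x).sub (hi (k + 2))).const_mul _).add ((hi k).const_mul _)) (hi (k + 1))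
  have hi' : Integrable fun y => x * (heatKernel τ (x - y) * y ^ (k + 1)) -
      heatKernel τ (x - y) * y ^ (k + 2) := ((hi (k + 1)).const_mul x).sub (hi (k + 2))
  rw [integral_add (hi'.const_mul _) ((hi k).const_mul _),
    integral_const_mul, integral_const_mul, integral_sub ((hi (k + 1)).const_mul x) (hi (k + 2)),
    integral_const_mul, ← integral_heatLaw hτ, ← integral_heatLaw hτ, ← integral_heatLaw hτ] at h0
  simp only [heatMoment, integral_div, Nat.factorial_succ]
  push_cast
  have h1 : (k : ℝ) + 1 ≠ 0 := by positivity
  have h2 : (k : ℝ) + 1 + 1 ≠ 0 := by positivity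
  field_simp at h0 ⊢
  rw [show ∫ y, y ^ (k + 2) ∂heatLaw τ x = x * ∫ y, y ^ (k + 1) ∂heatLaw τ x +
    2 * τ * (k + 1) * ∫ y, y ^ k ∂heatLaw τ x by linarith]
  ring

/-- The even exponential coefficients `τ^i/i!` at `m = 2i`, and `0` at odd `m`. -/
def evenCoef (τ : ℝ) (m : ℕ) : ℝ := if Even m then τ ^ (m / 2) / (m / 2).factorial else 0

theorem evenCoef_two_mul (τ : ℝ) (i : ℕ) : evenCoef τ (2 * i) = τ ^ i / i.factorial := by
  simp [evenCoef]

theorem evenCoef_add_two (τ : ℝ) (k : ℕ) : (k + 2 : ℝ) * evenCoef τ (k + 2) = 2 * τ * evenCoef τ k := by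
  rcases Nat.even_or_odd' k with ⟨i, rfl | rfl⟩
  · rw [show 2 * i + 2 = 2 * (i + 1) by ring, evenCoef_two_mul, evenCoef_two_mul, Nat.factorial_succ]
    push_cast
    field_simp
    ring
  · have h1 : ¬ Even (2 * i + 1) := by simp
    have h2 : ¬ Even (2 * i + 1 + 2) := by simp [parity_simps]
    simp [evenCoef, h1, h2]

/-- The generating series of the moments should be `F = e^{τX²} e^{xX}`, which satisfies `F' = (2τX
+ x) F`. Comparing coefficients gives the recurrence of `heatMoment_add_two`, and the first two
values agree. -/
theorem heatMoment_eq_sum (hτ : 0 < τ) (x : ℝ) (k : ℕ) : heatMoment τ x k =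
    ∑ q ∈ Finset.HasAntidiagonal.antidiagonal k, evenCoef τ q.1 * (x ^ q.2 / q.2.factorial) := by
  let U : PowerSeries ℝ := PowerSeries.mk (evenCoef τ)
  let V : PowerSeries ℝ := PowerSeries.mk fun l => x ^ l / l.factorial
  have hU : PowerSeries.derivative ℝ U = PowerSeries.C (2 * τ) * (PowerSeries.X * U) := by
    ext n
    rw [PowerSeries.coeff_derivative, PowerSeries.coeff_C_mul]
    rcases n with _ | n
    · rw [PowerSeries.coeff_zero_X_mul]
      simp [U, evenCoef]
    · rw [PowerSeries.coeff_succ_X_mul]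
      simp only [U, PowerSeries.coeff_mk]
      push_cast
      linarith [evenCoef_add_two τ n]
  have hV : PowerSeries.derivative ℝ V = PowerSeries.C x * V := by
    ext n
    rw [PowerSeries.coeff_derivative, PowerSeries.coeff_C_mul]
    simp only [V, PowerSeries.coeff_mk, Nat.factorial_succ]
    push_cast
    have h1 : (n : ℝ) + 1 ≠ 0 := by positivity
    field_simp
    ring
  have hF : PowerSeries.derivative ℝ (U * V) =
      PowerSeries.C (2 * τ) * (PowerSeries.X * (U * V)) + PowerSeries.C x * (U * V) := by
    rw [Derivation.leibniz, hU, hV, smul_eq_mul, smul_eq_mul]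
    ring
  have hrec : ∀ n : ℕ, (n + 2 : ℝ) * PowerSeries.coeff (n + 2) (U * V) =
      2 * τ * PowerSeries.coeff n (U * V) + x * PowerSeries.coeff (n + 1) (U * V) := by
    intro n
    have h := congrArg (PowerSeries.coeff (n + 1)) hF
    rw [PowerSeries.coeff_derivative, map_add, PowerSeries.coeff_C_mul, PowerSeries.coeff_C_mul,
      PowerSeries.coeff_succ_X_mul] at h
    push_cast at h
    linarith
  have key : ∀ k, heatMoment τ x k = PowerSeries.coeff k (U * V) := by
    intro k
    induction k using Nat.twoStepInduction with
    | zero =>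
      rw [heatMoment_zero, PowerSeries.coeff_mul]
      simp [U, V, evenCoef]
    | one =>
      rw [heatMoment_one, PowerSeries.coeff_mul, Finset.Nat.sum_antidiagonal_eq_sum_range_succ_mk]
      simp [U, V, evenCoef, Finset.sum_range_succ]
    | more n h0 h1 =>
      have hn : (n + 2 : ℝ) ≠ 0 := by positivity
      have := heatMoment_add_two hτ x n
      rw [h0, h1] at this
      have := hrec n
      apply mul_left_cancel₀ hn
      linarith
  rw [key, PowerSeries.coeff_mul]
  simp [U, V]

theorem summable_evenCoef (τ Λ : ℝ) : Summable fun m => evenCoef |τ| m * Λ ^ m := by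
  have inj : Function.Injective fun i : ℕ => 2 * i := fun a b h => by simpa using h
  rw [← inj.summable_iff]
  · refine (Real.summable_pow_div_factorial (|τ| * Λ ^ 2)).congr fun i => ?_
    simp only [Function.comp, evenCoef_two_mul]
    rw [mul_pow, ← pow_mul]; ring
  · intro m hm
    have : ¬ Even m := fun ⟨i, hi⟩ => hm ⟨i, by simp only; omega⟩
    simp [evenCoef, this]

theorem exp_mul_abs_le (c y : ℝ) : Real.exp (c * |y|) ≤ Real.exp (c * y) + Real.exp (-c * y) := by
  rcases abs_cases y with ⟨h, _⟩ | ⟨h, _⟩ <;> rw [h]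
  · linarith [Real.exp_pos (-c * y)]
  · rw [mul_neg, ← neg_mul]; linarith [Real.exp_pos (c * y)]

theorem integrable_exp_abs_heatLaw (τ x c : ℝ) :
    Integrable (fun y => Real.exp (c * |y|)) (heatLaw τ x) := by
  refine ((integrable_exp_heatLaw τ x c).add (integrable_exp_heatLaw τ x (-c))).mono'
    (by fun_prop) (ae_of_all _ fun y => ?_)
  rw [Real.norm_of_nonneg (Real.exp_pos _).le]
  exact exp_mul_abs_le c y

/-- Dominated convergence integrates the power series term by term. Absolute summability then allows
the polynomial moments to be opened up and regrouped by `(i, l)`, only the even indices `2i`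
surviving. -/
theorem hasSum_integral_heatLaw (hτ : 0 < τ) (x : ℝ) {c : ℕ → ℝ} {C Λ : ℝ} (hΛ : 0 ≤ Λ)
    (hc : ∀ k, |c k| ≤ C * Λ ^ k) :
    HasSum (fun q : ℕ × ℕ => c (q.2 + 2 * q.1) * (τ ^ q.1 / q.1.factorial * (x ^ q.2 / q.2.factorial)))
      (∫ y, ∑' k, c k * (y ^ k / k.factorial) ∂heatLaw τ x) := by
  have hC : 0 ≤ C := by simpa using (abs_nonneg _).trans (hc 0)
  have hb : ∀ (k : ℕ) (y : ℝ), ‖c k * (y ^ k / k.factorial)‖ ≤ C * ((Λ * |y|) ^ k / k.factorial) := by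
    intro k y
    rw [norm_mul, norm_div, norm_pow]
    simp only [Real.norm_eq_abs, Nat.abs_cast]
    calc _ ≤ (C * Λ ^ k) * (|y| ^ k / k.factorial) := by
          gcongr
          exact hc k
      _ = _ := by rw [mul_pow]; ring
  have hexp : ∀ y : ℝ, ∑' k : ℕ, C * ((Λ * |y|) ^ k / (k.factorial : ℝ)) = C * Real.exp (Λ * |y|) := by
    intro y
    rw [tsum_mul_left, Real.exp_eq_exp_ℝ, NormedSpace.exp_eq_tsum_div]
  have h1 : HasSum (fun k => c k * heatMoment τ x k)
      (∫ y, ∑' k, c k * (y ^ k / k.factorial) ∂heatLaw τ x) := by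
    have := hasSum_integral_of_dominated_convergence (μ := heatLaw τ x)
      (F := fun (k : ℕ) y => c k * (y ^ k / k.factorial))
      (f := fun y => ∑' k, c k * (y ^ k / k.factorial))
      (fun k y => C * ((Λ * |y|) ^ k / k.factorial)) (fun k => by fun_prop)
      (fun k => ae_of_all _ (hb k))
      (ae_of_all _ fun y => (Real.summable_pow_div_factorial _).mul_left C) ?_ ?_
    · simp only [integral_const_mul] at this
      exact this
    · simp_rw [hexp]
      exact (integrable_exp_abs_heatLaw τ x Λ).const_mul C
    · exact ae_of_all _ fun y => (Summable.of_norm_bounded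
        ((Real.summable_pow_div_factorial (Λ * |y|)).mul_left C) (fun k => hb k y)).hasSum
  have hs : Summable fun q : ℕ × ℕ => c (q.1 + q.2) * (evenCoef τ q.1 * (x ^ q.2 / q.2.factorial)) := by
    have e0 : ∀ m, 0 ≤ evenCoef |τ| m := fun m => by unfold evenCoef; split_ifs <;> positivity
    refine Summable.of_norm_bounded (((summable_evenCoef τ Λ).mul_of_nonneg
      (Real.summable_pow_div_factorial (Λ * |x|)) (fun m => by have := e0 m; positivity)
      (fun m => by positivity)).mul_left C) fun q => ?_
    rw [abs_of_pos hτ, norm_mul, norm_mul, norm_div, norm_pow]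
    simp only [Real.norm_eq_abs, Nat.abs_cast]
    have e1 := e0 q.1
    rw [abs_of_pos hτ] at e1
    rw [abs_of_nonneg e1]
    calc _ ≤ (C * Λ ^ (q.1 + q.2)) * (evenCoef τ q.1 * (|x| ^ q.2 / q.2.factorial)) := by
          gcongr
          exact hc _
      _ = _ := by rw [pow_add, mul_pow]; ring
  have h2 : HasSum (fun k => c k * heatMoment τ x k)
      (∑' q : ℕ × ℕ, c (q.1 + q.2) * (evenCoef τ q.1 * (x ^ q.2 / q.2.factorial))) := by
    have h3 := (Finset.HasAntidiagonal.sigmaAntidiagonalEquivProd (A := ℕ)).hasSum_iff.2 hs.hasSum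
    have h4 := h3.sigma (fun k => hasSum_fintype _)
    convert h4 using 2 with k
    rw [heatMoment_eq_sum hτ, Finset.mul_sum, ← Finset.sum_coe_sort]
    refine Finset.sum_congr rfl fun q _ => ?_
    have : q.1.1 + q.1.2 = k := Finset.HasAntidiagonal.mem_antidiagonal.1 q.2
    simp only [Function.comp, Finset.HasAntidiagonal.sigmaAntidiagonalEquivProd_apply, this]
  have h5 := hs.hasSum
  rw [h2.unique h1] at h5
  have inj : Function.Injective fun q : ℕ × ℕ => (2 * q.1, q.2) := by
    rintro ⟨a, b⟩ ⟨c, d⟩ h; simp at h; simp [h]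
  rw [← inj.hasSum_iff] at h5
  · convert h5 using 2 with q
    simp only [Function.comp, evenCoef_two_mul]
    rw [add_comm]
  · rintro ⟨m, l⟩ hm
    have : ¬ Even m := fun ⟨i, hi⟩ => hm ⟨(i, l), by simp only [Prod.mk.injEq, and_true]; omega⟩
    simp [evenCoef, this]

end GaussMoments

/-! ### The heat convolution of a double series -/

section HeatSeries

theorem hasSum_of_eq {ι E : Type*} [AddCommMonoid E] [TopologicalSpace E] {f g : ι → E} {v : E}
    (h : HasSum f v) (e : ∀ i, g i = f i) : HasSum g v := by
  rwa [funext e]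

variable {a : ℕ → ℕ → ℝ} {C Λ : ℝ}

theorem GeomBound.summable_left (h : GeomBound a C Λ) (hΛ : 0 ≤ Λ) (s : ℝ) (k : ℕ) :
    Summable fun j : ℕ => a j k * (s ^ j / j.factorial) := by
  have := (h.summable hΛ s 1).comp_injective (i := fun j : ℕ => (j, k))
    (fun a b h => by simpa using h)
  refine ((this.mul_right (k.factorial : ℝ))).congr fun j => ?_
  simp only [Function.comp, one_pow]
  field_simp

theorem GeomBound.abs_tsum_left_le (h : GeomBound a C Λ) (_hΛ : 0 ≤ Λ) (s : ℝ) (k : ℕ) :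
    |∑' j : ℕ, a j k * (s ^ j / j.factorial)| ≤ C * Real.exp (Λ * |s|) * Λ ^ k := by
  have hs := ((Real.summable_pow_div_factorial (Λ * |s|)).hasSum.mul_left (C * Λ ^ k))
  have he : ∑' n : ℕ, (Λ * |s|) ^ n / (n.factorial : ℝ) = Real.exp (Λ * |s|) := by
    rw [Real.exp_eq_exp_ℝ, NormedSpace.exp_eq_tsum_div]
  rw [he] at hs
  rw [show C * Real.exp (Λ * |s|) * Λ ^ k = C * Λ ^ k * Real.exp (Λ * |s|) by ring]
  rw [← Real.norm_eq_abs]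
  refine tsum_of_norm_bounded hs fun j => ?_
  rw [norm_mul, norm_div, norm_pow]
  simp only [Real.norm_eq_abs, Nat.abs_cast]
  have hC := h.nonneg
  calc _ ≤ (C * Λ ^ (j + k)) * (|s| ^ j / j.factorial) := by
        gcongr
        exact h j k
    _ = _ := by rw [pow_add, mul_pow]; ring

theorem GeomBound.dser_eq_tsum (h : GeomBound a C Λ) (hΛ : 0 ≤ Λ) (s y : ℝ) :
    dser a s y = ∑' k : ℕ, (∑' j : ℕ, a j k * (s ^ j / j.factorial)) * (y ^ k / k.factorial) := by
  rw [dser, ← (Equiv.prodComm ℕ ℕ).tsum_eq]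
  refine ((Equiv.prodComm ℕ ℕ).summable_iff.2 (h.summable hΛ s y)).tsum_prod.trans ?_
  refine tsum_congr fun k => ?_
  rw [← tsum_mul_right]
  refine tsum_congr fun j => ?_
  simp only [Function.comp, Equiv.prodComm_apply, Prod.swap_prod_mk]
  ring

/-- The general term of the series of the heat convolution, before integration in time. -/
def heatTerm (a : ℕ → ℕ → ℝ) (s τ x : ℝ) (k : ℕ × ℕ × ℕ) : ℝ :=
  a k.1 (k.2.2 + 2 * k.2.1) *
    (s ^ k.1 / k.1.factorial * (τ ^ k.2.1 / k.2.1.factorial * (x ^ k.2.2 / k.2.2.factorial)))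

theorem summable_triple (C p q r : ℝ) (hp : 0 ≤ p) (hq : 0 ≤ q) (hr : 0 ≤ r) :
    Summable fun k : ℕ × ℕ × ℕ => C * (p ^ k.1 / (k.1.factorial : ℝ) *
      (q ^ k.2.1 / (k.2.1.factorial : ℝ) * (r ^ k.2.2 / (k.2.2.factorial : ℝ)))) :=
  ((Real.summable_pow_div_factorial p).mul_of_nonneg
    ((Real.summable_pow_div_factorial q).mul_of_nonneg (Real.summable_pow_div_factorial r)
      (fun _ => by positivity) (fun _ => by positivity))
    (fun _ => by positivity) (fun _ => by positivity)).mul_left C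

theorem GeomBound.norm_heatTerm_le (h : GeomBound a C Λ) (hΛ : 0 ≤ Λ) {s τ x r : ℝ} (hs : |s| ≤ 1)
    (hτ : |τ| ≤ 1) (hx : |x| ≤ r) (k : ℕ × ℕ × ℕ) : ‖heatTerm a s τ x k‖ ≤
      C * (Λ ^ k.1 / k.1.factorial * ((Λ ^ 2) ^ k.2.1 / k.2.1.factorial *
        ((Λ * r) ^ k.2.2 / k.2.2.factorial))) := by
  have hC := h.nonneg
  rw [heatTerm, norm_mul, norm_mul, norm_mul, norm_div, norm_div, norm_div, norm_pow, norm_pow,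
    norm_pow]
  simp only [Real.norm_eq_abs, Nat.abs_cast]
  calc _ ≤ (C * Λ ^ (k.1 + (k.2.2 + 2 * k.2.1))) * (1 ^ k.1 / k.1.factorial *
        (1 ^ k.2.1 / k.2.1.factorial * (r ^ k.2.2 / k.2.2.factorial))) := by
        gcongr
        exact h _ _
    _ = _ := by rw [pow_add, pow_add, mul_pow, pow_mul]; simp only [one_pow]; ring

theorem GeomBound.summable_heatTerm (h : GeomBound a C Λ) (hΛ : 0 ≤ Λ) {s τ : ℝ} (hs : |s| ≤ 1)
    (hτ : |τ| ≤ 1) (x : ℝ) : Summable (heatTerm a s τ x) :=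
  Summable.of_norm_bounded (summable_triple C Λ (Λ ^ 2) (Λ * |x|) hΛ (by positivity) (by positivity))
    fun k => h.norm_heatTerm_le hΛ hs hτ le_rfl k

theorem GeomBound.hasSum_integral_dser (h : GeomBound a C Λ) (hΛ : 0 ≤ Λ) {s τ : ℝ} (hs : |s| ≤ 1)
    (hτ : 0 < τ) (hτ1 : τ ≤ 1) (x : ℝ) :
    HasSum (heatTerm a s τ x) (∫ y, dser a s y ∂heatLaw τ x) := by
  have hsum := h.summable_heatTerm hΛ hs (by rwa [abs_of_pos hτ]) x
  have e : (fun y => dser a s y) = fun y => ∑' k : ℕ, (∑' j : ℕ, a j k * (s ^ j / j.factorial)) *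
    (y ^ k / k.factorial) := funext fun y => h.dser_eq_tsum hΛ s y
  have h1 := hasSum_integral_heatLaw hτ x hΛ (h.abs_tsum_left_le hΛ s)
  rw [e]
  have h2 : HasSum (fun q : ℕ × ℕ × ℕ => heatTerm a s τ x q) (∑' q, heatTerm a s τ x q) := hsum.hasSum
  have h3 := ((Equiv.prodComm (ℕ × ℕ) ℕ).hasSum_iff.2 h2).prod_fiberwise
    (g := fun q : ℕ × ℕ => (∑' j : ℕ, a j (q.2 + 2 * q.1) * (s ^ j / j.factorial)) *
      (τ ^ q.1 / q.1.factorial * (x ^ q.2 / q.2.factorial))) (fun q => by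
        refine hasSum_of_eq ((h.summable_left hΛ s (q.2 + 2 * q.1)).hasSum.mul_right _) fun j => ?_
        simp only [Function.comp, Equiv.prodComm_apply, Prod.swap_prod_mk, heatTerm]
        ring)
  rw [← h3.unique h1]
  exact h2

theorem measurable_heatKernel : Measurable fun z : ℝ × ℝ => heatKernel z.1 z.2 := by
  unfold heatKernel
  refine Measurable.ite (measurableSet_lt measurable_const measurable_fst) ?_ measurable_const
  fun_prop

/-- A second dominated convergence, now in time, with a bound uniform in `s` because `t ≤ 1`; the
coefficients `simplexCoef` appear as the remaining integrals. -/
theorem GeomBound.hasSum_heatSol (h : GeomBound a C Λ) (hΛ : 0 ≤ Λ) {b : ℝ → ℝ → ℝ}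
    (hb : ∀ s y, mixedDeriv b s y = dser a s y) {t : ℝ} (ht : t ∈ Icc (0 : ℝ) 1) (x : ℝ) :
    HasSum (fun k : ℕ × ℕ × ℕ => a k.1 (k.2.2 + 2 * k.2.1) *
      (simplexCoef k.1 k.2.1 t * (x ^ k.2.2 / k.2.2.factorial))) (heatSol b t x) := by
  have key := intervalIntegral.hasSum_integral_of_dominated_convergence (μ := volume) (a := 0) (b := t)
    (F := fun (k : ℕ × ℕ × ℕ) s => heatTerm a s (t - s) x k)
    (f := fun s => ∫ y, heatKernel (t - s) (x - y) * mixedDeriv b s y)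
    (fun k _ => C * (Λ ^ k.1 / k.1.factorial * ((Λ ^ 2) ^ k.2.1 / k.2.1.factorial *
        ((Λ * |x|) ^ k.2.2 / k.2.2.factorial)))) ?_ ?_ ?_ ?_ ?_
  · refine hasSum_of_eq key fun k => ?_
    simp only [heatTerm]
    rw [intervalIntegral.integral_const_mul, simplexCoef, ← intervalIntegral.integral_mul_const]
    congr 1
    refine intervalIntegral.integral_congr fun s _ => ?_
    ring
  · intro k
    unfold heatTerm
    fun_prop
  · intro k
    refine ae_of_all _ fun s hs => ?_
    rw [uIoc_of_le ht.1] at hs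
    exact h.norm_heatTerm_le hΛ (by rw [abs_of_pos hs.1]; linarith [hs.2, ht.2])
      (by rw [abs_of_nonneg (by linarith [hs.2])]; linarith [hs.1, ht.2]) le_rfl k
  · exact ae_of_all _ fun s _ =>
      summable_triple C Λ (Λ ^ 2) (Λ * |x|) hΛ (by positivity) (by positivity)
  · exact intervalIntegrable_const
  -- At `s = t` the kernel is zero by convention while the series need not vanish; this null set is
  -- discarded.
  · filter_upwards [compl_mem_ae_iff.2 (measure_singleton (μ := (volume : Measure ℝ)) t)] with s hne hs
    rw [uIoc_of_le ht.1] at hs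
    have hst : 0 < t - s := sub_pos.2 (lt_of_le_of_ne hs.2 hne)
    simp_rw [hb]
    rw [← integral_heatLaw hst]
    exact h.hasSum_integral_dser hΛ (by rw [abs_of_pos hs.1]; linarith [hs.2, ht.2]) hst
      (by linarith [hs.1, ht.2]) x

theorem GeomBound.continuous_heatSol (h : GeomBound a C Λ) (hΛ : 0 ≤ Λ) {b : ℝ → ℝ → ℝ}
    (hb : ∀ s y, mixedDeriv b s y = dser a s y) {t : ℝ} (ht : t ∈ Icc (0 : ℝ) 1) :
    Continuous fun x => heatSol b t x := by
  have e : (fun x => heatSol b t x) = fun x => ∑' k : ℕ × ℕ × ℕ, a k.1 (k.2.2 + 2 * k.2.1) *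
      (simplexCoef k.1 k.2.1 t * (x ^ k.2.2 / k.2.2.factorial)) :=
    funext fun x => (h.hasSum_heatSol hΛ hb ht x).tsum_eq.symm
  have hC := h.nonneg
  rw [e]
  refine continuous_iff_continuousAt.2 fun x₀ => ?_
  have : ContinuousOn (fun x => ∑' k : ℕ × ℕ × ℕ, a k.1 (k.2.2 + 2 * k.2.1) *
      (simplexCoef k.1 k.2.1 t * (x ^ k.2.2 / k.2.2.factorial))) (Metric.ball 0 (|x₀| + 1)) := by
    refine continuousOn_tsum (fun k => by fun_prop)
      (summable_triple C Λ (Λ ^ 2) (Λ * (|x₀| + 1)) hΛ (by positivity) (by positivity)) fun k x hx => ?_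
    rw [mem_ball_zero_iff, Real.norm_eq_abs] at hx
    rw [norm_mul, norm_mul, norm_div, norm_pow]
    simp only [Real.norm_eq_abs, Nat.abs_cast]
    calc _ ≤ (C * Λ ^ (k.1 + (k.2.2 + 2 * k.2.1))) * (1 / (k.1.factorial * k.2.1.factorial) *
          ((|x₀| + 1) ^ k.2.2 / k.2.2.factorial)) := by
          gcongr
          · exact h _ _
          · exact abs_simplexCoef_le _ _ ht
      _ = _ := by rw [pow_add, pow_add, mul_pow, pow_mul]; field_simp
  exact this.continuousAt (Metric.isOpen_ball.mem_nhds (by simp))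

/-- The density grows at most like `e^{Λ|y|}`, and exponential moments of the heat law are bounded
uniformly for times at most 1. -/
theorem GeomBound.integrableOn_heat (h : GeomBound a C Λ) (hΛ : 0 ≤ Λ) {b : ℝ → ℝ → ℝ}
    (hb : ∀ s y, mixedDeriv b s y = dser a s y) {t : ℝ} (ht : t ∈ Icc (0 : ℝ) 1) (x : ℝ) :
    IntegrableOn (fun z : ℝ × ℝ => heatKernel (t - z.1) (x - z.2) * mixedDeriv b z.1 z.2)
      (Ioc 0 t ×ˢ univ) := by
  have hC := h.nonneg
  have hmeas : Measurable fun z : ℝ × ℝ => heatKernel (t - z.1) (x - z.2) * dser a z.1 z.2 :=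
    (measurable_heatKernel.comp (by fun_prop : Measurable fun z : ℝ × ℝ => (t - z.1, x - z.2))).mul
      (h.contDiff_dser hΛ).continuous.measurable
  simp_rw [hb]
  rw [IntegrableOn, Measure.volume_eq_prod, ← Measure.prod_restrict, Measure.restrict_univ]
  have hgood : ∀ᵐ s ∂(volume : Measure ℝ).restrict (Ioc 0 t), s ∈ Ioc 0 t ∧ s ≠ t := by
    filter_upwards [ae_restrict_mem measurableSet_Ioc, ae_restrict_of_ae
      (compl_mem_ae_iff.2 (measure_singleton (μ := (volume : Measure ℝ)) t))] with s h1 h2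
    exact ⟨h1, h2⟩
  have hbound : ∀ s ∈ Ioc 0 t, ∀ y, |dser a s y| ≤ C * Real.exp Λ * Real.exp (Λ * |y|) := by
    intro s hs y
    refine (h.abs_dser_le hΛ s y).trans ?_
    rw [mul_assoc]
    have : Λ * |s| ≤ Λ * 1 := by
      gcongr
      rw [abs_of_pos hs.1]; linarith [hs.2, ht.2]
    gcongr
    linarith
  have hint : ∀ s ∈ Ioc 0 t, s ≠ t → Integrable (fun y => dser a s y) (heatLaw (t - s) x) := by
    intro s hs _
    refine ((integrable_exp_abs_heatLaw (t - s) x Λ).const_mul (C * Real.exp Λ)).mono' ?_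
      (ae_of_all _ fun y => hbound s hs y)
    have := (h.contDiff_dser hΛ).continuous
    exact (this.comp (by fun_prop : Continuous fun y : ℝ => (s, y))).aestronglyMeasurable
  rw [integrable_prod_iff hmeas.aestronglyMeasurable]
  constructor
  · filter_upwards [hgood] with s hs
    exact (integrable_heatLaw_iff (sub_pos.2 (lt_of_le_of_ne hs.1.2 hs.2)) x _).1 (hint s hs.1 hs.2)
  · refine Integrable.mono' (g := fun _ => C * Real.exp Λ * (2 * Real.exp (|x| * Λ + Λ ^ 2)))
      (integrable_const _) hmeas.norm.stronglyMeasurable.integral_prod_right'.aestronglyMeasurable ?_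
    filter_upwards [hgood] with s hs
    have hst : 0 < t - s := sub_pos.2 (lt_of_le_of_ne hs.1.2 hs.2)
    have hst1 : t - s ≤ 1 := by linarith [hs.1.1, ht.2]
    have hk : ∀ y, 0 ≤ heatKernel (t - s) (x - y) := fun y => by
      rw [heatKernel_eq_pdf hst]; exact gaussianPDFReal_nonneg _ _ _
    have e1 : ∀ y, ‖heatKernel (t - s) (x - y) * dser a s y‖ =
        heatKernel (t - s) (x - y) * |dser a s y| := fun y => by
      rw [norm_mul, Real.norm_of_nonneg (hk y), Real.norm_eq_abs]
    simp only [e1]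
    rw [← integral_heatLaw hst, Real.norm_of_nonneg (integral_nonneg fun y => abs_nonneg _)]
    calc _ ≤ ∫ y, C * Real.exp Λ * (Real.exp (Λ * y) + Real.exp (-Λ * y)) ∂heatLaw (t - s) x := by
          refine integral_mono (hint s hs.1 hs.2).abs (((integrable_exp_heatLaw _ _ _).add
            (integrable_exp_heatLaw _ _ _)).const_mul _) fun y => (hbound s hs.1 y).trans ?_
          exact mul_le_mul_of_nonneg_left (exp_mul_abs_le Λ y) (by positivity)
      _ = C * Real.exp Λ * (Real.exp (x * Λ + (t - s) * Λ ^ 2) +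
            Real.exp (x * (-Λ) + (t - s) * (-Λ) ^ 2)) := by
          rw [integral_const_mul, integral_add (integrable_exp_heatLaw _ _ _)
            (integrable_exp_heatLaw _ _ _), integral_exp_heatLaw hst.le, integral_exp_heatLaw hst.le]
      _ ≤ _ := by
          have h1 : x * Λ ≤ |x| * Λ := mul_le_mul_of_nonneg_right (le_abs_self x) hΛ
          have h2 : -x * Λ ≤ |x| * Λ := mul_le_mul_of_nonneg_right (neg_le_abs x) hΛ
          have h3 : (t - s) * Λ ^ 2 ≤ 1 * Λ ^ 2 := by gcongr
          have h4 : Real.exp (x * Λ + (t - s) * Λ ^ 2) ≤ Real.exp (|x| * Λ + Λ ^ 2) :=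
            Real.exp_le_exp.2 (by linarith)
          have h5 : Real.exp (x * (-Λ) + (t - s) * (-Λ) ^ 2) ≤ Real.exp (|x| * Λ + Λ ^ 2) :=
            Real.exp_le_exp.2 (by rw [neg_sq]; linarith)
          gcongr
          linarith

end HeatSeries

/-! ### Series of paths in the Bessel spaces -/

section PathSeries

variable {A : ℕ → ℕ → ℂ} {C Λ : ℝ} (ρ : Cut) (s : ℝ) (r : ℝ≥0∞) [Fact (1 ≤ r)]

/-- The coefficient attached to the multi-index `(j, i, l)` of the heat convolution. -/
def heatCoef (A : ℕ → ℕ → ℂ) (k : ℕ × ℕ × ℕ) : ℂ := A k.1 (k.2.2 + 2 * k.2.1)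

theorem norm_heatCoef_le (h : ∀ j k, ‖A j k‖ ≤ C * Λ ^ (j + k)) (k : ℕ × ℕ × ℕ) :
    ‖heatCoef A k‖ ≤ C * (Λ ^ k.1 * ((Λ ^ 2) ^ k.2.1 * Λ ^ k.2.2)) := by
  refine (h _ _).trans (le_of_eq ?_)
  rw [pow_add, pow_add, pow_mul]; ring

theorem summable_heatCoef_mul (h : ∀ j k, ‖A j k‖ ≤ C * Λ ^ (j + k)) (hΛ : 0 ≤ Λ) {b : ℝ} (hb : 0 ≤ b)
    {D : ℝ} {w : ℕ × ℕ × ℕ → ℝ} (hw0 : ∀ k, 0 ≤ w k)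
    (hw : ∀ k, w k ≤ D * (1 / (k.1.factorial * k.2.1.factorial) *
      (b ^ k.2.2 / k.2.2.factorial))) : Summable fun k => ‖heatCoef A k‖ * w k := by
  have hC : 0 ≤ C := by simpa using (norm_nonneg _).trans (h 0 0)
  refine Summable.of_nonneg_of_le (fun k => mul_nonneg (norm_nonneg _) (hw0 k)) (fun k => ?_)
    (summable_triple (C * D) Λ (Λ ^ 2) (Λ * b) hΛ (by positivity) (by positivity))
  calc _ ≤ (C * (Λ ^ k.1 * ((Λ ^ 2) ^ k.2.1 * Λ ^ k.2.2))) *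
        (D * (1 / (k.1.factorial * k.2.1.factorial) * (b ^ k.2.2 / k.2.2.factorial))) :=
        mul_le_mul (norm_heatCoef_le h k) (hw k) (hw0 k) (by positivity)
    _ = _ := by rw [mul_pow Λ b]; field_simp

/-- The path `t ↦ g_{ji}(t) ρ x^l/l!`. -/
def pathTerm (k : ℕ × ℕ × ℕ) : C(I, BesselSpace s r) where
  toFun t := (simplexCoef k.1 k.2.1 t : ℂ) • BesselSpace.ofSchwartz s r (ρ.mono k.2.2)
  continuous_toFun := by
    have := continuous_simplexCoef k.1 k.2.1
    fun_prop

theorem pathTerm_apply (k : ℕ × ℕ × ℕ) (t : I) : pathTerm ρ s r k t =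
    (simplexCoef k.1 k.2.1 t : ℂ) • BesselSpace.ofSchwartz s r (ρ.mono k.2.2) := rfl

theorem norm_ofSchwartz (f : 𝓢(ℝ, ℂ)) : ‖BesselSpace.ofSchwartz s r f‖ =
    ‖((SchwartzMap.toLpCLM ℂ ℂ r (volume : Measure ℝ)).comp (schwartzBessel s)) f‖ := by
  rw [BesselSpace.norm_def, BesselSpace.toLp_ofSchwartz]
  rfl

theorem norm_pathTerm_le : ∃ b D : ℝ, 0 ≤ b ∧ ∀ k, ‖pathTerm ρ s r k‖ ≤
    D * (1 / (k.1.factorial * k.2.1.factorial) * (b ^ k.2.2 / k.2.2.factorial)) := by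
  obtain ⟨b, hb, h⟩ := ρ.norm_clm_mono_le
  obtain ⟨D, hD, h⟩ := h ((SchwartzMap.toLpCLM ℂ ℂ r (volume : Measure ℝ)).comp (schwartzBessel s))
  refine ⟨b, D, hb, fun k => ?_⟩
  rw [ContinuousMap.norm_le _ (by positivity)]
  intro t
  rw [pathTerm_apply, norm_smul, Complex.norm_real, Real.norm_eq_abs, norm_ofSchwartz,
    mul_left_comm]
  exact mul_le_mul (abs_simplexCoef_le _ _ t.2) (h _) (norm_nonneg _) (by positivity)

/-- The path `∑ A_{j,l+2i} g_{ji}(t) ρ x^l/l!`. -/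
def pathSeries (A : ℕ → ℕ → ℂ) : C(I, BesselSpace s r) := ∑' k, heatCoef A k • pathTerm ρ s r k

theorem summable_norm_pathSeries (h : ∀ j k, ‖A j k‖ ≤ C * Λ ^ (j + k)) (hΛ : 0 ≤ Λ) :
    Summable fun k => ‖heatCoef A k • pathTerm ρ s r k‖ := by
  obtain ⟨b, D, hb, hD⟩ := norm_pathTerm_le ρ s r
  simp_rw [norm_smul]
  exact summable_heatCoef_mul h hΛ hb (fun k => norm_nonneg _) hD

theorem hasSum_pathSeries (h : ∀ j k, ‖A j k‖ ≤ C * Λ ^ (j + k)) (hΛ : 0 ≤ Λ) :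
    HasSum (fun k => heatCoef A k • pathTerm ρ s r k) (pathSeries ρ s r A) :=
  (summable_norm_pathSeries ρ s r h hΛ).of_norm.hasSum

theorem hasSum_pathSeries_apply (h : ∀ j k, ‖A j k‖ ≤ C * Λ ^ (j + k)) (hΛ : 0 ≤ Λ) (t : I) :
    HasSum (fun k => (heatCoef A k * simplexCoef k.1 k.2.1 t) •
      BesselSpace.ofSchwartz s r (ρ.mono k.2.2)) (pathSeries ρ s r A t) := by
  have := (hasSum_pathSeries ρ s r h hΛ).mapL (ContinuousMap.evalCLM ℂ t)
  refine hasSum_of_eq this fun k => ?_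
  rw [ContinuousMap.evalCLM_apply, ContinuousMap.smul_apply, pathTerm_apply, smul_smul]

theorem pathSeries_zero_apply (h : ∀ j k, ‖A j k‖ ≤ C * Λ ^ (j + k)) (hΛ : 0 ≤ Λ) :
    pathSeries ρ s r A 0 = 0 := by
  refine (hasSum_pathSeries_apply ρ s r h hΛ 0).unique ?_
  simp [simplexCoef_zero, hasSum_zero]

theorem pathSeries_sub {A' : ℕ → ℕ → ℂ} {C' Λ' : ℝ} (h : ∀ j k, ‖A j k‖ ≤ C * Λ ^ (j + k))
    (hΛ : 0 ≤ Λ) (h' : ∀ j k, ‖A' j k‖ ≤ C' * Λ' ^ (j + k)) (hΛ' : 0 ≤ Λ') :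
    pathSeries ρ s r (fun j k => A j k - A' j k) = pathSeries ρ s r A - pathSeries ρ s r A' := by
  have := (hasSum_pathSeries ρ s r h hΛ).sub (hasSum_pathSeries ρ s r h' hΛ')
  rw [← this.tsum_eq, pathSeries]
  refine tsum_congr fun k => ?_
  rw [← sub_smul]; rfl

/-- The `L^r` representative of an increment of the path, as a pointwise series. -/
def incrField (A : ℕ → ℕ → ℂ) (t t' : ℝ) (y : ℝ) : ℂ :=
  ∑' k : ℕ × ℕ × ℕ, (heatCoef A k * (simplexCoef k.1 k.2.1 t - simplexCoef k.1 k.2.1 t' : ℝ)) *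
    schwartzBessel s (ρ.mono k.2.2) y

theorem abs_simplexCoef_sub_le (j i : ℕ) {t t' : ℝ} (ht : t ∈ Icc (0 : ℝ) 1) (ht' : t' ∈ Icc (0 : ℝ) 1) :
    |simplexCoef j i t - simplexCoef j i t'| ≤ 2 * (1 / (j.factorial * i.factorial)) := by
  refine (abs_sub _ _).trans ?_
  linarith [abs_simplexCoef_le j i ht, abs_simplexCoef_le j i ht']

/-- Summability of the series of a continuous linear image of the increments. -/
theorem summable_increment {G : Type} [NormedAddCommGroup G] [NormedSpace ℂ G] (T : 𝓢(ℝ, ℂ) →L[ℂ] G)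
    (h : ∀ j k, ‖A j k‖ ≤ C * Λ ^ (j + k)) (hΛ : 0 ≤ Λ) {t t' : ℝ} (ht : t ∈ Icc (0 : ℝ) 1)
    (ht' : t' ∈ Icc (0 : ℝ) 1) : Summable fun k : ℕ × ℕ × ℕ =>
      ‖(heatCoef A k * (simplexCoef k.1 k.2.1 t - simplexCoef k.1 k.2.1 t' : ℝ)) •
        T (ρ.mono k.2.2)‖ := by
  obtain ⟨b, hb, h'⟩ := ρ.norm_clm_mono_le
  obtain ⟨D, hD, h'⟩ := h' T
  simp_rw [norm_smul, norm_mul, mul_assoc]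
  refine summable_heatCoef_mul h hΛ hb (D := 2 * D) (fun k => by positivity) fun k => ?_
  rw [Complex.norm_real, Real.norm_eq_abs]
  refine (mul_le_mul (abs_simplexCoef_sub_le _ _ ht ht') (h' _) (norm_nonneg _)
    (by positivity)).trans (le_of_eq (by ring))

theorem tsum_enorm_ne_top {ι G : Type*} [NormedAddCommGroup G] {f : ι → G}
    (h : Summable fun i => ‖f i‖) : ∑' i, ‖f i‖ₑ ≠ ∞ := by
  simp_rw [← ofReal_norm]
  exact h.tsum_ofReal_ne_top

/-- An element of `L^r` has no value at a given `y`. This representative does, so Gaussian estimates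
at fixed `y` and Tonelli's theorem apply to it. -/
theorem toLp_increment_ae (h : ∀ j k, ‖A j k‖ ≤ C * Λ ^ (j + k)) (hΛ : 0 ≤ Λ) (t t' : I) :
    (pathSeries ρ s r A t - pathSeries ρ s r A t').toLp =ᵐ[volume] incrField ρ s A t t' := by
  set T := (SchwartzMap.toLpCLM ℂ ℂ r (volume : Measure ℝ)).comp (schwartzBessel s)
  have hs := summable_increment ρ T h hΛ t.2 t'.2
  have h1 := (hasSum_pathSeries_apply ρ s r h hΛ t).sub (hasSum_pathSeries_apply ρ s r h hΛ t')
  have h2 : HasSum (fun k : ℕ × ℕ × ℕ => (heatCoef A k *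
      (simplexCoef k.1 k.2.1 t - simplexCoef k.1 k.2.1 t' : ℝ)) • T (ρ.mono k.2.2))
      (pathSeries ρ s r A t - pathSeries ρ s r A t').toLp := by
    refine hasSum_of_eq (h1.map BesselSpace.toLp BesselSpace.isometry_toLp.continuous) fun k => ?_
    rw [Function.comp, ← sub_smul, map_smul, BesselSpace.toLp_ofSchwartz, ← mul_sub]
    push_cast
    rfl
  have h3 := Lp.hasSum_coeFn_tsum (tsum_enorm_ne_top hs)
  have h4 : ∀ᵐ y ∂(volume : Measure ℝ), ∀ k : ℕ × ℕ × ℕ, ((heatCoef A k *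
      (simplexCoef k.1 k.2.1 t - simplexCoef k.1 k.2.1 t' : ℝ)) • T (ρ.mono k.2.2)) y =
      (heatCoef A k * (simplexCoef k.1 k.2.1 t - simplexCoef k.1 k.2.1 t' : ℝ)) *
        schwartzBessel s (ρ.mono k.2.2) y := by
    refine ae_all_iff.2 fun k => ?_
    filter_upwards [Lp.coeFn_smul (heatCoef A k *
      (simplexCoef k.1 k.2.1 t - simplexCoef k.1 k.2.1 t' : ℝ)) (T (ρ.mono k.2.2)),
      SchwartzMap.coeFn_toLp (schwartzBessel s (ρ.mono k.2.2)) r volume] with y h5 h6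
    rw [h5, Pi.smul_apply, smul_eq_mul]
    congr 1
  rw [h2.tsum_eq] at h3
  filter_upwards [h3, h4] with y h5 h6
  simp_rw [h6] at h5
  exact h5.tsum_eq.symm

/-- The localized series converges both in the Bessel space and in `L¹`. Both embed continuously in
the tempered distributions, where the limits can be compared; the `L¹` limit also supplies the
integrability that `funDist` requires. -/
theorem toDist_pathSeries (h : ∀ j k, ‖A j k‖ ≤ C * Λ ^ (j + k)) (hΛ : 0 ≤ Λ) {b : ℝ → ℝ → ℝ} (t : I)
    (hb : ∀ x : ℝ, HasSum (fun k => heatCoef A k * simplexCoef k.1 k.2.1 t *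
      ((x : ℂ) ^ k.2.2 / (k.2.2.factorial : ℂ))) (heatSol b t x : ℂ)) :
    (pathSeries ρ s r A t).toDist = localSol ρ.toFun b t := by
  set T := SchwartzMap.toLpCLM ℂ ℂ 1 (volume : Measure ℝ)
  have hz : (0 : ℝ) ∈ Icc (0 : ℝ) 1 := ⟨le_rfl, zero_le_one⟩
  have hs := summable_increment ρ T h hΛ t.2 hz
  simp only [simplexCoef_zero, sub_zero] at hs
  set f : ℕ × ℕ × ℕ → Lp ℂ 1 (volume : Measure ℝ) := fun k =>
    (heatCoef A k * simplexCoef k.1 k.2.1 t) • T (ρ.mono k.2.2) with hf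
  have h3 := Lp.hasSum_coeFn_tsum (f := f) (tsum_enorm_ne_top hs)
  have h4 : ∀ᵐ y ∂(volume : Measure ℝ), ∀ k : ℕ × ℕ × ℕ, f k y =
      (ρ.toFun y : ℂ) * (heatCoef A k * simplexCoef k.1 k.2.1 t *
        ((y : ℂ) ^ k.2.2 / (k.2.2.factorial : ℂ))) := by
    refine ae_all_iff.2 fun k => ?_
    filter_upwards [Lp.coeFn_smul (heatCoef A k * simplexCoef k.1 k.2.1 t : ℂ) (T (ρ.mono k.2.2)),
      SchwartzMap.coeFn_toLp (ρ.mono k.2.2) 1 volume] with y h5 h6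
    rw [hf, h5, Pi.smul_apply, smul_eq_mul, show (T (ρ.mono k.2.2)) y = _ from h6, Cut.mono_apply]
    ring
  have h5 : (∑' k, f k : Lp ℂ 1 (volume : Measure ℝ)) =ᵐ[volume]
      fun x => ((ρ.toFun x * heatSol b t x : ℝ) : ℂ) := by
    filter_upwards [h3, h4] with y h6 h7
    simp_rw [h7] at h6
    rw [h6.unique ((hb y).mul_left _)]
    push_cast
    rfl
  have h8 : MemLp (fun x => ((ρ.toFun x * heatSol b t x : ℝ) : ℂ)) 1 (volume : Measure ℝ) :=
    (memLp_congr_ae h5).1 (Lp.memLp _)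
  have h9 : h8.toLp _ = ∑' k, f k := by
    apply Lp.ext
    exact (MemLp.coeFn_toLp h8).trans h5.symm
  rw [localSol, funDist, dif_pos h8, h9]
  have h10 := (hasSum_pathSeries_apply ρ s r h hΛ t).map BesselSpace.toDist
    BesselSpace.continuous_toDist
  have h11 := (hs.of_norm (f := f)).hasSum.mapL (Lp.toTemperedDistributionCLM ℂ (volume : Measure ℝ) 1)
  rw [Lp.toTemperedDistributionCLM_apply] at h11
  refine h10.unique (hasSum_of_eq h11 fun k => ?_)
  rw [Function.comp, map_smul, hf, map_smul, BesselSpace.toDist_ofSchwartz]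
  congr 1
  rw [Lp.toTemperedDistributionCLM_apply]
  exact (Lp.toTemperedDistribution_toLp_eq _).symm

end PathSeries

/-! ### The random coefficients -/

section RandomCoef

variable {Ω : Type*} [MeasurableSpace Ω] {P : Measure Ω}
  {W : Lp ℝ 2 (volume : Measure Plane) → Ω → ℝ} {H₀ H₁ : ℝ} {θ : Plane → ℝ} {Λ : ℝ}

/-- The kernel `θ w (iξ)^j (iη)^k` of the random coefficients. -/
def coefKernel (H₀ H₁ : ℝ) (θ : Plane → ℝ) (j k : ℕ) (z : Plane) : ℂ :=
  θ z * noiseWeight H₀ H₁ z * ((Complex.I * z 0) ^ j * (Complex.I * z 1) ^ k)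

/-- The random coefficients of the truncated sheet. -/
def coef (W : Lp ℝ 2 (volume : Measure Plane) → Ω → ℝ) (H₀ H₁ : ℝ) (θ : Plane → ℝ) (ω : Ω)
    (j k : ℕ) : ℂ :=
  integralHat W (coefKernel H₀ H₁ θ j k) ω

theorem measurable_coefKernel (hθ : IsFreqCutoff θ Λ) (j k : ℕ) :
    Measurable (coefKernel H₀ H₁ θ j k) := by
  unfold coefKernel
  have := hθ.meas
  have := measurable_noiseWeight H₀ H₁
  fun_prop

theorem norm_coefKernel_le (hθ : IsFreqCutoff θ Λ) (j k : ℕ) (z : Plane) :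
    ‖coefKernel H₀ H₁ θ j k z‖ ≤ Λ ^ (j + k) * (|θ z| * ‖noiseWeight H₀ H₁ z‖) := by
  rw [coefKernel, norm_mul, norm_mul, norm_mul, norm_pow, norm_pow, norm_mul, norm_mul,
    Complex.norm_I, one_mul, one_mul, Complex.norm_real, Complex.norm_real, Complex.norm_real]
  simp only [Real.norm_eq_abs]
  by_cases hz : θ z = 0
  · simp [hz]
  · have := hθ.one_le
    rw [pow_add, mul_comm]
    gcongr
    · exact (hθ.supp z hz).1
    · exact (hθ.supp z hz).2

theorem memLp_coefKernel (hθ : IsFreqCutoff θ Λ) (h₀ : H₀ < 1) (h₁ : H₁ < 1) (j k : ℕ) :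
    MemLp (coefKernel H₀ H₁ θ j k) 2 volume :=
  memLp_of_bound (measurable_coefKernel hθ j k).aestronglyMeasurable (hθ.memLp h₀ h₁)
    (norm_coefKernel_le hθ j k)

theorem aemeasurable_coef (hW : IsWhiteNoise W P) (j k : ℕ) :
    AEMeasurable (fun ω => coef W H₀ H₁ θ ω j k) P :=
  aemeasurable_integralHat hW _

/-- A power series in `iξ`, `iη` under the Wiener integral becomes the same series in the random
coefficients. It serves both for the sheet itself and for the increments of the paths. -/
theorem ae_hasSum_coef (hW : IsWhiteNoise W P) (hθ : IsFreqCutoff θ Λ) (h₀ : H₀ < 1) (h₁ : H₁ < 1)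
    {ι : Type*} [Countable ι] (J K : ι → ℕ) (u : ι → ℂ)
    (hu : Summable fun i => ‖u i‖ * Λ ^ (J i + K i)) {f : Plane → ℂ}
    (hf : ∀ z : Plane, HasSum (fun i => u i * ((Complex.I * z 0) ^ J i * (Complex.I * z 1) ^ K i))
      (f z)) :
    MemLp (fun z => θ z * noiseWeight H₀ H₁ z * f z) 2 volume ∧
    ∀ᵐ ω ∂P, HasSum (fun i => u i * coef W H₀ H₁ θ ω (J i) (K i))
      (integralHat W (fun z => θ z * noiseWeight H₀ H₁ z * f z) ω) := by
  have hΛ := hθ.one_le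
  obtain ⟨m, h⟩ := ae_hasSum_integralHat hW (Φ := fun i z => u i * coefKernel H₀ H₁ θ (J i) (K i) z)
    (f := fun z => θ z * noiseWeight H₀ H₁ z * f z)
    (fun i => ((measurable_coefKernel hθ (J i) (K i)).const_mul _).aestronglyMeasurable)
    (hθ.memLp h₀ h₁) (fun i => by positivity) hu
    (fun i z => by
      rw [norm_mul, mul_assoc]
      exact mul_le_mul_of_nonneg_left (norm_coefKernel_le hθ _ _ z) (norm_nonneg _))
    (Eventually.of_forall fun z =>
      hasSum_of_eq ((hf z).mul_left (θ z * noiseWeight H₀ H₁ z)) fun i => by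
        rw [coefKernel]; ring)
  refine ⟨m, ?_⟩
  have hc : ∀ᵐ ω ∂P, ∀ i, integralHat W (fun z => u i * coefKernel H₀ H₁ θ (J i) (K i) z) ω =
      u i * coef W H₀ H₁ θ ω (J i) (K i) :=
    ae_all_iff.2 fun i => integralHat_const_mul hW (memLp_coefKernel hθ h₀ h₁ _ _) (u i)
  filter_upwards [h, hc] with ω h1 h2
  simpa only [h2] using h1

/-- Divided by `(2Λ)^(j+k)`, the kernels are bounded by `2^(-(j+k))` times a fixed `L²` function, so
the normalized coefficients are almost surely summable, hence bounded. The extra factor 2 buys the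
summability. -/
theorem ae_norm_coef_le (hW : IsWhiteNoise W P) (hθ : IsFreqCutoff θ Λ) (h₀ : H₀ < 1) (h₁ : H₁ < 1) :
    ∀ᵐ ω ∂P, ∃ C : ℝ, ∀ j k, ‖coef W H₀ H₁ θ ω j k‖ ≤ C * (2 * Λ) ^ (j + k) := by
  have hΛ := hθ.one_le
  set c : ℕ × ℕ → ℝ := fun i => (2⁻¹ : ℝ) ^ i.1 * (2⁻¹ : ℝ) ^ i.2
  have hcs : Summable c := (summable_geometric_of_lt_one (by norm_num) (by norm_num)).mul_of_nonneg
    (summable_geometric_of_lt_one (by norm_num) (by norm_num)) (fun _ => by positivity)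
    (fun _ => by positivity)
  have hp : ∀ i : ℕ × ℕ, ‖(((2 * Λ) ^ (i.1 + i.2) : ℝ) : ℂ)⁻¹‖ = ((2 * Λ) ^ (i.1 + i.2))⁻¹ := by
    intro i
    rw [norm_inv, Complex.norm_real, Real.norm_of_nonneg (by positivity)]
  have h := ae_summable_integralHat hW (ι := ℕ × ℕ)
    (Φ := fun i z => (((2 * Λ) ^ (i.1 + i.2) : ℝ) : ℂ)⁻¹ * coefKernel H₀ H₁ θ i.1 i.2 z)
    (fun i => ((measurable_coefKernel hθ i.1 i.2).const_mul _).aestronglyMeasurable)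
    (hθ.memLp h₀ h₁) (c := c) (fun i => by positivity) hcs (fun i z => by
      rw [norm_mul, hp]
      refine (mul_le_mul_of_nonneg_left (norm_coefKernel_le hθ i.1 i.2 z) (by positivity)).trans
        (le_of_eq ?_)
      simp only [c]
      rw [← mul_assoc, mul_pow, ← pow_add, inv_pow]
      field_simp)
  have hc : ∀ᵐ ω ∂P, ∀ i : ℕ × ℕ,
      integralHat W (fun z => (((2 * Λ) ^ (i.1 + i.2) : ℝ) : ℂ)⁻¹ * coefKernel H₀ H₁ θ i.1 i.2 z) ω =
      (((2 * Λ) ^ (i.1 + i.2) : ℝ) : ℂ)⁻¹ * coef W H₀ H₁ θ ω i.1 i.2 :=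
    ae_all_iff.2 fun i => integralHat_const_mul hW (memLp_coefKernel hθ h₀ h₁ _ _) _
  filter_upwards [h, hc] with ω h1 h2
  simp_rw [h2, norm_mul, hp] at h1
  refine ⟨∑' i : ℕ × ℕ, ((2 * Λ) ^ (i.1 + i.2))⁻¹ * ‖coef W H₀ H₁ θ ω i.1 i.2‖, fun j k => ?_⟩
  have := h1.le_tsum (j, k) (fun _ _ => by positivity)
  rw [inv_mul_le_iff₀ (by positivity)] at this
  rw [mul_comm]
  exact this

theorem ae_coef_sub (hW : IsWhiteNoise W P) {θ' : Plane → ℝ} {Λ' : ℝ} (hθ : IsFreqCutoff θ Λ)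
    (hθ' : IsFreqCutoff θ' Λ') (h₀ : H₀ < 1) (h₁ : H₁ < 1) :
    ∀ᵐ ω ∂P, ∀ j k, coef W H₀ H₁ (fun z => θ z - θ' z) ω j k =
      coef W H₀ H₁ θ ω j k - coef W H₀ H₁ θ' ω j k := by
  refine ae_all_iff.2 fun j => ae_all_iff.2 fun k => ?_
  filter_upwards [integralHat_sub hW (memLp_coefKernel (H₀ := H₀) (H₁ := H₁) hθ h₀ h₁ j k)
    (memLp_coefKernel hθ' h₀ h₁ j k)] with ω h
  rw [coef, coef, coef, ← Pi.sub_apply, ← h]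
  congr 1
  ext z
  simp only [coefKernel, Pi.sub_apply]
  push_cast
  ring

end RandomCoef

/-! ### The truncated sheet as a double series -/

section Sheet

variable {Ω : Type*} [MeasurableSpace Ω] {P : Measure Ω}
  {W : Lp ℝ 2 (volume : Measure Plane) → Ω → ℝ} {H₀ H₁ κ : ℝ} {n : ℕ}

/-- The indicator of the frequency domain. -/
def freqCut (κ : ℝ) (n : ℕ) : Plane → ℝ := (freqDomain κ n).indicator fun _ => 1

theorem measurableSet_freqDomain (κ : ℝ) (n : ℕ) : MeasurableSet (freqDomain κ n) := by
  have h : ∀ i : Fin 2, Measurable fun z : Plane => |z i| := fun i => by fun_prop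
  exact (measurableSet_le (h 0) measurable_const).inter (measurableSet_le (h 1) measurable_const)

theorem isFreqCutoff_freqCut (hκ : 0 < κ) (n : ℕ) :
    IsFreqCutoff (freqCut κ n) ((2 : ℝ) ^ (2 * κ * n)) where
  meas := measurable_const.indicator (measurableSet_freqDomain κ n)
  one_le := Real.one_le_rpow one_le_two (by positivity)
  abs_le z := by
    unfold freqCut
    by_cases hz : z ∈ freqDomain κ n <;> simp [hz]
  supp z hz := by
    have hz : z ∈ freqDomain κ n := by
      by_contra h
      exact hz (indicator_of_notMem h _)
    refine ⟨hz.1, hz.2.trans (Real.rpow_le_rpow_of_exponent_le one_le_two ?_)⟩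
    have : 0 ≤ κ * n := by positivity
    linarith

/-- The series `∑ (iξ)^j t^{j+1}/(j+1)! = (e^{iξt} - 1)/(iξ)`. -/
def expQuot (t ξ : ℝ) : ℂ :=
  ∑' j : ℕ, (t : ℂ) ^ (j + 1) / ((j + 1).factorial : ℂ) * (Complex.I * ξ) ^ j

theorem summable_norm_expQuot (t ξ : ℝ) : Summable fun j : ℕ =>
    ‖(t : ℂ) ^ (j + 1) / ((j + 1).factorial : ℂ) * (Complex.I * ξ) ^ j‖ := by
  refine Summable.of_nonneg_of_le (fun _ => norm_nonneg _) (fun j => ?_)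
    ((Real.summable_pow_div_factorial (|t| * |ξ|)).mul_left |t|)
  rw [norm_mul, norm_div, norm_pow, norm_pow, norm_mul, Complex.norm_I, one_mul, Complex.norm_real,
    Complex.norm_real, Complex.norm_natCast]
  simp only [Real.norm_eq_abs]
  calc _ ≤ |t| ^ (j + 1) / (j.factorial : ℝ) * |ξ| ^ j := by
        gcongr
        omega
    _ = _ := by rw [pow_succ, mul_pow]; ring

theorem hasSum_expQuot_mul (t ξ x η : ℝ) : HasSum (fun k : ℕ × ℕ =>
    ((t : ℂ) ^ (k.1 + 1) / ((k.1 + 1).factorial : ℂ) * (Complex.I * ξ) ^ k.1) *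
      ((x : ℂ) ^ (k.2 + 1) / ((k.2 + 1).factorial : ℂ) * (Complex.I * η) ^ k.2))
    (expQuot t ξ * expQuot x η) := by
  rw [expQuot, expQuot, tsum_mul_tsum_of_summable_norm (summable_norm_expQuot t ξ)
    (summable_norm_expQuot x η)]
  exact (summable_mul_of_summable_norm (summable_norm_expQuot t ξ) (summable_norm_expQuot x η)).hasSum

theorem mul_expQuot (t ξ : ℝ) : Complex.I * ξ * expQuot t ξ = Complex.exp (Complex.I * ξ * t) - 1 := by
  have h : HasSum (fun n : ℕ => (Complex.I * ξ * t) ^ n / (n.factorial : ℂ))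
      (Complex.exp (Complex.I * ξ * t)) := by
    rw [Complex.exp_eq_exp_ℂ]
    exact NormedSpace.expSeries_div_hasSum_exp _
  have h1 := (hasSum_nat_add_iff' 1).2 h
  simp only [Finset.range_one, Finset.sum_singleton, pow_zero, Nat.factorial_zero, Nat.cast_one,
    div_one] at h1
  rw [expQuot, ← tsum_mul_left, ← h1.tsum_eq]
  refine tsum_congr fun j => ?_
  rw [mul_pow (Complex.I * (ξ : ℂ)) (t : ℂ) (j + 1), pow_succ (Complex.I * (ξ : ℂ))]
  ring

/-- Factoring `iξ` and `iη` out of the two differences leaves entire functions and gives the weight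
the form it has for `∂_t∂_x B`. -/
theorem sheetKernel_eq (t x : ℝ) : sheetKernel H₀ H₁ κ n t x = fun z =>
    freqCut κ n z * noiseWeight H₀ H₁ z * (expQuot t (z 0) * expQuot x (z 1)) := by
  ext z
  have hk : ∀ H t ξ : ℝ, harmKernel H t ξ =
      Complex.I * ξ / ((|ξ| ^ (H + 1 / 2) : ℝ) : ℂ) * expQuot t ξ := by
    intro H t ξ
    rw [harmKernel, ← mul_expQuot]; ring
  rw [sheetKernel, freqCut, noiseWeight]
  by_cases hz : z ∈ freqDomain κ n
  · rw [indicator_of_mem hz, indicator_of_mem hz, hk, hk, Complex.ofReal_one]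
    ring
  · rw [indicator_of_notMem hz, indicator_of_notMem hz]
    simp

theorem ae_hasSum_sheet (hW : IsWhiteNoise W P) (hκ : 0 < κ) (h₀ : H₀ < 1) (h₁ : H₁ < 1) (t x : ℝ) :
    MemLp (sheetKernel H₀ H₁ κ n t x) 2 volume ∧ ∀ᵐ ω ∂P, HasSum (fun k : ℕ × ℕ =>
      ((t ^ (k.1 + 1) / (k.1 + 1).factorial * (x ^ (k.2 + 1) / (k.2 + 1).factorial) : ℝ) : ℂ) *
        coef W H₀ H₁ (freqCut κ n) ω k.1 k.2)
      (integralHat W (sheetKernel H₀ H₁ κ n t x) ω) := by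
  have hθ := isFreqCutoff_freqCut hκ n
  have hΛ := hθ.one_le
  set Λ := (2 : ℝ) ^ (2 * κ * n)
  rw [sheetKernel_eq]
  refine ae_hasSum_coef hW hθ h₀ h₁ (fun k : ℕ × ℕ => k.1) (fun k => k.2)
    (fun k => ((t ^ (k.1 + 1) / (k.1 + 1).factorial * (x ^ (k.2 + 1) / (k.2 + 1).factorial) : ℝ) : ℂ))
    ?_ fun z => ?_
  · have hs : ∀ t : ℝ, Summable fun j : ℕ => |t| ^ (j + 1) / ((j + 1).factorial : ℝ) * Λ ^ j := by
      intro t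
      refine (summable_norm_expQuot t Λ).congr fun j => ?_
      rw [norm_mul, norm_div, norm_pow, norm_pow, norm_mul, Complex.norm_I, one_mul,
        Complex.norm_real, Complex.norm_real, Complex.norm_natCast, Real.norm_eq_abs,
        Real.norm_of_nonneg (by positivity)]
    refine ((hs t).mul_of_nonneg (hs x) (fun _ => by positivity) (fun _ => by positivity)).congr
      fun k => ?_
    rw [Complex.norm_real, norm_mul, norm_div, norm_div, norm_pow, norm_pow, pow_add Λ]
    simp only [Real.norm_eq_abs, Nat.abs_cast]
    ring
  · refine hasSum_of_eq (hasSum_expQuot_mul t (z 0) x (z 1)) fun k => ?_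
    push_cast
    ring

/-- Almost surely, all the values of the smooth version are given by the double series. -/
theorem ae_sheet_eq_dser (hW : IsWhiteNoise W P) (hκ : 0 < κ) (h₀ : H₀ < 1) (h₁ : H₁ < 1)
    {B : ℝ → ℝ → Ω → ℝ} (hB : IsTruncatedSheet W P H₀ H₁ κ n B) :
    ∀ᵐ ω ∂P, (∃ C : ℝ, ∀ j k, ‖coef W H₀ H₁ (freqCut κ n) ω j k‖ ≤
        C * (2 * (2 : ℝ) ^ (2 * κ * n)) ^ (j + k)) ∧
      (∀ t x, B t x ω = dser (padSeq fun j k => (coef W H₀ H₁ (freqCut κ n) ω j k).re) t x) ∧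
      ∀ t x, (0 : ℝ) = dser (padSeq fun j k => (coef W H₀ H₁ (freqCut κ n) ω j k).im) t x := by
  have hθ := isFreqCutoff_freqCut hκ n
  have hΛ := hθ.one_le
  set Λ := (2 : ℝ) ^ (2 * κ * n)
  -- The version property has one null set per point. Rational points keep these countable, and
  -- continuity of the path and of the series extends the identity to the plane.
  have hv : ∀ᵐ ω ∂P, ∀ z : ℚ × ℚ, (B z.1 z.2 ω : ℂ) =
      integralHat W (sheetKernel H₀ H₁ κ n z.1 z.2) ω := ae_all_iff.2 fun z => hB.version _ _
  have hs : ∀ᵐ ω ∂P, ∀ z : ℚ × ℚ, HasSum (fun k : ℕ × ℕ =>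
      (((z.1 : ℝ) ^ (k.1 + 1) / (k.1 + 1).factorial *
        ((z.2 : ℝ) ^ (k.2 + 1) / (k.2 + 1).factorial) : ℝ) : ℂ) *
        coef W H₀ H₁ (freqCut κ n) ω k.1 k.2)
      (integralHat W (sheetKernel H₀ H₁ κ n z.1 z.2) ω) :=
    ae_all_iff.2 fun z => (ae_hasSum_sheet hW hκ h₀ h₁ _ _).2
  filter_upwards [ae_norm_coef_le hW hθ h₀ h₁, hv, hs, hB.smooth] with ω ⟨C, hC⟩ hv hs hsm
  set A := coef W H₀ H₁ (freqCut κ n) ω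
  have g1 : GeomBound (fun j k => (A j k).re) C (2 * Λ) := fun j k =>
    (Complex.abs_re_le_norm _).trans (hC j k)
  have g2 : GeomBound (fun j k => (A j k).im) C (2 * Λ) := fun j k =>
    (Complex.abs_im_le_norm _).trans (hC j k)
  have hd : DenseRange fun z : ℚ × ℚ => ((z.1 : ℝ), (z.2 : ℝ)) :=
    Rat.denseRange_cast.prodMap Rat.denseRange_cast
  have c1 := ((g1.pad (by linarith)).contDiff_dser (by linarith)).continuous
  have c2 := ((g2.pad (by linarith)).contDiff_dser (by linarith)).continuous
  refine ⟨⟨C, hC⟩, fun t x => ?_, fun t x => ?_⟩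
  · refine congrFun (hd.equalizer hsm.continuous c1 (funext fun z => ?_)) (t, x)
    have h1 := hs z
    rw [← hv z] at h1
    have h2 := Complex.hasSum_re h1
    have h3 := (g1.pad (by linarith)).hasSum (by linarith) z.1 z.2
    rw [hasSum_padSeq_iff] at h3
    refine h2.unique (hasSum_of_eq h3 fun k => ?_)
    rw [Complex.re_ofReal_mul, mul_comm]
  -- `B` is real, so the imaginary parts form a series with sum zero; no separate proof that each
  -- coefficient is real is needed.
  · refine congrFun (hd.equalizer continuous_const c2 (funext fun z => ?_)) (t, x)
    have h1 := hs z
    rw [← hv z] at h1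
    have h2 := Complex.hasSum_im h1
    have h3 := (g2.pad (by linarith)).hasSum (by linarith) z.1 z.2
    rw [hasSum_padSeq_iff] at h3
    refine h2.unique (hasSum_of_eq h3 fun k => ?_)
    rw [Complex.im_ofReal_mul, mul_comm]

end Sheet

/-! ### The main moment estimate -/

section MainEstimate

variable {Ω : Type*} [MeasurableSpace Ω] {P : Measure Ω}
  {W : Lp ℝ 2 (volume : Measure Plane) → Ω → ℝ} {H₀ H₁ : ℝ} {θ : Plane → ℝ} {Λ : ℝ}

/-- The random path associated with a frequency cutoff. -/
def cutPath (W : Lp ℝ 2 (volume : Measure Plane) → Ω → ℝ) (H₀ H₁ : ℝ) (ρ : Cut) (s : ℝ) (r : ℝ≥0∞)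
    [Fact (1 ≤ r)] (θ : Plane → ℝ) (ω : Ω) : C(I, BesselSpace s r) :=
  pathSeries ρ s r (coef W H₀ H₁ θ ω)

theorem aestronglyMeasurable_cutPath (hW : IsWhiteNoise W P) (hθ : IsFreqCutoff θ Λ) (h₀ : H₀ < 1)
    (h₁ : H₁ < 1) (ρ : Cut) (s : ℝ) (r : ℝ≥0∞) [Fact (1 ≤ r)] :
    AEStronglyMeasurable (cutPath W H₀ H₁ ρ s r θ) P := by
  refine aestronglyMeasurable_of_tendsto_ae (atTop : Filter (Finset (ℕ × ℕ × ℕ)))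
    (f := fun S ω => ∑ k ∈ S, heatCoef (coef W H₀ H₁ θ ω) k • pathTerm ρ s r k) (fun S => ?_) ?_
  · refine Finset.aestronglyMeasurable_fun_sum S fun k _ => ?_
    exact (aemeasurable_coef hW _ _).aestronglyMeasurable.smul_const _
  · have := hθ.one_le
    filter_upwards [ae_norm_coef_le hW hθ h₀ h₁] with ω ⟨C, hC⟩
    exact hasSum_pathSeries ρ s r hC (by positivity)

/-- Evaluation of the Bessel potential of a Schwartz function. -/
def besselEval (s y : ℝ) : 𝓢(ℝ, ℂ) →L[ℂ] ℂ :=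
  ((BoundedContinuousFunction.evalCLM ℂ y).comp
    (SchwartzMap.toBoundedContinuousFunctionCLM ℂ ℝ ℂ)).comp (schwartzBessel s)

theorem besselEval_apply (s y : ℝ) (f : 𝓢(ℝ, ℂ)) : besselEval s y f = schwartzBessel s f y := rfl

theorem hasSum_mul_prod {ι κ : Type*} {f : ι → ℂ} {g : κ → ℂ} {a b : ℂ} (hf : HasSum f a)
    (hg : HasSum g b) : HasSum (fun x : ι × κ => f x.1 * g x.2) (a * b) :=
  hf.mul hg (summable_mul_of_summable_norm hf.summable.norm hg.summable.norm)

/-- The product of the expansions of the heat symbol and of the localized exponential. The index `l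
+ 2i` comes from `(-η²)^i (iη)^l = (iη)^(l+2i)`. -/
theorem hasSum_increment_symbol (ρ : Cut) (s y : ℝ) {t t' : ℝ} (ht : t ∈ Icc (0 : ℝ) 1)
    (ht' : t' ∈ Icc (0 : ℝ) 1) (ξ η : ℝ) : HasSum (fun k : ℕ × ℕ × ℕ =>
      (((simplexCoef k.1 k.2.1 t - simplexCoef k.1 k.2.1 t' : ℝ) : ℂ) *
        schwartzBessel s (ρ.mono k.2.2) y) *
        ((Complex.I * ξ) ^ k.1 * (Complex.I * η) ^ (k.2.2 + 2 * k.2.1)))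
      ((heatSymbol t ξ η - heatSymbol t' ξ η) *
        schwartzBessel s (ρ.exp (Complex.I * η)) y) := by
  have h2 : HasSum (fun l => (Complex.I * η) ^ l * schwartzBessel s (ρ.mono l) y)
      (schwartzBessel s (ρ.exp (Complex.I * η)) y) := by
    refine hasSum_of_eq ((ρ.hasSum_exp (Complex.I * η)).mapL (besselEval s y)) fun l => ?_
    rw [map_smul, besselEval_apply, smul_eq_mul]
  have h3 := hasSum_mul_prod ((hasSum_heatSymbol ht ξ η).sub (hasSum_heatSymbol ht' ξ η)) h2
  refine hasSum_of_eq ((Equiv.prodAssoc ℕ ℕ ℕ).symm.hasSum_iff.2 h3) fun k => ?_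
  simp only [Function.comp, Equiv.prodAssoc_symm_apply]
  rw [pow_add, pow_mul, mul_pow Complex.I (η : ℂ) 2, Complex.I_sq]
  push_cast
  ring

/-- The resummation at a fixed point `y`. It reduces every moment of the increment to a
deterministic `L²` norm in frequency. -/
theorem ae_incrField_eq (hW : IsWhiteNoise W P) (hθ : IsFreqCutoff θ Λ) (h₀ : H₀ < 1) (h₁ : H₁ < 1)
    (ρ : Cut) (s y : ℝ) {t t' : ℝ} (ht : t ∈ Icc (0 : ℝ) 1) (ht' : t' ∈ Icc (0 : ℝ) 1) :
    MemLp (fun z : Plane => θ z * noiseWeight H₀ H₁ z *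
        ((heatSymbol t (z 0) (z 1) - heatSymbol t' (z 0) (z 1)) *
          schwartzBessel s (ρ.exp (Complex.I * z 1)) y)) 2 volume ∧
    ∀ᵐ ω ∂P, incrField ρ s (coef W H₀ H₁ θ ω) t t' y =
      integralHat W (fun z : Plane => θ z * noiseWeight H₀ H₁ z *
        ((heatSymbol t (z 0) (z 1) - heatSymbol t' (z 0) (z 1)) *
          schwartzBessel s (ρ.exp (Complex.I * z 1)) y)) ω := by
  have hΛ := hθ.one_le
  have hu : Summable fun k : ℕ × ℕ × ℕ =>
      ‖((simplexCoef k.1 k.2.1 t - simplexCoef k.1 k.2.1 t' : ℝ) : ℂ) *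
        schwartzBessel s (ρ.mono k.2.2) y‖ * Λ ^ (k.1 + (k.2.2 + 2 * k.2.1)) := by
    have := summable_increment ρ (besselEval s y) (A := fun j k => (Λ : ℂ) ^ (j + k)) (C := 1) (Λ := Λ)
      (fun j k => by rw [norm_pow, Complex.norm_real, Real.norm_of_nonneg (by positivity), one_mul])
      (by positivity) ht ht'
    refine this.congr fun k => ?_
    rw [norm_smul, norm_mul, norm_mul, heatCoef, norm_pow, Complex.norm_real Λ,
      Real.norm_of_nonneg (by positivity), besselEval_apply]
    ring
  obtain ⟨m, h⟩ := ae_hasSum_coef hW hθ h₀ h₁ (fun k : ℕ × ℕ × ℕ => k.1)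
    (fun k => k.2.2 + 2 * k.2.1) (fun k => ((simplexCoef k.1 k.2.1 t - simplexCoef k.1 k.2.1 t' : ℝ) : ℂ) *
        schwartzBessel s (ρ.mono k.2.2) y) hu (f := fun z =>
          (heatSymbol t (z 0) (z 1) - heatSymbol t' (z 0) (z 1)) *
          schwartzBessel s (ρ.exp (Complex.I * z 1)) y)
    (fun z => hasSum_increment_symbol ρ s y ht ht' (z 0) (z 1))
  refine ⟨m, ?_⟩
  filter_upwards [h] with ω hω
  rw [← hω.tsum_eq, incrField]
  refine tsum_congr fun k => ?_
  rw [heatCoef]; ring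

/-- The kernel is bounded by the product of the heat increment, the localized exponential and the
noise weight. The factor `1+y²` uses up exactly the spatial decay, and the support condition on `θ`
yields `N^(-ς)`. -/
theorem eLpNorm_incrField_le [IsProbabilityMeasure P] (hW : IsWhiteNoise W P) (hθ : IsFreqCutoff θ Λ) (h₀ : H₀ < 1) (h₁ : H₁ < 1)
    (ρ : Cut) {α a ε ς D N : ℝ} (hD0 : 0 ≤ D) (hD : ∀ η y : ℝ,
      (1 + y ^ 2) * ‖schwartzBessel (-α) (ρ.exp (Complex.I * η)) y‖ ≤ D * bracket (-α / 2) η)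
    (hε0 : 0 ≤ ε) (hε1 : ε ≤ 1) (hς : 0 ≤ ς) (ha : 0 ≤ a) (haβ : a ≤ 2 - 2 * ε - ς)
    (hN : 0 < N) (hθN : ∀ z, θ z ≠ 0 → N ^ 2 ≤ 1 + |z 0| + z 1 ^ 2) {q : ℝ≥0∞} (hq : 1 ≤ q)
    {t t' : ℝ} (ht' : 0 ≤ t') (htt : t' ≤ t) (ht : t ≤ 1) (y : ℝ) :
    eLpNorm (fun ω => ((1 + y ^ 2 : ℝ) : ℂ) * incrField ρ (-α) (coef W H₀ H₁ θ ω) t t' y) q P ≤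
      2 * gaussMoment q * (ENNReal.ofReal (10 * D * N ^ (-ς) * (t - t') ^ ε) *
        eLpNorm (majorant H₀ H₁ a (2 - 2 * ε - ς - a + α)) 2 volume) := by
  obtain ⟨m, h⟩ := ae_incrField_eq hW hθ h₀ h₁ ρ (-α) y (t := t) (t' := t')
    ⟨ht'.trans htt, ht⟩ ⟨ht', htt.trans ht⟩
  set f := fun z : Plane => θ z * noiseWeight H₀ H₁ z *
        ((heatSymbol t (z 0) (z 1) - heatSymbol t' (z 0) (z 1)) *
          schwartzBessel (-α) (ρ.exp (Complex.I * z 1)) y) with hf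
  have e : (fun ω => ((1 + y ^ 2 : ℝ) : ℂ) * incrField ρ (-α) (coef W H₀ H₁ θ ω) t t' y) =ᵐ[P]
      integralHat W (fun z => ((1 + y ^ 2 : ℝ) : ℂ) * f z) := by
    filter_upwards [h, integralHat_const_mul hW m ((1 + y ^ 2 : ℝ) : ℂ)] with ω h1 h2
    rw [h1, h2]
  rw [eLpNorm_congr_ae e]
  refine (eLpNorm_integralHat_le hW (m.const_mul _) hq).trans ?_
  gcongr
  have htt0 : 0 ≤ t - t' := sub_nonneg.2 htt
  refine eLpNorm_le_of_bound (by positivity) ?_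
  -- The symbol bound was obtained by dividing by `iξ + η²`; the line `ξ = 0` is excluded as a null
  -- set.
  have hz0 : ∀ᵐ z : Plane, z 0 ≠ 0 := by
    have h0 := Measure.addHaar_submodule (volume : Measure Plane)
      (LinearMap.ker (EuclideanSpace.proj (𝕜 := ℝ) (0 : Fin 2) : Plane →L[ℝ] ℝ).toLinearMap) ?_
    · exact compl_mem_ae_iff.2 h0
    · intro htop
      have := htop.ge (Submodule.mem_top (x := (EuclideanSpace.single 0 1 : Plane)))
      simp at this
  filter_upwards [hz0] with z hz0
  by_cases hz : θ z = 0
  · simp only [hf, hz, Complex.ofReal_zero, zero_mul, mul_zero, norm_zero]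
    exact mul_nonneg (by positivity) (majorant_nonneg _ _ _ _ _)
  have b1 := norm_heatSymbol_sub_le ht' htt ht hz0 (z 1) hε0 hε1
  have b2 := hD (z 1) y
  have b3 := rpow_weight_le (α := α) ha rfl haβ hς hN (abs_nonneg (z 0)) (sq_nonneg (z 1)) (hθN z hz)
  have b4 := hθ.abs_le z
  rw [norm_mul, hf, norm_mul, norm_mul, norm_mul, Complex.norm_real, Complex.norm_real,
    Real.norm_of_nonneg (by positivity : 0 ≤ 1 + y ^ 2), Real.norm_eq_abs]
  calc (1 + y ^ 2) * (|θ z| * ‖noiseWeight H₀ H₁ z‖ *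
        (‖heatSymbol t (z 0) (z 1) - heatSymbol t' (z 0) (z 1)‖ *
          ‖schwartzBessel (-α) (ρ.exp (Complex.I * z 1)) y‖))
      = |θ z| * ‖noiseWeight H₀ H₁ z‖ * (‖heatSymbol t (z 0) (z 1) - heatSymbol t' (z 0) (z 1)‖ *
          ((1 + y ^ 2) * ‖schwartzBessel (-α) (ρ.exp (Complex.I * z 1)) y‖)) := by ring
    _ ≤ 1 * ‖noiseWeight H₀ H₁ z‖ * ((10 * ((t - t') ^ ε * (1 + |z 0| + z 1 ^ 2) ^ (-(1 - ε)))) *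
          (D * bracket (-α / 2) (z 1))) := by
        gcongr
    _ = 10 * D * (t - t') ^ ε * ‖noiseWeight H₀ H₁ z‖ * ((1 + |z 0| + z 1 ^ 2) ^ (-(1 - ε)) *
          (1 + z 1 ^ 2) ^ (-α / 2)) := by rw [bracket]; ring
    _ ≤ 10 * D * (t - t') ^ ε * ‖noiseWeight H₀ H₁ z‖ * (N ^ (-ς) * ((1 + |z 0|) ^ (-a / 2) *
          (1 + z 1 ^ 2) ^ (-(2 - 2 * ε - ς - a + α) / 2))) := by
        gcongr
    _ = _ := by rw [majorant]; ring

theorem eLpNorm_natCast_pow {X E : Type*} [MeasurableSpace X] [NormedAddCommGroup E] {μ : Measure X}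
    {f : X → E} {q : ℕ} (hq : q ≠ 0) : eLpNorm f q μ ^ q = ∫⁻ x, ‖f x‖ₑ ^ q ∂μ := by
  have := eLpNorm_nnreal_pow_eq_lintegral (μ := μ) (f := f) (p := (q : NNReal)) (by exact_mod_cast hq)
  simpa using this

theorem aemeasurable_incrField (hW : IsWhiteNoise W P) (hθ : IsFreqCutoff θ Λ) (h₀ : H₀ < 1)
    (h₁ : H₁ < 1) (ρ : Cut) (s : ℝ) {t t' : ℝ} (ht : t ∈ Icc (0 : ℝ) 1) (ht' : t' ∈ Icc (0 : ℝ) 1) :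
    AEMeasurable (fun z : Ω × ℝ => incrField ρ s (coef W H₀ H₁ θ z.1) t t' z.2)
      (P.prod cauchyWeight) := by
  refine aemeasurable_of_tendsto_metrizable_ae (atTop : Filter (Finset (ℕ × ℕ × ℕ)))
    (f := fun S z => ∑ k ∈ S, (heatCoef (coef W H₀ H₁ θ z.1) k *
      (simplexCoef k.1 k.2.1 t - simplexCoef k.1 k.2.1 t' : ℝ)) *
        schwartzBessel s (ρ.mono k.2.2) z.2) (fun S => ?_) ?_
  · refine Finset.aemeasurable_fun_sum S fun k _ => ?_
    refine AEMeasurable.mul (AEMeasurable.mul_const ?_ _) ?_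
    · exact (aemeasurable_coef hW _ _).comp_quasiMeasurePreserving Measure.quasiMeasurePreserving_fst
    · exact ((schwartzBessel s (ρ.mono k.2.2)).continuous.measurable.comp measurable_snd).aemeasurable
  · have := hθ.one_le
    filter_upwards [Measure.quasiMeasurePreserving_fst.ae (ae_norm_coef_le hW hθ h₀ h₁)] with z ⟨C, hC⟩
    exact (summable_increment ρ (besselEval s z.2) hC (by positivity) ht ht').of_norm.hasSum

/-- After `hC₁`, Tonelli's theorem puts the expectation inside; the bound at each `y` is uniform and
the weight has finite mass. -/
theorem lintegral_increment_le [IsProbabilityMeasure P] (hW : IsWhiteNoise W P) (hθ : IsFreqCutoff θ Λ) (h₀ : H₀ < 1)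
    (h₁ : H₁ < 1) (ρ : Cut) (s : ℝ) {r : ℝ≥0∞} [Fact (1 ≤ r)] {q : ℕ} (hq : q ≠ 0) {C₁ K : ℝ≥0∞}
    (hC₁ : ∀ F : ℝ → ℂ, AEStronglyMeasurable F volume → eLpNorm F r volume ^ q ≤
        C₁ * ∫⁻ y, ‖((1 + y ^ 2 : ℝ) : ℂ) * F y‖ₑ ^ q ∂cauchyWeight) (t t' : I)
    (hK : ∀ y : ℝ, eLpNorm (fun ω => ((1 + y ^ 2 : ℝ) : ℂ) *
      incrField ρ s (coef W H₀ H₁ θ ω) t t' y) q P ≤ K) :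
    ∫⁻ ω, ‖cutPath W H₀ H₁ ρ s r θ ω t - cutPath W H₀ H₁ ρ s r θ ω t'‖ₑ ^ q ∂P ≤
      C₁ * (cauchyWeight univ * K ^ q) := by
  have hΛ := hθ.one_le
  have hm : AEMeasurable (fun z : Ω × ℝ => ‖((1 + z.2 ^ 2 : ℝ) : ℂ) *
      incrField ρ s (coef W H₀ H₁ θ z.1) t t' z.2‖ₑ ^ q) (P.prod cauchyWeight) := by
    have := aemeasurable_incrField hW hθ h₀ h₁ ρ s t.2 t'.2
    fun_prop
  calc _ ≤ ∫⁻ ω, C₁ * ∫⁻ y, ‖((1 + y ^ 2 : ℝ) : ℂ) *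
        incrField ρ s (coef W H₀ H₁ θ ω) t t' y‖ₑ ^ q ∂cauchyWeight ∂P := by
        refine lintegral_mono_ae ?_
        filter_upwards [ae_norm_coef_le hW hθ h₀ h₁] with ω ⟨C, hC⟩
        have h1 := toLp_increment_ae ρ s r hC (by positivity) t t'
        have h2 : ‖cutPath W H₀ H₁ ρ s r θ ω t - cutPath W H₀ H₁ ρ s r θ ω t'‖ₑ =
            eLpNorm (incrField ρ s (coef W H₀ H₁ θ ω) t t') r volume := by
          rw [← eLpNorm_congr_ae h1, ← Lp.enorm_def, ← ofReal_norm, ← ofReal_norm]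
          rfl
        rw [h2]
        exact hC₁ _ ((Lp.aestronglyMeasurable _).congr h1)
    _ = C₁ * ∫⁻ y, ∫⁻ ω, ‖((1 + y ^ 2 : ℝ) : ℂ) *
        incrField ρ s (coef W H₀ H₁ θ ω) t t' y‖ₑ ^ q ∂P ∂cauchyWeight := by
        rw [lintegral_const_mul'' _ hm.lintegral_prod_right', lintegral_lintegral_swap hm]
    _ ≤ C₁ * ∫⁻ y, K ^ q ∂cauchyWeight := by
        gcongr with y
        rw [← eLpNorm_natCast_pow hq]
        gcongr
        exact hK y
    _ = _ := by rw [lintegral_const, mul_comm (K ^ q)]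

/-- Uniform moment bound for the paths associated with high frequencies. -/
theorem exists_eLpNorm_cutPath_le [IsProbabilityMeasure P] (hW : IsWhiteNoise W P) (h₀ : H₀ < 1) (h₁ : H₁ < 1) (ρ : Cut)
    {α ς : ℝ} (hα : 0 ≤ α) (hς : 0 ≤ ς) (hς₀ : ς < 2 * H₀) (hςα : ς < α - (1 - (2 * H₀ + H₁)))
    {r : ℝ≥0∞} [Fact (1 ≤ r)] (hr : r ≠ ∞) :
    ∃ K : ℝ≥0∞, K ≠ ∞ ∧ ∀ (θ : Plane → ℝ) (Λ N : ℝ), IsFreqCutoff θ Λ → 0 < N →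
      (∀ z, θ z ≠ 0 → N ^ 2 ≤ 1 + |z 0| + z 1 ^ 2) →
      eLpNorm (cutPath W H₀ H₁ ρ (-α) r θ) r P ≤ K * ENNReal.ofReal (N ^ (-ς)) := by
  -- `δ` is the time regularity. It costs `2δ` of heat decay, and a further `δ` makes `a > 2 - 2H₀`
  -- strict. The third condition then gives `a ≤ 2 - 2δ - ς`, the fourth gives `b > 1 - H₁` in the
  -- majorant.
  obtain ⟨δ, hδ0, hδ1, hδ2, hδ3⟩ : ∃ δ : ℝ, 0 < δ ∧ δ ≤ 1 ∧ 3 * δ + ς < 2 * H₀ ∧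
      3 * δ + ς < α - (1 - (2 * H₀ + H₁)) := by
    refine ⟨min 1 (min ((2 * H₀ - ς) / 4) ((α - (1 - (2 * H₀ + H₁)) - ς) / 4)), ?_, min_le_left _ _, ?_, ?_⟩
    · exact lt_min one_pos (lt_min (by linarith) (by linarith))
    · have := (min_le_right (1 : ℝ) _).trans (min_le_left ((2 * H₀ - ς) / 4)
        ((α - (1 - (2 * H₀ + H₁)) - ς) / 4))
      linarith
    · have := (min_le_right (1 : ℝ) _).trans (min_le_right ((2 * H₀ - ς) / 4)
        ((α - (1 - (2 * H₀ + H₁)) - ς) / 4))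
      linarith
  set a : ℝ := 2 - 2 * H₀ + δ with ha
  obtain ⟨D, hD0, hD⟩ := ρ.norm_schwartzBessel_exp_le hα
  have hr1 : 1 ≤ r := Fact.out
  -- An integer moment above `r`, high enough for Kolmogorov's condition `δ q > 1`.
  obtain ⟨q, hqr, hqδ⟩ : ∃ q : ℕ, r ≤ q ∧ 1 < δ * q := by
    obtain ⟨q, hq⟩ := exists_nat_gt (max r.toReal (1 / δ))
    refine ⟨q, ?_, ?_⟩
    · rw [← ENNReal.ofReal_toReal hr, ← ENNReal.ofReal_natCast]
      exact ENNReal.ofReal_le_ofReal ((le_max_left _ _).trans hq.le)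
    · have := (le_max_right r.toReal (1 / δ)).trans_lt hq
      rwa [div_lt_iff₀ hδ0, mul_comm] at this
  have hq1 : (1 : ℝ≥0∞) ≤ q := hr1.trans hqr
  have hq0 : q ≠ 0 := by rintro rfl; simp at hq1
  obtain ⟨C₁, hC₁, hC₁'⟩ := eLpNorm_pow_le_cauchyWeight hr1 hr hqr
  obtain ⟨C₂, hC₂, hC₂'⟩ := lintegral_norm_pow_le_of_increments (P := P) (E := BesselSpace (-α) r)
    hq0 hqδ
  have hM := memLp_majorant (a := a) (b := 2 - 2 * δ - ς - a + α) h₀ h₁ (by linarith) (by linarith)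
  set M := eLpNorm (majorant H₀ H₁ a (2 - 2 * δ - ς - a + α)) 2 volume
  set K₀ : ℝ≥0∞ := 2 * gaussMoment q * (ENNReal.ofReal (10 * D) * M) with hK₀
  have hK₀t : K₀ ≠ ∞ := ENNReal.mul_ne_top (ENNReal.mul_ne_top (by simp)
    (gaussMoment_ne_top (by simp))) (ENNReal.mul_ne_top ENNReal.ofReal_ne_top hM.2.ne)
  set K₁ := C₂ * (C₁ * (cauchyWeight univ * K₀ ^ q))
  have hK₁ : K₁ ≠ ∞ := ENNReal.mul_ne_top hC₂ (ENNReal.mul_ne_top hC₁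
    (ENNReal.mul_ne_top (measure_ne_top _ _) (ENNReal.pow_ne_top hK₀t)))
  have hq0' : (q : ℝ) ≠ 0 := by exact_mod_cast hq0
  refine ⟨K₁ ^ (1 / (q : ℝ)), ENNReal.rpow_ne_top_of_nonneg (by positivity) hK₁, ?_⟩
  intro θ Λ N hθ hN hθN
  have hmeas := aestronglyMeasurable_cutPath hW hθ h₀ h₁ ρ (-α) r
  refine (eLpNorm_le_eLpNorm_of_exponent_le hqr hmeas).trans ?_
  have key := hC₂' (cutPath W H₀ H₁ ρ (-α) r θ) hmeas ?_
    (C₁ * (cauchyWeight univ * K₀ ^ q) * ENNReal.ofReal (N ^ (-ς)) ^ q) ?_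
  · rw [← eLpNorm_natCast_pow hq0] at key
    have h1 : eLpNorm (cutPath W H₀ H₁ ρ (-α) r θ) q P ^ q ≤
        (K₁ ^ (1 / (q : ℝ)) * ENNReal.ofReal (N ^ (-ς))) ^ q := by
      refine key.trans (le_of_eq ?_)
      rw [mul_pow (K₁ ^ (1 / (q : ℝ))), ← ENNReal.rpow_natCast (K₁ ^ (1 / (q : ℝ))), ← ENNReal.rpow_mul,
        one_div_mul_cancel hq0', ENNReal.rpow_one, ← mul_assoc]
    exact (ENNReal.pow_le_pow_left_iff hq0).1 h1
  · have := hθ.one_le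
    filter_upwards [ae_norm_coef_le hW hθ h₀ h₁] with ω ⟨C, hC⟩
    exact pathSeries_zero_apply ρ (-α) r hC (by positivity)
  · intro t' t htt
    have htt' : (t' : ℝ) ≤ t := htt
    have hnn : (0 : ℝ) ≤ t - t' := sub_nonneg.2 htt'
    refine (lintegral_increment_le hW hθ h₀ h₁ ρ (-α) hq0 hC₁' t t' (fun y =>
      eLpNorm_incrField_le hW hθ h₀ h₁ ρ (a := a) (ε := δ) (ς := ς) hD0 hD hδ0.le hδ1 hς
        (by linarith) (by linarith) hN hθN hq1 t'.2.1 htt t.2.2 y)).trans (le_of_eq ?_)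
    rw [ENNReal.ofReal_mul (by positivity), ENNReal.ofReal_mul (by positivity),
      Real.rpow_mul hnn, Real.rpow_natCast, ENNReal.ofReal_pow (by positivity), hK₀]
    ring

end MainEstimate

/-! ### Hermitian kernels have real Wiener integrals -/

section Hermitian

/-- The involution `f ↦ conj f(-·)` of `L²`. -/
def reflConj (f : Lp ℂ 2 (volume : Measure Plane)) : Lp ℂ 2 (volume : Measure Plane) :=
  (Complex.conjCLE : ℂ →L[ℝ] ℂ).compLpL 2 volume
    (Lp.compMeasurePreserving Neg.neg (Measure.measurePreserving_neg volume) f)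

theorem continuous_reflConj : Continuous reflConj :=
  (ContinuousLinearMap.continuous _).comp
    (Lp.isometry_compMeasurePreserving (Measure.measurePreserving_neg volume)).continuous

theorem coeFn_reflConj (f : Lp ℂ 2 (volume : Measure Plane)) :
    reflConj f =ᵐ[volume] fun z => (starRingEnd ℂ) (f (-z)) := by
  filter_upwards [(Complex.conjCLE : ℂ →L[ℝ] ℂ).coeFn_compLpL (p := 2) (μ := volume)
    (Lp.compMeasurePreserving Neg.neg (Measure.measurePreserving_neg volume) f),
    Lp.coeFn_compMeasurePreserving f (Measure.measurePreserving_neg (volume : Measure Plane))]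
    with z h1 h2
  rw [reflConj, h1, h2]
  rfl

/-- The involution `f ↦ conj f(-·)` of the Schwartz space. -/
def schwartzReflConj (f : 𝓢(Plane, ℂ)) : 𝓢(Plane, ℂ) :=
  (SchwartzMap.compCLMOfContinuousLinearEquiv ℝ (ContinuousLinearEquiv.neg ℝ) f).postcompCLM
    (Complex.conjCLE : ℂ →L[ℝ] ℂ)

theorem schwartzReflConj_apply (f : 𝓢(Plane, ℂ)) (z : Plane) :
    schwartzReflConj f z = (starRingEnd ℂ) (f (-z)) := rfl

theorem fourier_schwartzReflConj (f : 𝓢(Plane, ℂ)) (w : Plane) :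
    𝓕 (schwartzReflConj f) w = (starRingEnd ℂ) (𝓕 f w) := by
  rw [SchwartzMap.fourier_coe, SchwartzMap.fourier_coe, Real.fourier_eq', Real.fourier_eq',
    ← integral_conj, ← integral_neg_eq_self]
  refine integral_congr_ae (Eventually.of_forall fun v => ?_)
  simp only [schwartzReflConj_apply, neg_neg, smul_eq_mul, map_mul, ← Complex.exp_conj,
    Complex.conj_ofReal, Complex.conj_I, inner_neg_left]
  congr 2
  push_cast
  ring

/-- Both sides are continuous on `L²` and agree on Schwartz functions, where the Fourier integral
can be computed. -/
theorem fourier_reflConj (f : Lp ℂ 2 (volume : Measure Plane)) :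
    𝓕 (reflConj f) = (Complex.conjCLE : ℂ →L[ℝ] ℂ).compLpL 2 volume (𝓕 f) := by
  have hd : DenseRange (SchwartzMap.toLpCLM ℝ ℂ 2 (volume : Measure Plane)) :=
    SchwartzMap.denseRange_toLpCLM (by simp)
  have hc : Continuous (𝓕 : Lp ℂ 2 (volume : Measure Plane) → Lp ℂ 2 (volume : Measure Plane)) :=
    FourierTransform.continuous_fourier
  refine congrFun (hd.equalizer (hc.comp continuous_reflConj)
    ((ContinuousLinearMap.continuous _).comp hc) (funext fun g => ?_)) f
  simp only [Function.comp, SchwartzMap.toLpCLM_apply]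
  have e : reflConj (g.toLp 2) = (schwartzReflConj g).toLp 2 := by
    apply Lp.ext
    have h1 := SchwartzMap.coeFn_toLp g 2 (volume : Measure Plane)
    have h2 := (Measure.measurePreserving_neg (volume : Measure Plane)).quasiMeasurePreserving.ae h1
    filter_upwards [coeFn_reflConj (g.toLp 2), SchwartzMap.coeFn_toLp (schwartzReflConj g) 2 volume, h2]
      with z h3 h4 h5
    rw [h3, h4, h5, schwartzReflConj_apply]
  rw [e, SchwartzMap.toLp_fourier_eq, SchwartzMap.toLp_fourier_eq]
  apply Lp.ext
  filter_upwards [(Complex.conjCLE : ℂ →L[ℝ] ℂ).coeFn_compLpL (p := 2) (μ := volume) ((𝓕 g).toLp 2),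
    SchwartzMap.coeFn_toLp (𝓕 g) 2 (volume : Measure Plane),
    SchwartzMap.coeFn_toLp (𝓕 (schwartzReflConj g)) 2 (volume : Measure Plane)] with z h1 h2 h3
  rw [h1, h2, h3, fourier_schwartzReflConj]
  rfl

theorem im_fourier_eq_zero {f : Plane → ℂ} (hf : MemLp f 2 volume)
    (h : ∀ z, f (-z) = (starRingEnd ℂ) (f z)) :
    Complex.imCLM.compLp (𝓕 (hf.toLp f : Lp ℂ 2 (volume : Measure Plane))) = 0 := by
  have e : reflConj (hf.toLp f) = hf.toLp f := by
    apply Lp.ext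
    have h1 := MemLp.coeFn_toLp hf
    have h2 := (Measure.measurePreserving_neg (volume : Measure Plane)).quasiMeasurePreserving.ae h1
    filter_upwards [coeFn_reflConj (hf.toLp f), h1, h2] with z h3 h4 h5
    rw [h3, h4, h5, h, Complex.conj_conj]
  have h1 := fourier_reflConj (hf.toLp f)
  rw [e] at h1
  have h2 := (Complex.conjCLE : ℂ →L[ℝ] ℂ).coeFn_compLpL (p := 2) (μ := volume) (𝓕 (hf.toLp f))
  rw [← h1] at h2
  apply Lp.ext
  filter_upwards [h2, Complex.imCLM.coeFn_compLp (𝓕 (hf.toLp f)), Lp.coeFn_zero ℝ 2 volume]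
    with z h3 h4 h5
  rw [h4, h5]
  have := congrArg Complex.im h3
  simp at this
  simp only [Complex.imCLM_apply, Pi.zero_apply]
  linarith

variable {Ω : Type*} [MeasurableSpace Ω] {P : Measure Ω}
  {W : Lp ℝ 2 (volume : Measure Plane) → Ω → ℝ}

theorem ae_im_integralHat_eq_zero (hW : IsWhiteNoise W P) {f : Plane → ℂ} (hf : MemLp f 2 volume)
    (h : ∀ z, f (-z) = (starRingEnd ℂ) (f z)) : ∀ᵐ ω ∂P, (integralHat W f ω).im = 0 := by
  -- With all arguments zero this says that `W 0` vanishes almost surely.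
  filter_upwards [hW.ae_linear 0 0 0 0 0 (by simp)] with ω hω
  rw [integralHat_of_memLp hf, im_fourier_eq_zero hf h, hω]
  simp

theorem sheetKernel_neg (H₀ H₁ κ : ℝ) (n : ℕ) (t x : ℝ) (z : Plane) :
    sheetKernel H₀ H₁ κ n t x (-z) = (starRingEnd ℂ) (sheetKernel H₀ H₁ κ n t x z) := by
  have hk : ∀ H t ξ : ℝ, harmKernel H t (-ξ) = (starRingEnd ℂ) (harmKernel H t ξ) := by
    intro H t ξ
    simp only [harmKernel, abs_neg, map_div₀, map_sub, map_one, ← Complex.exp_conj, map_mul,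
      Complex.conj_I, Complex.conj_ofReal, Complex.ofReal_neg, mul_neg, neg_mul]
  have hm : -z ∈ freqDomain κ n ↔ z ∈ freqDomain κ n := by
    simp [freqDomain]
  by_cases hz : z ∈ freqDomain κ n
  · rw [sheetKernel, indicator_of_mem (hm.2 hz), indicator_of_mem hz]
    simp [hk]
  · rw [sheetKernel, indicator_of_notMem (fun h => hz (hm.1 h)), indicator_of_notMem hz]
    simp

end Hermitian

/-! ### The truncated sheet and its heat convolution -/

section SheetHeat

variable {Ω : Type*} [MeasurableSpace Ω] {P : Measure Ω}
  {W : Lp ℝ 2 (volume : Measure Plane) → Ω → ℝ} {H₀ H₁ κ : ℝ} {n : ℕ}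

/-- The series of real parts is itself the smooth version. Hermitian symmetry of the kernel shows
that the complex Wiener integral has no imaginary part to be lost. -/
theorem exists_isTruncatedSheet (hW : IsWhiteNoise W P) (hκ : 0 < κ) (h₀ : H₀ < 1) (h₁ : H₁ < 1)
    (n : ℕ) : ∃ B, IsTruncatedSheet W P H₀ H₁ κ n B := by
  have hθ := isFreqCutoff_freqCut hκ n
  have hΛ := hθ.one_le
  have hg := ae_norm_coef_le hW hθ h₀ h₁
  set Λ := (2 : ℝ) ^ (2 * κ * n)
  have g1 : ∀ {ω C}, (∀ j k, ‖coef W H₀ H₁ (freqCut κ n) ω j k‖ ≤ C * (2 * Λ) ^ (j + k)) →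
      GeomBound (padSeq fun j k => (coef W H₀ H₁ (freqCut κ n) ω j k).re) C (2 * Λ) := fun hC =>
    GeomBound.pad (fun j k => (Complex.abs_re_le_norm _).trans (hC j k)) (by linarith)
  refine ⟨fun t x ω => dser (padSeq fun j k => (coef W H₀ H₁ (freqCut κ n) ω j k).re) t x,
    fun t x => ?_, ?_⟩
  · obtain ⟨m, hs⟩ := ae_hasSum_sheet (n := n) hW hκ h₀ h₁ t x
    filter_upwards [hs, hg, ae_im_integralHat_eq_zero hW m (sheetKernel_neg H₀ H₁ κ n t x)]
      with ω h1 ⟨C, hC⟩ h3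
    apply Complex.ext
    · have h2 := Complex.hasSum_re h1
      have h4 := (g1 hC).hasSum (by linarith) t x
      rw [hasSum_padSeq_iff] at h4
      refine (h2.unique (hasSum_of_eq h4 fun k => ?_)).symm
      rw [Complex.re_ofReal_mul, mul_comm]
    · rw [h3, Complex.ofReal_im]
  · filter_upwards [hg] with ω ⟨C, hC⟩
    exact (g1 hC).contDiff_dser (by linarith)

theorem ae_mixedDeriv_sheet (hW : IsWhiteNoise W P) (hκ : 0 < κ) (h₀ : H₀ < 1) (h₁ : H₁ < 1)
    {B : ℝ → ℝ → Ω → ℝ} (hB : IsTruncatedSheet W P H₀ H₁ κ n B) :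
    ∀ᵐ ω ∂P, (∃ C : ℝ, ∀ j k, ‖coef W H₀ H₁ (freqCut κ n) ω j k‖ ≤
        C * (2 * (2 : ℝ) ^ (2 * κ * n)) ^ (j + k)) ∧
      (∀ s y, mixedDeriv (fun t x => B t x ω) s y =
        dser (fun j k => (coef W H₀ H₁ (freqCut κ n) ω j k).re) s y) ∧
      ∀ s y, mixedDeriv (fun _ _ => 0) s y =
        dser (fun j k => (coef W H₀ H₁ (freqCut κ n) ω j k).im) s y := by
  have hΛ := (isFreqCutoff_freqCut hκ n).one_le
  filter_upwards [ae_sheet_eq_dser hW hκ h₀ h₁ hB] with ω ⟨⟨C, hC⟩, hre, him⟩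
  refine ⟨⟨C, hC⟩, fun s y => ?_, fun s y => ?_⟩
  · rw [funext fun t => funext fun x => hre t x]
    exact (GeomBound.pad (fun j k => (Complex.abs_re_le_norm _).trans (hC j k))
      (by linarith)).mixedDeriv_dser (by linarith) s y
  · rw [funext fun t => funext fun x => him t x]
    exact (GeomBound.pad (fun j k => (Complex.abs_im_le_norm _).trans (hC j k))
      (by linarith)).mixedDeriv_dser (by linarith) s y

theorem ae_heatSol_wellDefined (hW : IsWhiteNoise W P) (hκ : 0 < κ) (h₀ : H₀ < 1) (h₁ : H₁ < 1)
    {B : ℝ → ℝ → Ω → ℝ} (hB : IsTruncatedSheet W P H₀ H₁ κ n B) :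
    ∀ᵐ ω ∂P, ∀ t ∈ Icc (0 : ℝ) 1,
      (∀ x : ℝ, IntegrableOn (fun z : ℝ × ℝ => heatKernel (t - z.1) (x - z.2) *
        mixedDeriv (fun s y => B s y ω) z.1 z.2) (Ioc 0 t ×ˢ univ)) ∧
      Continuous fun x => heatSol (fun s y => B s y ω) t x := by
  have hΛ := (isFreqCutoff_freqCut hκ n).one_le
  filter_upwards [ae_mixedDeriv_sheet hW hκ h₀ h₁ hB] with ω ⟨⟨C, hC⟩, hre, him⟩ t ht
  have g : GeomBound (fun j k => (coef W H₀ H₁ (freqCut κ n) ω j k).re) C _ := fun j k =>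
    (Complex.abs_re_le_norm _).trans (hC j k)
  exact ⟨fun x => g.integrableOn_heat (by linarith) hre ht x,
    g.continuous_heatSol (by linarith) hre ht⟩

/-- The path has complex coefficients. Their real parts sum to the heat convolution of the sheet;
their imaginary parts represent the zero field, whose heat convolution is zero. -/
theorem ae_toDist_cutPath (hW : IsWhiteNoise W P) (hκ : 0 < κ) (h₀ : H₀ < 1) (h₁ : H₁ < 1)
    {B : ℝ → ℝ → Ω → ℝ} (hB : IsTruncatedSheet W P H₀ H₁ κ n B) (ρ : Cut) (s : ℝ) (r : ℝ≥0∞)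
    [Fact (1 ≤ r)] :
    ∀ᵐ ω ∂P, ∀ t : I, (cutPath W H₀ H₁ ρ s r (freqCut κ n) ω t).toDist =
      localSol ρ.toFun (fun s y => B s y ω) t := by
  have hΛ := (isFreqCutoff_freqCut hκ n).one_le
  filter_upwards [ae_mixedDeriv_sheet hW hκ h₀ h₁ hB] with ω ⟨⟨C, hC⟩, hre, him⟩ t
  refine toDist_pathSeries ρ s r hC (by linarith) t fun x => ?_
  have h1 := GeomBound.hasSum_heatSol (fun j k => (Complex.abs_re_le_norm _).trans (hC j k))
    (by linarith) hre t.2 x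
  have h2 := GeomBound.hasSum_heatSol (fun j k => (Complex.abs_im_le_norm _).trans (hC j k))
    (by linarith) him t.2 x
  have h0 : heatSol (fun _ _ => 0) t x = 0 := by simp [heatSol, mixedDeriv]
  rw [h0] at h2
  rw [Complex.hasSum_iff]
  have e : ∀ k : ℕ × ℕ × ℕ, heatCoef (coef W H₀ H₁ (freqCut κ n) ω) k * simplexCoef k.1 k.2.1 t *
      ((x : ℂ) ^ k.2.2 / (k.2.2.factorial : ℂ)) =
      ((simplexCoef k.1 k.2.1 t * (x ^ k.2.2 / k.2.2.factorial) : ℝ) : ℂ) *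
        coef W H₀ H₁ (freqCut κ n) ω k.1 (k.2.2 + 2 * k.2.1) := by
    intro k
    rw [heatCoef]; push_cast; ring
  simp_rw [e]
  constructor
  · refine hasSum_of_eq h1 fun k => ?_
    rw [Complex.re_ofReal_mul, mul_comm]
  · refine hasSum_of_eq h2 fun k => ?_
    rw [Complex.im_ofReal_mul, mul_comm]

end SheetHeat

/-! ### The limit of the paths -/

section Limit

variable {Ω : Type*} [MeasurableSpace Ω] {P : Measure Ω}
  {W : Lp ℝ 2 (volume : Measure Plane) → Ω → ℝ} {H₀ H₁ : ℝ}

theorem IsFreqCutoff.sub {θ θ' : Plane → ℝ} {Λ Λ' : ℝ} (h : IsFreqCutoff θ Λ) (h' : IsFreqCutoff θ' Λ')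
    (h01 : ∀ z, 0 ≤ θ z) (h01' : ∀ z, 0 ≤ θ' z) :
    IsFreqCutoff (fun z => θ z - θ' z) (max Λ Λ') where
  meas := h.meas.sub h'.meas
  one_le := h.one_le.trans (le_max_left _ _)
  abs_le z := by
    have h1 := (_root_.abs_le.1 (h.abs_le z)).2
    have h2 := (_root_.abs_le.1 (h'.abs_le z)).2
    rw [_root_.abs_le]
    constructor <;> linarith [h01 z, h01' z]
  supp z hz := by
    by_cases h0 : θ z = 0
    · have := h'.supp z (fun h1 => hz (by rw [h0, h1, sub_zero]))
      exact ⟨this.1.trans (le_max_right _ _), this.2.trans (le_max_right _ _)⟩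
    · have := h.supp z h0
      exact ⟨this.1.trans (le_max_left _ _), this.2.trans (le_max_left _ _)⟩

theorem freqCut_nonneg (κ : ℝ) (n : ℕ) (z : Plane) : 0 ≤ freqCut κ n z :=
  indicator_nonneg (fun _ _ => zero_le_one) z

/-- The box is parabolic: with `N = 2^(κn)` it allows time frequencies up to `N²` and space
frequencies up to `N`. -/
theorem sq_le_of_notMem_freqDomain {κ : ℝ} {n : ℕ} {z : Plane} (h : z ∉ freqDomain κ n) :
    ((2 : ℝ) ^ (κ * n)) ^ 2 ≤ 1 + |z 0| + z 1 ^ 2 := by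
  have e : ((2 : ℝ) ^ (κ * n)) ^ 2 = (2 : ℝ) ^ (2 * κ * n) := by
    rw [← Real.rpow_natCast, ← Real.rpow_mul zero_le_two]
    congr 1; push_cast; ring
  simp only [freqDomain, mem_ofPred_eq, not_and_or, not_le] at h
  rcases h with h | h
  · rw [e]; linarith [sq_nonneg (z 1)]
  · have : ((2 : ℝ) ^ (κ * n)) ^ 2 ≤ |z 1| ^ 2 := by gcongr
    rw [sq_abs] at this
    linarith [abs_nonneg (z 0)]

theorem sq_min_le_of_freqCut_sub_ne_zero {κ κ' : ℝ} {n n' : ℕ} {z : Plane}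
    (h : freqCut κ n z - freqCut κ' n' z ≠ 0) :
    (min ((2 : ℝ) ^ (κ * n)) ((2 : ℝ) ^ (κ' * n'))) ^ 2 ≤ 1 + |z 0| + z 1 ^ 2 := by
  by_cases h1 : z ∈ freqDomain κ n
  · by_cases h2 : z ∈ freqDomain κ' n'
    · exact absurd (by rw [freqCut, freqCut, indicator_of_mem h1, indicator_of_mem h2, sub_self]) h
    · refine le_trans ?_ (sq_le_of_notMem_freqDomain h2)
      gcongr
      exact min_le_right _ _
  · refine le_trans ?_ (sq_le_of_notMem_freqDomain h1)
    gcongr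
    exact min_le_left _ _

theorem ae_cutPath_sub (hW : IsWhiteNoise W P) {θ θ' : Plane → ℝ} {Λ Λ' : ℝ} (hθ : IsFreqCutoff θ Λ)
    (hθ' : IsFreqCutoff θ' Λ') (h₀ : H₀ < 1) (h₁ : H₁ < 1) (ρ : Cut) (s : ℝ) (r : ℝ≥0∞)
    [Fact (1 ≤ r)] : cutPath W H₀ H₁ ρ s r (fun z => θ z - θ' z) =ᵐ[P]
      fun ω => cutPath W H₀ H₁ ρ s r θ ω - cutPath W H₀ H₁ ρ s r θ' ω := by
  have h1 := hθ.one_le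
  have h2 := hθ'.one_le
  filter_upwards [ae_coef_sub hW hθ hθ' h₀ h₁, ae_norm_coef_le hW hθ h₀ h₁,
    ae_norm_coef_le hW hθ' h₀ h₁] with ω h ⟨C, hC⟩ ⟨C', hC'⟩
  rw [cutPath, cutPath, cutPath, ← pathSeries_sub ρ s r hC (by positivity) hC' (by positivity)]
  congr 1
  exact funext fun j => funext fun k => h j k

variable [IsProbabilityMeasure P] (ρ : Cut) {α : ℝ} {r : ℝ≥0∞} [Fact (1 ≤ r)]

/-- The difference of two cutoffs is again a cutoff, supported away from the low frequencies. `K`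
depends on neither `κ` nor `κ'`, so all approximation schemes can be compared with a single one. -/
theorem exists_eLpNorm_cutPath_sub_le (hW : IsWhiteNoise W P) (h₀ : H₀ < 1) (h₁ : H₁ < 1)
    {ς : ℝ} (hα : 0 ≤ α) (hς : 0 ≤ ς) (hς₀ : ς < 2 * H₀) (hςα : ς < α - (1 - (2 * H₀ + H₁)))
    (hr : r ≠ ∞) :
    ∃ K : ℝ≥0∞, K ≠ ∞ ∧ ∀ κ κ' : ℝ, 0 < κ → 0 < κ' → ∀ n n' : ℕ,
      eLpNorm (fun ω => cutPath W H₀ H₁ ρ (-α) r (freqCut κ n) ω -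
        cutPath W H₀ H₁ ρ (-α) r (freqCut κ' n') ω) r P ≤
        K * ENNReal.ofReal ((min ((2 : ℝ) ^ (κ * n)) ((2 : ℝ) ^ (κ' * n'))) ^ (-ς)) := by
  obtain ⟨K, hK, h⟩ := exists_eLpNorm_cutPath_le hW h₀ h₁ ρ hα hς hς₀ hςα hr
  refine ⟨K, hK, fun κ κ' hκ hκ' n n' => ?_⟩
  have hθ := isFreqCutoff_freqCut hκ n
  have hθ' := isFreqCutoff_freqCut hκ' n'
  rw [← eLpNorm_congr_ae (ae_cutPath_sub hW hθ hθ' h₀ h₁ ρ (-α) r)]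
  exact h _ _ _ (hθ.sub hθ' (freqCut_nonneg κ n) (freqCut_nonneg κ' n')) (by positivity)
    fun z hz => sq_min_le_of_freqCut_sub_ne_zero hz

theorem memLp_cutPath (hW : IsWhiteNoise W P) (hH₀ : H₀ ∈ Ioo (0 : ℝ) 1) (h₁ : H₁ < 1)
    (hα : 0 ≤ α) (hα₀ : 1 - (2 * H₀ + H₁) < α) (hr : r ≠ ∞) {κ : ℝ} (hκ : 0 < κ) (n : ℕ) :
    MemLp (cutPath W H₀ H₁ ρ (-α) r (freqCut κ n)) r P := by
  have hθ := isFreqCutoff_freqCut hκ n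
  -- With `ς = 0` and `N = 1` the support condition is void and the bound is plain finiteness.
  obtain ⟨K, hK, h⟩ := exists_eLpNorm_cutPath_le hW hH₀.2 h₁ ρ hα le_rfl (by linarith [hH₀.1])
    (by linarith) hr
  refine ⟨aestronglyMeasurable_cutPath hW hθ hH₀.2 h₁ ρ (-α) r,
    (h _ _ 1 hθ one_pos fun z _ => ?_).trans_lt (ENNReal.mul_lt_top hK.lt_top ENNReal.ofReal_lt_top)⟩
  nlinarith [abs_nonneg (z 0), sq_nonneg (z 1)]

/-- The paths converge, at the same rates and to the same limit for all `κ`. -/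
theorem exists_limit_cutPath (hW : IsWhiteNoise W P) (hH₀ : H₀ ∈ Ioo (0 : ℝ) 1) (h₁ : H₁ < 1)
    (hα : 0 ≤ α) (hα₀ : 1 - (2 * H₀ + H₁) < α) (hr : r ≠ ∞) :
    ∃ Y : Lp C(I, BesselSpace (-α) r) r P, ∀ ς : ℝ, 0 ≤ ς → ς < 2 * H₀ →
      ς < α - (1 - (2 * H₀ + H₁)) → ∃ K : ℝ≥0∞, K ≠ ∞ ∧ ∀ κ : ℝ, 0 < κ → ∀ n : ℕ,
        eLpNorm (fun ω => cutPath W H₀ H₁ ρ (-α) r (freqCut κ n) ω - Y ω) r P ≤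
          K * ENNReal.ofReal (((2 : ℝ) ^ (κ * n)) ^ (-ς)) := by
  -- The limit is built along `κ = 1`; every other `κ` is compared with this sequence below.
  have hm := fun n => memLp_cutPath ρ hW hH₀ h₁ hα hα₀ hr one_pos n
  set X : ℕ → Lp C(I, BesselSpace (-α) r) r P := fun n => (hm n).toLp _
  obtain ⟨Y, hY⟩ : ∃ Y, Tendsto X atTop (𝓝 Y) := by
    refine cauchySeq_tendsto_of_complete ?_
    obtain ⟨ς, hς0, hς1⟩ := exists_between (lt_min (mul_pos two_pos hH₀.1) (sub_pos.2 hα₀))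
    rw [lt_min_iff] at hς1
    obtain ⟨K, hK, h⟩ := exists_eLpNorm_cutPath_sub_le ρ hW hH₀.2 h₁ hα hς0.le hς1.1 hς1.2 hr
    refine cauchySeq_of_edist_le_geometric (ENNReal.ofReal ((2 : ℝ) ^ (-ς))) K ?_ hK fun n => ?_
    · rw [ENNReal.ofReal_lt_one]
      exact Real.rpow_lt_one_of_one_lt_of_neg one_lt_two (by linarith)
    · rw [Lp.edist_toLp_toLp]
      refine (h 1 1 one_pos one_pos n (n + 1)).trans (le_of_eq ?_)
      congr 1
      rw [min_eq_left (Real.rpow_le_rpow_of_exponent_le one_le_two (by push_cast; linarith)),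
        ← ENNReal.ofReal_pow (by positivity), ← Real.rpow_natCast, ← Real.rpow_mul zero_le_two,
        ← Real.rpow_mul zero_le_two]
      congr 2; ring
  refine ⟨Y, fun ς hς hς₀ hςα => ?_⟩
  obtain ⟨K, hK, h⟩ := exists_eLpNorm_cutPath_sub_le ρ hW hH₀.2 h₁ hα hς hς₀ hςα hr
  refine ⟨K, hK, fun κ hκ n => ?_⟩
  have hmn := memLp_cutPath ρ hW hH₀ h₁ hα hα₀ hr hκ n
  have hlim : Tendsto (fun m => K * ENNReal.ofReal (((2 : ℝ) ^ (κ * n)) ^ (-ς)) + edist (X m) Y) atTop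
      (𝓝 (K * ENNReal.ofReal (((2 : ℝ) ^ (κ * n)) ^ (-ς)) + 0)) :=
    tendsto_const_nhds.add (tendsto_iff_edist_tendsto_0.1 hY)
  rw [add_zero] at hlim
  -- For `m ≥ κ n` the minimum of `2^(κn)` and `2^m` is the former, so the comparison keeps the rate
  -- of the scheme `κ`.
  obtain ⟨m₀, hm₀⟩ := exists_nat_ge (κ * n)
  refine ge_of_tendsto hlim (eventually_atTop.2 ⟨m₀, fun m hmm => ?_⟩)
  have e1 : edist (hmn.toLp _) Y =
      eLpNorm (fun ω => cutPath W H₀ H₁ ρ (-α) r (freqCut κ n) ω - Y ω) r P := by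
    rw [Lp.edist_def]
    refine eLpNorm_congr_ae ?_
    filter_upwards [hmn.coeFn_toLp] with ω hω
    rw [Pi.sub_apply, hω]
  rw [← e1]
  refine (edist_triangle _ (X m) _).trans (add_le_add_left ?_ _)
  rw [Lp.edist_toLp_toLp]
  refine (h κ 1 hκ one_pos n m).trans (le_of_eq ?_)
  rw [min_eq_left (Real.rpow_le_rpow_of_exponent_le one_le_two ?_)]
  have : (m₀ : ℝ) ≤ m := by exact_mod_cast hmm
  linarith

/-- A Borel–Cantelli type statement: geometric decay of norms holds almost surely at any smaller
rate. -/
theorem ae_norm_le_of_eLpNorm_le {E : Type*} [NormedAddCommGroup E] {f : ℕ → Ω → E}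
    (hf : ∀ n, AEStronglyMeasurable (f n) P) {K q : ℝ≥0∞} (hq : 1 ≤ q) (hK : K ≠ ∞) {κ ς ς' : ℝ}
    (hκ : 0 < κ) (hς : ς < ς')
    (h : ∀ n : ℕ, eLpNorm (f n) q P ≤ K * ENNReal.ofReal (((2 : ℝ) ^ (κ * n)) ^ (-ς'))) :
    ∀ᵐ ω ∂P, ∃ C : ℝ, ∀ n : ℕ, ‖f n ω‖ ≤ C * (2 : ℝ) ^ (-(ς * κ * n)) := by
  -- The margin `ς' - ς` makes the expectation of `∑ 2^(ςκn) ‖f n‖` a convergent geometric series;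
  -- each term is then at most the almost surely finite sum.
  set a : ℝ := (2 : ℝ) ^ (-((ς' - ς) * κ))
  have ha0 : 0 ≤ a := by positivity
  have ha : a < 1 := Real.rpow_lt_one_of_one_lt_of_neg one_lt_two
    (neg_neg_of_pos (mul_pos (sub_pos.2 hς) hκ))
  have h1 : ∫⁻ ω, ∑' n : ℕ, ENNReal.ofReal ((2 : ℝ) ^ (ς * κ * n)) * ‖f n ω‖ₑ ∂P ≠ ∞ := by
    rw [lintegral_tsum (fun n => ((hf n).enorm.const_mul _))]
    have h2 : ∀ n : ℕ, ∫⁻ ω, ENNReal.ofReal ((2 : ℝ) ^ (ς * κ * n)) * ‖f n ω‖ₑ ∂P ≤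
        K * ENNReal.ofReal a ^ n := by
      intro n
      rw [lintegral_const_mul'' _ (hf n).enorm, ← eLpNorm_one_eq_lintegral_enorm]
      calc _ ≤ ENNReal.ofReal ((2 : ℝ) ^ (ς * κ * n)) *
            (K * ENNReal.ofReal (((2 : ℝ) ^ (κ * n)) ^ (-ς'))) := by
            gcongr
            exact (eLpNorm_le_eLpNorm_of_exponent_le hq (hf n)).trans (h n)
        _ = _ := by
            rw [mul_left_comm, ← ENNReal.ofReal_mul (by positivity), ← ENNReal.ofReal_pow ha0,
              ← Real.rpow_mul zero_le_two, ← Real.rpow_add two_pos, ← Real.rpow_natCast,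
              ← Real.rpow_mul zero_le_two]
            congr 3; ring
    refine ne_top_of_le_ne_top ?_ (ENNReal.tsum_le_tsum h2)
    rw [ENNReal.tsum_mul_left, ENNReal.tsum_geometric]
    refine ENNReal.mul_ne_top hK (ENNReal.inv_ne_top.2 ?_)
    rw [Ne, tsub_eq_zero_iff_le, not_le, ENNReal.ofReal_lt_one]
    exact ha
  filter_upwards [ae_lt_top' (AEMeasurable.tsum fun n => (hf n).enorm.const_mul _) h1]
    with ω hω
  refine ⟨(∑' n : ℕ, ENNReal.ofReal ((2 : ℝ) ^ (ς * κ * n)) * ‖f n ω‖ₑ).toReal, fun n => ?_⟩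
  have h3 := ENNReal.toReal_mono hω.ne (ENNReal.le_tsum n)
  rw [ENNReal.toReal_mul, ENNReal.toReal_ofReal (by positivity), toReal_enorm] at h3
  rw [Real.rpow_neg zero_le_two, ← div_eq_mul_inv, le_div_iff₀ (by positivity), mul_comm]
  exact h3

theorem besselENorm_toDist {s : ℝ} (f : BesselSpace s r) : besselENorm s r f.toDist = ‖f‖ₑ := by
  rw [besselENorm, dif_pos f.memSobolev]
  rfl

end Limit

/-! ### The limit process -/

section LimitProcess

variable {Ω : Type*} [MeasurableSpace Ω] {P : Measure Ω} [IsProbabilityMeasure P]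
  {W : Lp ℝ 2 (volume : Measure Plane) → Ω → ℝ} {H₀ H₁ : ℝ}

/-- The limit `ρ · Ψ`, taken along the approximations with `κ = 1`. -/
def limitProcess (ρ : ℝ → ℝ) (B : ℝ → ℕ → ℝ → ℝ → Ω → ℝ) (ω : Ω) (t : I) : 𝓢'(ℝ, ℂ) :=
  limUnder atTop fun n => localSol ρ (fun s y => B 1 n s y ω) t

/-- Almost sure convergence of paths in a Bessel space implies convergence of the distributions at
every time. Uniqueness of limits identifies `Y` with `limitProcess`, which involves neither `α` nor
`r`. -/
theorem ae_toDist_limit (hW : IsWhiteNoise W P) (hH₀ : H₀ ∈ Ioo (0 : ℝ) 1) (h₁ : H₁ < 1) (ρ : Cut)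
    {α : ℝ} (hα₀ : 1 - (2 * H₀ + H₁) < α) {r : ℝ≥0∞} [Fact (1 ≤ r)]
    {B : ℝ → ℕ → ℝ → ℝ → Ω → ℝ}
    (hB : ∀ κ : ℝ, 0 < κ → ∀ n : ℕ, IsTruncatedSheet W P H₀ H₁ κ n (B κ n))
    {Y : Lp C(I, BesselSpace (-α) r) r P}
    (hY : ∀ ς : ℝ, 0 ≤ ς → ς < 2 * H₀ →
      ς < α - (1 - (2 * H₀ + H₁)) → ∃ K : ℝ≥0∞, K ≠ ∞ ∧ ∀ κ : ℝ, 0 < κ → ∀ n : ℕ,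
        eLpNorm (fun ω => cutPath W H₀ H₁ ρ (-α) r (freqCut κ n) ω - Y ω) r P ≤
          K * ENNReal.ofReal (((2 : ℝ) ^ (κ * n)) ^ (-ς))) :
    ∀ᵐ ω ∂P, ∀ t : I, (Y ω t).toDist = limitProcess ρ.toFun B ω t := by
  obtain ⟨ς, hς0, hς1⟩ := exists_between (lt_min (mul_pos two_pos hH₀.1) (sub_pos.2 hα₀))
  rw [lt_min_iff] at hς1
  obtain ⟨K, hK, h⟩ := hY ς hς0.le hς1.1 hς1.2
  have hd : ∀ᵐ ω ∂P, ∀ (n : ℕ) (t : I), (cutPath W H₀ H₁ ρ (-α) r (freqCut 1 n) ω t).toDist =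
      localSol ρ.toFun (fun s y => B 1 n s y ω) t :=
    ae_all_iff.2 fun n => ae_toDist_cutPath hW one_pos hH₀.2 h₁ (hB 1 one_pos n) ρ (-α) r
  filter_upwards [hd, ae_norm_le_of_eLpNorm_le (fun n => (aestronglyMeasurable_cutPath hW
    (isFreqCutoff_freqCut one_pos n) hH₀.2 h₁ ρ (-α) r).sub (Lp.aestronglyMeasurable Y)) Fact.out hK
    one_pos (half_lt_self hς0) (h 1 one_pos)] with ω hd ⟨C, hC⟩ t
  have hgeo : Tendsto (fun n : ℕ => C * (2 : ℝ) ^ (-(ς / 2 * 1 * n))) atTop (𝓝 0) := by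
    have h1 : (2 : ℝ) ^ (-(ς / 2)) < 1 :=
      Real.rpow_lt_one_of_one_lt_of_neg one_lt_two (by linarith)
    have h2 := (tendsto_pow_atTop_nhds_zero_of_lt_one (by positivity) h1).const_mul C
    rw [mul_zero] at h2
    refine h2.congr fun n => ?_
    rw [← Real.rpow_natCast, ← Real.rpow_mul zero_le_two]
    congr 2; ring
  have hX : Tendsto (fun n => cutPath W H₀ H₁ ρ (-α) r (freqCut 1 n) ω) atTop (𝓝 (Y ω)) :=
    tendsto_iff_norm_sub_tendsto_zero.2
      (squeeze_zero (fun n => norm_nonneg _) (fun n => hC n) hgeo)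
  have hXt : Tendsto (fun n => (cutPath W H₀ H₁ ρ (-α) r (freqCut 1 n) ω t).toDist) atTop
      (𝓝 (Y ω t).toDist) :=
    (BesselSpace.continuous_toDist.tendsto _).comp
      (((continuous_eval_const t).tendsto (Y ω)).comp hX)
  simp_rw [hd] at hXt
  exact hXt.limUnder_eq.symm

/-- Convergence in `L^r(Ω; C([0,1]; W^{-α,r}))`. -/
theorem exists_tendsto_limitProcess (hW : IsWhiteNoise W P) (hH₀ : H₀ ∈ Ioo (0 : ℝ) 1) (h₁ : H₁ < 1)
    (ρ : Cut) {α : ℝ} (hα : 0 ≤ α) (hα₀ : 1 - (2 * H₀ + H₁) < α) {r : ℝ≥0∞} [Fact (1 ≤ r)] (hr : r ≠ ∞)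
    {B : ℝ → ℕ → ℝ → ℝ → Ω → ℝ}
    (hB : ∀ κ : ℝ, 0 < κ → ∀ n : ℕ, IsTruncatedSheet W P H₀ H₁ κ n (B κ n)) {κ : ℝ} (hκ : 0 < κ) :
    ∃ (X : ℕ → Lp C(I, BesselSpace (-α) r) r P) (Y : Lp C(I, BesselSpace (-α) r) r P),
      (∀ n, ∀ᵐ ω ∂P, ∀ t : I, (X n ω t).toDist = localSol ρ.toFun (fun s y => B κ n s y ω) t) ∧
      (∀ᵐ ω ∂P, ∀ t : I, (Y ω t).toDist = limitProcess ρ.toFun B ω t) ∧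
      Tendsto X atTop (𝓝 Y) := by
  obtain ⟨Y, hY⟩ := exists_limit_cutPath ρ hW hH₀ h₁ hα hα₀ hr
  have hm := fun n => memLp_cutPath ρ hW hH₀ h₁ hα hα₀ hr hκ n
  refine ⟨fun n => (hm n).toLp _, Y, fun n => ?_, ae_toDist_limit hW hH₀ h₁ ρ hα₀ hB hY, ?_⟩
  · filter_upwards [(hm n).coeFn_toLp, ae_toDist_cutPath hW hκ hH₀.2 h₁ (hB κ hκ n) ρ (-α) r]
      with ω h1 h2 t
    rw [h1, h2 t]
  · obtain ⟨ς, hς0, hς1⟩ := exists_between (lt_min (mul_pos two_pos hH₀.1) (sub_pos.2 hα₀))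
    rw [lt_min_iff] at hς1
    obtain ⟨K, hK, h⟩ := hY ς hς0.le hς1.1 hς1.2
    rw [tendsto_iff_edist_tendsto_0]
    have h1 : ENNReal.ofReal ((2 : ℝ) ^ (-(ς * κ))) < 1 := by
      rw [ENNReal.ofReal_lt_one]
      exact Real.rpow_lt_one_of_one_lt_of_neg one_lt_two (neg_neg_of_pos (mul_pos hς0 hκ))
    have h2 := ENNReal.Tendsto.const_mul (ENNReal.tendsto_pow_atTop_nhds_zero_of_lt_one h1)
      (Or.inr hK)
    rw [mul_zero] at h2
    refine tendsto_of_tendsto_of_tendsto_of_le_of_le tendsto_const_nhds h2 (fun _ => zero_le)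
      fun n => ?_
    have e : edist ((hm n).toLp _) Y =
        eLpNorm (fun ω => cutPath W H₀ H₁ ρ (-α) r (freqCut κ n) ω - Y ω) r P := by
      rw [Lp.edist_def]
      refine eLpNorm_congr_ae ?_
      filter_upwards [(hm n).coeFn_toLp] with ω hω
      rw [Pi.sub_apply, hω]
    simp only
    rw [e]
    refine (h κ hκ n).trans (le_of_eq ?_)
    rw [← ENNReal.ofReal_pow (by positivity), ← Real.rpow_natCast, ← Real.rpow_mul zero_le_two,
      ← Real.rpow_mul zero_le_two]
    congr 3; ring

/-- The almost sure rate of convergence. -/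
theorem ae_iSup_besselENorm_le (hW : IsWhiteNoise W P) (hH₀ : H₀ ∈ Ioo (0 : ℝ) 1) (h₁ : H₁ < 1)
    (ρ : Cut) {α : ℝ} (hα : 0 ≤ α) (hα₀ : 1 - (2 * H₀ + H₁) < α) {r : ℝ≥0∞} [Fact (1 ≤ r)] (hr : r ≠ ∞)
    {B : ℝ → ℕ → ℝ → ℝ → Ω → ℝ}
    (hB : ∀ κ : ℝ, 0 < κ → ∀ n : ℕ, IsTruncatedSheet W P H₀ H₁ κ n (B κ n)) {κ : ℝ} (hκ : 0 < κ)
    {ς : ℝ} (hς : 0 < ς) (hς₀ : ς < 2 * H₀) (hςα : ς < α - (1 - (2 * H₀ + H₁))) :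
    ∀ᵐ ω ∂P, ∃ C : ℝ, ∀ n : ℕ, (⨆ t : I, besselENorm (-α) r
      (localSol ρ.toFun (fun s y => B κ n s y ω) t - limitProcess ρ.toFun B ω t)) ≤
        ENNReal.ofReal (C * (2 : ℝ) ^ (-(ς * κ * n))) := by
  obtain ⟨Y, hY⟩ := exists_limit_cutPath ρ hW hH₀ h₁ hα hα₀ hr
  -- Moments converge at a slightly better rate `ς'`; the excess is spent in the Borel–Cantelli
  -- step.
  obtain ⟨ς', hςς', hς1⟩ := exists_between (lt_min hς₀ hςα)
  rw [lt_min_iff] at hς1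
  obtain ⟨K, hK, h⟩ := hY ς' (hς.trans hςς').le hς1.1 hς1.2
  have hd : ∀ᵐ ω ∂P, ∀ (n : ℕ) (t : I), (cutPath W H₀ H₁ ρ (-α) r (freqCut κ n) ω t).toDist =
      localSol ρ.toFun (fun s y => B κ n s y ω) t :=
    ae_all_iff.2 fun n => ae_toDist_cutPath hW hκ hH₀.2 h₁ (hB κ hκ n) ρ (-α) r
  filter_upwards [hd, ae_toDist_limit hW hH₀ h₁ ρ hα₀ hB hY,
    ae_norm_le_of_eLpNorm_le (fun n => (aestronglyMeasurable_cutPath hW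
    (isFreqCutoff_freqCut hκ n) hH₀.2 h₁ ρ (-α) r).sub (Lp.aestronglyMeasurable Y)) Fact.out hK
    hκ hςς' (h κ hκ)] with ω hd hl ⟨C, hC⟩
  refine ⟨C, fun n => iSup_le fun t => ?_⟩
  rw [← hd, ← hl, ← map_sub, besselENorm_toDist, ← ofReal_norm]
  refine ENNReal.ofReal_le_ofReal (le_trans ?_ (hC n))
  exact ContinuousMap.norm_coe_le_norm
    (cutPath W H₀ H₁ ρ (-α) r (freqCut κ n) ω - Y ω) t

end LimitProcess

end RoughHeat

end

/-! ### The main theorem -/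

theorem mainTheorem2 {Ω : Type*} [MeasurableSpace Ω] (P : Measure Ω) [IsProbabilityMeasure P]
    (W : Lp ℝ 2 (volume : Measure RoughHeat.Plane) → Ω → ℝ) (hW : RoughHeat.IsWhiteNoise W P)
    (H₀ H₁ : ℝ) (hH₀ : H₀ ∈ Ioo (0 : ℝ) 1) (hH₁ : H₁ ∈ Ioo (0 : ℝ) 1) (hH : 2 * H₀ + H₁ < 1)
    (α₀ : ℝ) (hα₀ : α₀ = 1 - (2 * H₀ + H₁)) :
    -- the truncated sheets `B^{κ,n}` have smooth versions
    (∀ κ : ℝ, 0 < κ → ∀ n : ℕ, ∃ B, RoughHeat.IsTruncatedSheet W P H₀ H₁ κ n B) ∧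
    ∀ B : ℝ → ℕ → ℝ → ℝ → Ω → ℝ,
      (∀ κ : ℝ, 0 < κ → ∀ n : ℕ, RoughHeat.IsTruncatedSheet W P H₀ H₁ κ n (B κ n)) →
      -- the processes `Ψ^{κ,n} = G ∗ ∂_t∂_x B^{κ,n}` are well defined and continuous in space
      (∀ κ : ℝ, 0 < κ → ∀ n : ℕ, ∀ᵐ ω ∂P, ∀ t ∈ Icc (0 : ℝ) 1,
        (∀ x : ℝ, IntegrableOn (fun z : ℝ × ℝ => RoughHeat.heatKernel (t - z.1) (x - z.2) *
          RoughHeat.mixedDeriv (fun s y => B κ n s y ω) z.1 z.2) (Ioc 0 t ×ˢ univ)) ∧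
        Continuous fun x => RoughHeat.heatSol (fun s y => B κ n s y ω) t x) ∧
      ∀ ρ : ℝ → ℝ, ContDiff ℝ ((⊤ : ℕ∞) : WithTop ℕ∞) ρ → HasCompactSupport ρ →
        -- one limit process `ρ · Ψ`, the same for all `κ` (and all `α`, `p`)
        ∃ ρΨ : Ω → I → 𝓢'(ℝ, ℂ),
          -- convergence in `L^{2p}(Ω; C([0,1]; W^{-α,2p}(ℝ)))`
          (∀ κ : ℝ, 0 < κ → ∀ α : ℝ, α₀ < α → ∀ (p : ℝ≥0∞) [Fact (1 ≤ p)], p ≠ ∞ →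
            ∃ (X : ℕ → RoughHeat.PathSpace P α p) (Y : RoughHeat.PathSpace P α p),
              (∀ n, ∀ᵐ ω ∂P, ∀ t : I, (X n ω t).toDist =
                RoughHeat.localSol ρ (fun s y => B κ n s y ω) t) ∧
              (∀ᵐ ω ∂P, ∀ t : I, (Y ω t).toDist = ρΨ ω t) ∧
              Tendsto X atTop (𝓝 Y)) ∧
          -- almost sure rate of convergence in `C([0,1]; H^{-α}(ℝ))`
          ∀ κ : ℝ, 0 < κ → ∀ α : ℝ, α₀ < α → ∀ ς : ℝ, 0 < ς →
            ς < min (2 * H₀) (min H₁ (α - α₀)) →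
            ∀ᵐ ω ∂P, ∃ C : ℝ, ∀ n : ℕ, 1 ≤ n →
              (⨆ t : I, RoughHeat.besselENorm (-α) 2
                (RoughHeat.localSol ρ (fun s y => B κ n s y ω) t - ρΨ ω t)) ≤
                  ENNReal.ofReal (C * (2 : ℝ) ^ (-(ς * κ * n))) := by
  subst hα₀
  refine ⟨fun κ hκ n => RoughHeat.exists_isTruncatedSheet hW hκ hH₀.2 hH₁.2 n, fun B hB =>
    ⟨fun κ hκ n => RoughHeat.ae_heatSol_wellDefined hW hκ hH₀.2 hH₁.2 (hB κ hκ n),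
      fun ρ hρ hρc => ⟨RoughHeat.limitProcess ρ B, ?_, ?_⟩⟩⟩
  · intro κ hκ α hα p _ hp
    -- The Bessel order satisfies `α ≥ 0` because `2H₀ + H₁ < 1` makes the threshold positive.
    exact RoughHeat.exists_tendsto_limitProcess hW hH₀ hH₁.2 ⟨ρ, hρ, hρc⟩ (by linarith) hα
      (ENNReal.mul_ne_top (by simp) hp) hB hκ
  · intro κ hκ α hα ς hς hς'
    rw [lt_min_iff, lt_min_iff] at hς'
    filter_upwards [RoughHeat.ae_iSup_besselENorm_le (r := 2) hW hH₀ hH₁.2 ⟨ρ, hρ, hρc⟩ (by linarith)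
      hα (by simp) hB hκ hς hς'.1 hς'.2.2] with ω ⟨C, hC⟩
    exact ⟨C, fun n _ => hC n⟩
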